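/- All manifolds are smooth, Hausdorff, second countable and without boundary. A *(natural) polydifferential operator of rank $r \geq 1$ on $n$-manifolds* is an assignment $D$ to each Riemannian $n$-manifold $(M,g)$ of a linear operator $D^g \colon C^\infty(M)^{\otimes(r-1)} \to C^\infty(M)$ such that $D^g(u_1 \otimes \dotsm \otimes u_{r-1})$ is a universal (coefficients independent of $(M,g)$) $\mathbb{R}$-linear combination of complete contractions, by means of the inverse metric, of tensors $\nabla^{N_1}\mathrm{Rm} \otimes \dotsm \otimes \nabla^{N_q}\mathrm{Rm} \otimes \nabla^{P_1}u_1 \otimes \dotsm \otimes \nabla^{P_{r-1}}u_{r-1}$. Set $\mathfrak{D}^g(u_1 \otimes \dotsm \otimes u_r) := \int_M u_1 D^g(u_2 \otimes \dotsm \otimes u_r)\, \mathrm{dvol}_g$ for $u_1,\dotsc,u_r \in C_0^\infty(M)$. The operator $D$ is *formally self-adjoint* if $\mathfrak{D}^g$ is symmetric for every $(M,g)$, and *conformally covariant* if there is a $w \in \mathbb{R}$ such that $\mathfrak{D}^{e^{2\Upsilon}g}(e^{w\Upsilon}u_1 \otimes \dotsm \otimes e^{w\Upsilon}u_r) = \mathfrak{D}^g(u_1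 \otimes \dotsm \otimes u_r)$ for all $(M,g)$, all $\Upsilon \in C^\infty(M)$ and all $u_1,\dotsc,u_r \in C_0^\infty(M)$. A *conformally variational invariant* (CVI) of homogeneity $-2k$ is a polydifferential operator $I$ of rank $1$ (that is, a scalar Riemannian invariant) such that $I^{c^2g} = c^{-2k}I^g$ for all constants $c>0$, and for which there is an isometry-invariant real-valued function $F$ of compact Riemannian $n$-manifolds with $\left.\frac{d}{dt}\right|_{t=0} F(M,e^{2tu}g) = \int_M u I^g\, \mathrm{dvol}_g$ for all compact Riemannian $n$-manifolds $(M,g)$ and all $u \in C^\infty(M)$. **Theorem.** Let $n$ and $k$ be integers with $n \geq 0$, $k \geq 1$ and $n \neq 2k$, and let $I$ be a CVI of homogeneity $-2k$ on $n$-manifolds. There is an integer $r$ with $1 \leq r \leq 2k$ that is the least positive integer for which there exists a formally self-adjoint, conformally covariant, polydifferential operator $D$ of rank $r$ satisfying $$ D^g(1^{\otimes(r-1)}) = \left(\frac{n-2k}{r}\right)^{r-1} I^g \quad\text{for all } (M,g). $$ For this $r$, the operator $D$ is unique among all such operators of rank $r$. Moreover $D$ is obtained from $I$ by iterated weighted conformal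 linearization: $D^g(v^{\otimes(r-1)}) = \frac{1}{(r-1)!}L_{r-1}^g(v)$ for all $(M,g)$ and all $v \in C^\infty(M)$, where $L_0^g(v) := I^g$ and $$ L_{j}^g(v) := \left.\frac{\partial}{\partial t}\right|_{t=0} e^{\frac{(r-1)n+2k}{r}tv} L_{j-1}^{e^{2tv}g}\bigl( e^{-\frac{n-2k}{r}tv}v \bigr), \qquad j \geq 1. $$ -/

import Mathlib

open scoped Manifold ContDiff Bundle
open MeasureTheory

noncomputable section

namespace CPD

/-- The model space `ℝⁿ`. -/
abbrev Eucl (n : ℕ) : Type := EuclideanSpace ℝ (Fin n)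

/-- A smooth `n`-manifold: Hausdorff, second countable, without boundary. -/
structure SmoothManifold (n : ℕ) where
  carrier : Type
  [top : TopologicalSpace carrier]
  [charted : ChartedSpace (Eucl n) carrier]
  [smooth : IsManifold (𝓡 n) ∞ carrier]
  [t2 : T2Space carrier]
  [secondCountable : SecondCountableTopology carrier]

attribute [instance] SmoothManifold.top SmoothManifold.charted SmoothManifold.smooth
  SmoothManifold.t2 SmoothManifold.secondCountable

instance (n : ℕ) : CoeSort (SmoothManifold n) Type := ⟨SmoothManifold.carrier⟩

variable {n : ℕ}

/-- Manifolds carry their Borel σ-algebra. -/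
instance (M : SmoothManifold n) : MeasurableSpace M := borel M

instance (M : SmoothManifold n) : BorelSpace M := ⟨rfl⟩

/-- The algebra `C^∞(M)` of real-valued smooth functions. -/
abbrev Smooth (M : SmoothManifold n) : Type := ContMDiffMap (𝓡 n) 𝓘(ℝ, ℝ) M ℝ ∞

/-- Smooth Riemannian metrics on `M`. -/
abbrev Metric (M : SmoothManifold n) : Type :=
  Bundle.ContMDiffRiemannianMetric (𝓡 n) ∞ (Eucl n) (fun x : M => TangentSpace (𝓡 n) x)

/-- The charts of `M`: the members of its maximal smooth atlas. -/
def charts (M : SmoothManifold n) : Set (OpenPartialHomeomorph M (Eucl n)) :=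
  IsManifold.maximalAtlas (𝓡 n) ∞ M

/-- The smooth function `e^{a f}`. -/
def expSmooth {M : SmoothManifold n} (a : ℝ) (f : Smooth M) : Smooth M :=
  ⟨fun x => Real.exp (a * f x),
    Real.contDiff_exp.contMDiff.comp (contMDiff_const.mul f.contMDiff)⟩

/-! ### Rescaling of metrics -/

/-- The metric `f g`, for a positive smooth function `f`. -/
def rescale {M : SmoothManifold n} (g : Metric M) (f : Smooth M) (hf : ∀ x, 0 < f x) :
    Metric M where
  inner x := f x • g.inner x
  symm x v w := by
    change f x * g.inner x v w = f x * g.inner x w v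
    rw [g.symm]
  pos x v hv := mul_pos (hf x) (g.pos x v hv)
  isVonNBounded x := by
    have h := (g.isVonNBounded x).image
      ((Real.sqrt (f x))⁻¹ • ContinuousLinearMap.id ℝ (TangentSpace (𝓡 n) x))
    refine h.subset ?_
    intro v hv
    have hs : 0 < Real.sqrt (f x) := Real.sqrt_pos.2 (hf x)
    refine ⟨Real.sqrt (f x) • v, ?_, ?_⟩
    · have hv' : f x * g.inner x v v < 1 := hv
      change g.inner x (Real.sqrt (f x) • v) (Real.sqrt (f x) • v) < 1
      rw [map_smul, map_smul]
      change Real.sqrt (f x) * (Real.sqrt (f x) * g.inner x v v) < 1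
      rw [← mul_assoc, Real.mul_self_sqrt (hf x).le]
      exact hv'
    · change (Real.sqrt (f x))⁻¹ • (Real.sqrt (f x) • v) = v
      rw [smul_smul, inv_mul_cancel₀ hs.ne', one_smul]
  contMDiff := by
    have : ∀ x : M, ContinuousAdd (TangentSpace (𝓡 n) x →L[ℝ] ℝ) := fun x =>
      inferInstanceAs (ContinuousAdd (Eucl n →L[ℝ] ℝ))
    have : ∀ x : M, IsTopologicalAddGroup (TangentSpace (𝓡 n) x →L[ℝ] ℝ) := fun x =>
      inferInstanceAs (IsTopologicalAddGroup (Eucl n →L[ℝ] ℝ))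
    have : ∀ x : M, ContinuousSMul ℝ (TangentSpace (𝓡 n) x →L[ℝ] ℝ) := fun x =>
      inferInstanceAs (ContinuousSMul ℝ (Eucl n →L[ℝ] ℝ))
    exact ContMDiff.smul_section f.contMDiff g.contMDiff

/-- The conformally related metric `e^{2Υ} g`. -/
def conformal {M : SmoothManifold n} (g : Metric M) (Υ : Smooth M) : Metric M :=
  rescale g (expSmooth 2 Υ) (fun _ => Real.exp_pos _)

/-- The homothetic metric `c² g`. -/
def homothety {M : SmoothManifold n} (g : Metric M) (c : ℝ) (hc : 0 < c) : Metric M :=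
  rescale g (ContMDiffMap.const (c ^ 2)) (fun _ => show 0 < c ^ 2 from pow_pos hc 2)

/-! ### Local tensor calculus

A covariant tensor field of rank `r` in a chart is given by its components, as functions on `ℝⁿ`.
Only their values on the (open) target of the chart matter. -/

/-- Components `T_{i₁ ⋯ i_r}(y)` of a covariant tensor of rank `r` on `ℝⁿ`. -/
abbrev Tensor (n r : ℕ) : Type := (Fin r → Fin n) → Eucl n → ℝ

/-- The partial derivative `∂_a f` on `ℝⁿ`. -/
def partialD (a : Fin n) (f : Eucl n → ℝ) (y : Eucl n) : ℝ :=
  fderiv ℝ f y (EuclideanSpace.single a 1)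

/-- The components `g_{ij}` of the metric in the chart `e`. -/
def gram {M : SmoothManifold n} (g : Metric M) (e : OpenPartialHomeomorph M (Eucl n))
    (y : Eucl n) : Matrix (Fin n) (Fin n) ℝ :=
  Matrix.of fun i j =>
    g.inner (e.symm y)
      (mfderiv (𝓡 n) (𝓡 n) e.symm y (EuclideanSpace.single i (1 : ℝ) : Eucl n))
      (mfderiv (𝓡 n) (𝓡 n) e.symm y (EuclideanSpace.single j (1 : ℝ) : Eucl n))

/-- The Christoffel symbol `Γ^c_{ab}` of the metric with components `G`. -/
def christoffel (G : Eucl n → Matrix (Fin n) (Fin n) ℝ) (c a b : Fin n) (y : Eucl n) : ℝ :=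
  (1 / 2) * ∑ d, (G y)⁻¹ c d *
    (partialD a (fun z => G z d b) y + partialD b (fun z => G z d a) y
      - partialD d (fun z => G z a b) y)

/-- The covariant derivative, the new index being the first one:
`(∇T)_{a i₁ ⋯ i_r} = ∂_a T_{i₁ ⋯ i_r} - ∑_s Γ^c_{a i_s} T_{i₁ ⋯ c ⋯ i_r}`. -/
def covDeriv (G : Eucl n → Matrix (Fin n) (Fin n) ℝ) {r : ℕ} (T : Tensor n r) :
    Tensor n (r + 1) :=
  fun idx y =>
    partialD (idx 0) (T (Fin.tail idx)) y
      - ∑ s : Fin r, ∑ c : Fin n,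
          christoffel G c (idx 0) (Fin.tail idx s) y * T (Function.update (Fin.tail idx) s c) y

/-- The iterated covariant derivative `∇^N T`. -/
def iterCovDeriv (G : Eucl n → Matrix (Fin n) (Fin n) ℝ) {r : ℕ} (T : Tensor n r) :
    (N : ℕ) → Tensor n (r + N)
  | 0 => T
  | N + 1 => covDeriv G (iterCovDeriv G T N)

/-- The components `R_{ijk}{}^l` of the curvature:
`∇_{∂_i} ∇_{∂_j} ∂_k - ∇_{∂_j} ∇_{∂_i} ∂_k = ∑_l R_{ijk}{}^l ∂_l`. -/
def riemannUp (G : Eucl n → Matrix (Fin n) (Fin n) ℝ) (i j k l : Fin n) (y : Eucl n) : ℝ :=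
  partialD i (christoffel G l j k) y - partialD j (christoffel G l i k) y
    + ∑ p, (christoffel G p j k y * christoffel G l i p y
        - christoffel G p i k y * christoffel G l j p y)

/-- The Riemann curvature tensor `Rm`, with components `R_{ijkl} = ∑_p g_{lp} R_{ijk}{}^p`. -/
def riemann (G : Eucl n → Matrix (Fin n) (Fin n) ℝ) : Tensor n 4 :=
  fun idx y => ∑ p, G y (idx 3) p * riemannUp G (idx 0) (idx 1) (idx 2) p y

/-! ### Complete contractions -/

/-- A recipe for a complete contraction of
`∇^{N_1} Rm ⊗ ⋯ ⊗ ∇^{N_q} Rm ⊗ ∇^{P_1} u_1 ⊗ ⋯ ⊗ ∇^{P_ℓ} u_ℓ`: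
the numbers of derivatives, and a partition of all the tensor slots into pairs. -/
structure Contraction (ℓ : ℕ) where
  /-- number of curvature factors -/
  q : ℕ
  N : Fin q → ℕ
  P : Fin ℓ → ℕ
  /-- number of pairs -/
  m : ℕ
  pairing : Fin m × Fin 2 ≃ (Σ i : Fin q, Fin (4 + N i)) ⊕ (Σ j : Fin ℓ, Fin (0 + P j))

/-- The value at the point with coordinates `y` of the complete contraction, computed in the chart
`e`: each pair of slots is contracted with the inverse metric. -/
def Contraction.eval {ℓ : ℕ} (α : Contraction ℓ) {M : SmoothManifold n} (g : Metric M)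
    (u : Fin ℓ → Smooth M) (e : OpenPartialHomeomorph M (Eucl n)) (y : Eucl n) : ℝ :=
  ∑ idx : ((Σ i : Fin α.q, Fin (4 + α.N i)) ⊕ (Σ j : Fin ℓ, Fin (0 + α.P j))) → Fin n,
    (∏ p : Fin α.m, (gram g e y)⁻¹ (idx (α.pairing (p, 0))) (idx (α.pairing (p, 1))))
      * (∏ i : Fin α.q,
          iterCovDeriv (gram g e) (riemann (gram g e)) (α.N i) (fun s => idx (Sum.inl ⟨i, s⟩)) y)
      * (∏ j : Fin ℓ,
          iterCovDeriv (gram g e) (r := 0) (fun _ z => u j (e.symm z)) (α.P j)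
            (fun s => idx (Sum.inr ⟨j, s⟩)) y)

/-! ### Polydifferential operators -/

/-- An assignment, to each Riemannian `n`-manifold `(M, g)`, of a linear map
`C^∞(M)^{⊗ℓ} → C^∞(M)`, written as an `ℓ`-linear map. Its rank is `ℓ + 1`. -/
abbrev PolyOp (n ℓ : ℕ) : Type 1 :=
  ∀ (M : SmoothManifold n), Metric M → MultilinearMap ℝ (fun _ : Fin ℓ => Smooth M) (Smooth M)

/-- `D` is a natural polydifferential operator: a linear combination of complete contractions whose
coefficients do not depend on the manifold, the metric, the functions, the point or the chart. -/
def IsNatural {ℓ : ℕ} (D : PolyOp n ℓ) : Prop :=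
  ∃ (K : ℕ) (c : Fin K → ℝ) (α : Fin K → Contraction ℓ),
    ∀ (M : SmoothManifold n) (g : Metric M) (u : Fin ℓ → Smooth M),
      ∀ e ∈ charts M, ∀ x ∈ e.source,
        D M g u x = ∑ s, c s * (α s).eval g u e (e x)

/-- `D` has homogeneity `h`: `D^{c² g} = c^h D^g` for all constants `c > 0`. -/
def HasHomogeneity {ℓ : ℕ} (D : PolyOp n ℓ) (h : ℝ) : Prop :=
  ∀ (M : SmoothManifold n) (g : Metric M) (c : ℝ) (hc : 0 < c),
    D M (homothety g c hc) = c ^ h • D M g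

/-- The measure `√(det g_{ij}) dy` of the chart `e`, transported to `M` (supported on the domain
of the chart). -/
def chartMeasure {M : SmoothManifold n} (g : Metric M) (e : OpenPartialHomeomorph M (Eucl n)) :
    Measure M :=
  Measure.map e.symm
    ((volume.restrict e.target).withDensity
      (fun y => ENNReal.ofReal (Real.sqrt (gram g e y).det)))

/-- The Riemannian volume measure `dvol_g`: the measure whose restriction to the domain of each
chart is `√(det g_{ij}) dy`. It is obtained by gluing, as the least measure that dominates all these
local measures. -/
def vol {M : SmoothManifold n} (g : Metric M) : Measure M :=
  ⨆ e ∈ charts M, chartMeasure g e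

/-- The Dirichlet form `𝔇^g(u_0 ⊗ ⋯ ⊗ u_ℓ) = ∫_M u_0 D^g(u_1 ⊗ ⋯ ⊗ u_ℓ) dvol_g`. -/
def dirichlet {ℓ : ℕ} (D : PolyOp n ℓ) {M : SmoothManifold n} (g : Metric M)
    (u : Fin (ℓ + 1) → Smooth M) : ℝ :=
  ∫ x, u 0 x * D M g (fun j => u j.succ) x ∂(vol g)

/-- `D` is formally self-adjoint: its Dirichlet form is symmetric on `C_0^∞(M)^{⊗(ℓ+1)}`. -/
def IsFormallySelfAdjoint {ℓ : ℕ} (D : PolyOp n ℓ) : Prop :=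
  ∀ (M : SmoothManifold n) (g : Metric M) (u : Fin (ℓ + 1) → Smooth M),
    (∀ i, HasCompactSupport (u i)) →
      ∀ σ : Equiv.Perm (Fin (ℓ + 1)), dirichlet D g (fun i => u (σ i)) = dirichlet D g u

/-- Conformal covariance: for some weight `w`, if `ĝ = e^{2Υ} g`, then
`𝔇^ĝ(e^{wΥ} u_0 ⊗ ⋯ ⊗ e^{wΥ} u_ℓ) = 𝔇^g(u_0 ⊗ ⋯ ⊗ u_ℓ)`. -/
def IsConformallyCovariant {ℓ : ℕ} (D : PolyOp n ℓ) : Prop :=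
  ∃ w : ℝ, ∀ (M : SmoothManifold n) (g : Metric M) (Υ : Smooth M) (u : Fin (ℓ + 1) → Smooth M),
    (∀ i, HasCompactSupport (u i)) →
      dirichlet D (conformal g Υ) (fun i => expSmooth w Υ * u i) = dirichlet D g u

/-! ### Conformally variational invariants -/

/-- A scalar assignment `I` is a polydifferential operator of rank `1`; this is the function `I^g`. -/
def value (I : PolyOp n 0) {M : SmoothManifold n} (g : Metric M) : Smooth M :=
  I M g (fun i => i.elim0)

/-- A Riemannian functional: a real-valued function of compact Riemannian `n`-manifolds which is
invariant under isometries. (The values of `F` on noncompact manifolds are irrelevant.) -/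
def IsRiemannianFunctional (F : ∀ M : SmoothManifold n, Metric M → ℝ) : Prop :=
  ∀ (M N : SmoothManifold n) (_ : CompactSpace M) (_ : CompactSpace N) (g : Metric M) (h : Metric N)
    (Φ : Diffeomorph (𝓡 n) (𝓡 n) M N ∞),
    (∀ (x : M) (v w : TangentSpace (𝓡 n) x),
      h.inner (Φ x) (mfderiv (𝓡 n) (𝓡 n) Φ x v) (mfderiv (𝓡 n) (𝓡 n) Φ x w) = g.inner x v w) →
    F M g = F N h

/-- A conformally variational invariant of homogeneity `-2k`: a scalar Riemannian invariant,
homogeneous, which is the `L²`-gradient of a Riemannian functional under conformal variations: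
`d/dt|_{t=0} F(e^{2tu} g) = ∫_M u I^g dvol_g`. -/
def IsCVI (I : PolyOp n 0) (k : ℕ) : Prop :=
  IsNatural I ∧ HasHomogeneity I (-(2 * (k : ℝ))) ∧
    ∃ F : ∀ M : SmoothManifold n, Metric M → ℝ, IsRiemannianFunctional F ∧
      ∀ (M : SmoothManifold n) (_ : CompactSpace M) (g : Metric M) (u : Smooth M),
        HasDerivAt (fun t : ℝ => F M (conformal g (t • u)))
          (∫ x, u x * value I g x ∂(vol g)) 0

/-- `D` is a formally self-adjoint, conformally covariant, polydifferential operator of rank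
`r = ℓ + 1` such that `D^g(1^{⊗(r-1)}) = ((n-2k)/r)^{r-1} I^g`. -/
structure IsAssociated (I : PolyOp n 0) (k : ℕ) {ℓ : ℕ} (D : PolyOp n ℓ) : Prop where
  natural : IsNatural D
  selfAdjoint : IsFormallySelfAdjoint D
  covariant : IsConformallyCovariant D
  apply_one : ∀ (M : SmoothManifold n) (g : Metric M),
    D M g (fun _ => 1) = (((n : ℝ) - 2 * k) / (ℓ + 1 : ℝ)) ^ ℓ • value I g

/-- The iterated weighted conformal linearizations of `I` for the rank `r`, on the diagonal:
`L_0^g(v) = I^g` and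
`L_{j+1}^g(v) = ∂/∂t|_{t=0} e^{((r-1)n+2k)/r · tv} L_j^{e^{2tv} g}(e^{-(n-2k)/r · tv} v)`. -/
def iterLinearization (I : PolyOp n 0) (k r : ℕ) :
    ℕ → ∀ M : SmoothManifold n, Metric M → Smooth M → M → ℝ
  | 0 => fun _ g _ x => value I g x
  | j + 1 => fun M g v x =>
      deriv (fun t : ℝ =>
        Real.exp ((((r : ℝ) - 1) * n + 2 * k) / r * (t * v x)) *
          iterLinearization I k r j M (conformal g (t • v))
            (expSmooth (-((n : ℝ) - 2 * k) / r) (t • v) * v) x) 0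

end CPD

end

/-! Put `μ = 2k/(n-2k)` and consider the metrics `v^{2μ} g` for positive functions `v`. The
transformation laws of the Levi-Civita connection and of the curvature (`IsNat.exists_covI_conf`,
`exists_riemann_conf`) show that `v^{2kμ} I^{v^{2μ}g}` is a universal combination of terms `v^{-p}
β(v, …, v)`, where `β` is a complete contraction containing `p` factors `v`, each differentiated at
least once, and has order `2k`, a curvature counting for two derivatives
(`Contraction.conformal_expansion`, `exists_expansion`). Hence `p ≤ 2k`, and `E(v) = v^{2k+2kμ}
I^{v^{2μ}g}` is the diagonal of a natural operator of degree `2k` (`IsNatural.exists_polarization`).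

Since `nμ = 2kμ + 2k`, the derivative of `F(v^{2μ}g)` along `v ↦ e^{tφ}v` is `μ ∫ φ E(v) dvol_g`.
Equality of the mixed second derivatives makes `∫ φ dE_v(ψv) dvol_g` symmetric in `φ` and `ψ`
(`IsCVI.symmetric`).

The decisive point is that `E` is divisible by `v`, so that the degree drops to `2k-1`. The only
terms not visibly divisible are those with `p = 2k`; they contain no curvature and only first
derivatives, and add up to `C|∇v|^{2k}` (`Contraction.evalG_top`). Take `φ = 1`, `ψ = 1/v`, `v = s +
χ` on the sphere: the symmetry says that `∫ E(s+χ)/(s+χ)` is a polynomial in `s`. Dividing with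
remainder by `s + χ`, where the remainder is the value `C|∇χ|^{2k}` at `s = -χ`, the integral `∫
C|∇χ|^{2k}/(s+χ)` is a polynomial in `s` that tends to zero at infinity. It vanishes, and `C = 0`
because `χ` is not constant (`IsCVI.integral_remainder`, `IsCVI.top_coefficient`).

So `v D(v) = b E(v)` for a symmetric natural `D` of rank `2k` (`IsCVI.exists_lower`).
Differentiating this relation turns the symmetry for `E` into self-adjointness of `D` on compact
manifolds (`IsCVI.symmetric_lower`). As `D` is local and every metric on a compact part of a chart
occurs on a sphere (`exists_sphere_model`), self-adjointness holds on all manifolds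
(`IsNatural.symmetric_of_sphere`). Covariance is immediate from `D(v) = b v^{nμ-1} I^{v^{2μ}g}`
(`HasDiagonal`). This gives existence in rank `2k`, hence a least rank `r ≤ 2k`.

Conversely let `D` be associated with `I ≠ 0` in any rank `r`. Constant rescalings force the weight
to be `-(n-2k)/r` (`IsAssociated.weight_eq`). Covariance with the conformal factor that turns `v`
into `1` then expresses the diagonal of `D` through `I` (`IsAssociated.hasDiagonal`), and
polarization gives uniqueness. In `L_j`, covariance moves the variation of the metric onto the
arguments equal to `1`, so each linearization replaces one of them by a multiple of `v`
(`IsAssociated.iterLinearization_eq`). If `I = 0`, the least rank is `1` and `D = I`. -/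

noncomputable section

namespace CPD

variable {n : ℕ}

/-! ### Partial derivatives -/

lemma partialD_add {a : Fin n} {f h : Eucl n → ℝ} {y : Eucl n} (hf : DifferentiableAt ℝ f y)
    (hh : DifferentiableAt ℝ h y) :
    partialD a (fun z => f z + h z) y = partialD a f y + partialD a h y := by
  simp [partialD, fderiv_fun_add hf hh]

lemma partialD_mul {a : Fin n} {f h : Eucl n → ℝ} {y : Eucl n} (hf : DifferentiableAt ℝ f y)
    (hh : DifferentiableAt ℝ h y) :
    partialD a (fun z => f z * h z) y = f y * partialD a h y + partialD a f y * h y := by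
  simp only [partialD, fderiv_fun_mul hf hh, add_apply,
    smul_apply, smul_eq_mul]
  ring

lemma partialD_const (a : Fin n) (c : ℝ) (y : Eucl n) : partialD a (fun _ => c) y = 0 := by
  simp [partialD]

lemma partialD_const_mul {a : Fin n} (c : ℝ) {f : Eucl n → ℝ} {y : Eucl n} :
    partialD a (fun z => c * f z) y = c * partialD a f y := by
  have : (fun z => c * f z) = c • f := rfl
  simp [partialD, this, fderiv_const_smul_field]

lemma partialD_sum {κ : Type*} {s : Finset κ} {a : Fin n} {f : κ → Eucl n → ℝ} {y : Eucl n}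
    (hf : ∀ i ∈ s, DifferentiableAt ℝ (f i) y) :
    partialD a (fun z => ∑ i ∈ s, f i z) y = ∑ i ∈ s, partialD a (f i) y := by
  simp [partialD, fderiv_fun_sum hf]

lemma partialD_congr {a : Fin n} {f h : Eucl n → ℝ} {y : Eucl n} (hf : f =ᶠ[nhds y] h) :
    partialD a f y = partialD a h y := by
  simp [partialD, hf.fderiv_eq]

lemma partialD_congr_on {U : Set (Eucl n)} (hU : IsOpen U) {a : Fin n} {f h : Eucl n → ℝ}
    {y : Eucl n} (hy : y ∈ U) (hf : ∀ z ∈ U, f z = h z) : partialD a f y = partialD a h y :=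
  partialD_congr (Filter.eventually_of_mem (hU.mem_nhds hy) hf)

lemma contDiffAt_partialD {a : Fin n} {f : Eucl n → ℝ} {y : Eucl n} (hf : ContDiffAt ℝ ∞ f y) :
    ContDiffAt ℝ ∞ (partialD a f) y := by
  have := hf.fderiv_right (m := ∞) (by simp)
  exact this.clm_apply contDiffAt_const

lemma smooth_diffAt {f : Eucl n → ℝ} {y : Eucl n} (hf : ContDiffAt ℝ ∞ f y) :
    DifferentiableAt ℝ f y := hf.differentiableAt (by simp)

/-! ### Local data: a metric and a positive function on an open subset of `ℝⁿ` -/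

/-- A nondegenerate smooth symmetric matrix field and a positive smooth function on an open set. -/
structure LocalData (n : ℕ) where
  U : Set (Eucl n)
  isOpen : IsOpen U
  G : Eucl n → Matrix (Fin n) (Fin n) ℝ
  smoothG : ∀ y ∈ U, ∀ i j, ContDiffAt ℝ ∞ (fun z => G z i j) y
  symmG : ∀ y ∈ U, ∀ i j, G y i j = G y j i
  detG : ∀ y ∈ U, IsUnit (G y).det
  v : Eucl n → ℝ
  smoothv : ∀ y ∈ U, ContDiffAt ℝ ∞ v y
  posv : ∀ y ∈ U, 0 < v y

/-- Families of tensors over the local data, with slots indexed by `ι`. -/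
abbrev Fam (n : ℕ) (ι : Type) : Type := LocalData n → (ι → Fin n) → Eucl n → ℝ

/-- Cramer's rule: the adjugate is polynomial in the entries, and the determinant does not vanish at
`y`. -/
lemma contDiffAt_matrix_inv {G : Eucl n → Matrix (Fin n) (Fin n) ℝ} {y : Eucl n}
    (hG : ∀ i j, ContDiffAt ℝ ∞ (fun z => G z i j) y) (hd : IsUnit (G y).det) (i j : Fin n) :
    ContDiffAt ℝ ∞ (fun z => (G z)⁻¹ i j) y := by
  have hdet : ∀ H : Eucl n → Matrix (Fin n) (Fin n) ℝ,
      (∀ i j, ContDiffAt ℝ ∞ (fun z => H z i j) y) → ContDiffAt ℝ ∞ (fun z => (H z).det) y := by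
    intro H hH
    simp only [Matrix.det_apply]
    refine ContDiffAt.sum fun σ _ => ?_
    refine ContDiffAt.const_smul _ ?_
    exact contDiffAt_prod fun i _ => hH _ _
  have hadj : ContDiffAt ℝ ∞ (fun z => (G z).adjugate i j) y := by
    simp only [Matrix.adjugate_apply]
    refine hdet _ fun k l => ?_
    by_cases hk : k = j
    · subst hk; simpa using contDiffAt_const
    · simpa [Matrix.updateRow_ne hk] using hG k l
  have : (fun z => (G z)⁻¹ i j) = fun z => ((G z).det)⁻¹ * (G z).adjugate i j := by
    funext z
    rw [Matrix.inv_def, Matrix.smul_apply, Ring.inverse_eq_inv', smul_eq_mul]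
  rw [this]
  exact ((hdet G hG).inv hd.ne_zero).mul hadj

lemma contDiffAt_christoffel {G : Eucl n → Matrix (Fin n) (Fin n) ℝ} {y : Eucl n}
    (hG : ∀ i j, ContDiffAt ℝ ∞ (fun z => G z i j) y) (hd : IsUnit (G y).det) (c a b : Fin n) :
    ContDiffAt ℝ ∞ (christoffel G c a b) y := by
  unfold christoffel
  refine contDiffAt_const.mul (ContDiffAt.sum fun d _ => ?_)
  refine (contDiffAt_matrix_inv hG hd c d).mul ?_
  exact ((contDiffAt_partialD (hG d b)).add (contDiffAt_partialD (hG d a))).sub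
    (contDiffAt_partialD (hG a b))

lemma contDiffAt_riemann {G : Eucl n → Matrix (Fin n) (Fin n) ℝ} {y : Eucl n}
    (hG : ∀ i j, ContDiffAt ℝ ∞ (fun z => G z i j) y) (hd : IsUnit (G y).det)
    (idx : Fin 4 → Fin n) : ContDiffAt ℝ ∞ (riemann G idx) y := by
  have hC := fun c a b => contDiffAt_christoffel hG hd c a b
  unfold riemann riemannUp
  refine ContDiffAt.sum fun p _ => (hG _ _).mul ?_
  refine ((contDiffAt_partialD (hC _ _ _)).sub (contDiffAt_partialD (hC _ _ _))).add ?_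
  exact ContDiffAt.sum fun p _ => ((hC _ _ _).mul (hC _ _ _)).sub ((hC _ _ _).mul (hC _ _ _))

/-! ### The covariant derivative with arbitrary index types -/

open Classical in
/-- The covariant derivative of a tensor with slots `ι`; the new slot is `none`. -/
def covI (G : Eucl n → Matrix (Fin n) (Fin n) ℝ) {ι : Type} [Fintype ι]
    (T : (ι → Fin n) → Eucl n → ℝ) (idx : Option ι → Fin n) (y : Eucl n) : ℝ :=
  partialD (idx none) (T fun i => idx (some i)) y
    - ∑ s : ι, ∑ c : Fin n, christoffel G c (idx none) (idx (some s)) y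
        * T (Function.update (fun i => idx (some i)) s c) y

/-- Slots indexed by arbitrary finite types make products and contractions free of renumbering; this
lemma is the bridge to the numbered slots, the new slot `0` becoming `none`. -/
lemma covDeriv_eq_covI (G : Eucl n → Matrix (Fin n) (Fin n) ℝ) {r : ℕ} (T : Tensor n r)
    (idx : Fin (r + 1) → Fin n) (y : Eucl n) :
    covDeriv G T idx y = covI G T (idx ∘ (finSuccEquiv r).symm) y := by
  have h : (fun i : Fin r => (idx ∘ (finSuccEquiv r).symm) (some i)) = Fin.tail idx := by
    funext i; simp [Fin.tail]
  unfold covDeriv covI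
  rw [h]
  simp only [Function.comp_apply, finSuccEquiv_symm_none, finSuccEquiv_symm_some]
  congr 1
  refine Finset.sum_congr rfl fun s _ => Finset.sum_congr rfl fun c _ => ?_
  congr!

lemma contDiffAt_covI {G : Eucl n → Matrix (Fin n) (Fin n) ℝ} {y : Eucl n}
    (hG : ∀ i j, ContDiffAt ℝ ∞ (fun z => G z i j) y) (hd : IsUnit (G y).det)
    {ι : Type} [Fintype ι] {T : (ι → Fin n) → Eucl n → ℝ}
    (hT : ∀ idx, ContDiffAt ℝ ∞ (T idx) y) (idx : Option ι → Fin n) :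
    ContDiffAt ℝ ∞ (covI G T idx) y := by
  unfold covI
  refine (contDiffAt_partialD (hT _)).sub ?_
  refine ContDiffAt.sum fun s _ => ContDiffAt.sum fun c _ => ?_
  exact (contDiffAt_christoffel hG hd _ _ _).mul (hT _)

lemma contDiffAt_iterCovDeriv {G : Eucl n → Matrix (Fin n) (Fin n) ℝ} {y : Eucl n}
    (hG : ∀ i j, ContDiffAt ℝ ∞ (fun z => G z i j) y) (hd : IsUnit (G y).det)
    {r : ℕ} {T : Tensor n r} (hT : ∀ idx, ContDiffAt ℝ ∞ (T idx) y) (N : ℕ)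
    (idx : Fin (r + N) → Fin n) : ContDiffAt ℝ ∞ (iterCovDeriv G T N idx) y := by
  induction N with
  | zero => exact hT idx
  | succ N ih =>
    have : iterCovDeriv G T (N + 1) idx
        = covI G (iterCovDeriv G T N) (idx ∘ (finSuccEquiv (r + N)).symm) :=
      funext fun z => covDeriv_eq_covI G _ idx z
    rw [this]
    exact contDiffAt_covI hG hd ih _

/-! ### Symmetries of the Levi-Civita connection and parallelism of the metric -/

section Metric

variable (D : LocalData n) {y : Eucl n} (hy : y ∈ D.U)
include hy

lemma LocalData.inv_mul_cancel : (D.G y)⁻¹ * D.G y = 1 :=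
  Matrix.nonsing_inv_mul _ (D.detG y hy)

lemma LocalData.mul_inv_cancel : D.G y * (D.G y)⁻¹ = 1 :=
  Matrix.mul_nonsing_inv _ (D.detG y hy)

lemma LocalData.inv_symm (i j : Fin n) : (D.G y)⁻¹ i j = (D.G y)⁻¹ j i := by
  have h : (D.G y).transpose = D.G y := by
    ext i j; exact D.symmG y hy j i
  have := congrFun (congrFun (Matrix.transpose_nonsing_inv (D.G y)) j) i
  rw [h] at this
  exact this

lemma LocalData.partialD_symm (a i j : Fin n) :
    partialD a (fun z => D.G z i j) y = partialD a (fun z => D.G z j i) y :=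
  partialD_congr_on D.isOpen hy fun z hz => D.symmG z hz i j

lemma LocalData.christoffel_symm (c a b : Fin n) :
    christoffel D.G c a b y = christoffel D.G c b a y := by
  unfold christoffel
  congr 1
  refine Finset.sum_congr rfl fun d _ => ?_
  rw [D.partialD_symm hy d a b]
  ring

lemma LocalData.lower_christoffel (c a b : Fin n) :
    ∑ d, D.G y c d * christoffel D.G d a b y
      = (1 / 2) * (partialD a (fun z => D.G z c b) y + partialD b (fun z => D.G z c a) y
        - partialD c (fun z => D.G z a b) y) := by
  have h : ∀ e, ∑ d, D.G y c d * (D.G y)⁻¹ d e = if c = e then 1 else 0 := fun e => by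
    have := congrFun (congrFun (D.mul_inv_cancel hy) c) e
    rwa [Matrix.mul_apply, Matrix.one_apply] at this
  set S : Fin n → ℝ := fun e => partialD a (fun z => D.G z e b) y
    + partialD b (fun z => D.G z e a) y - partialD e (fun z => D.G z a b) y with hS
  have : ∀ d, D.G y c d * christoffel D.G d a b y
      = ∑ e, (1 / 2) * ((D.G y c d * (D.G y)⁻¹ d e) * S e) := fun d => by
    unfold christoffel
    rw [Finset.mul_sum, Finset.mul_sum]
    refine Finset.sum_congr rfl fun e _ => ?_
    simp only [hS]; ring
  simp only [this]
  rw [Finset.sum_comm]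
  simp only [← Finset.mul_sum, ← Finset.sum_mul, h]
  simp [hS]

/-- Metric compatibility. -/
lemma LocalData.partialD_metric (a i j : Fin n) :
    partialD a (fun z => D.G z i j) y
      = ∑ d, (christoffel D.G d a i y * D.G y d j + christoffel D.G d a j y * D.G y i d) := by
  have h1 : ∑ d, christoffel D.G d a i y * D.G y d j
      = ∑ d, D.G y j d * christoffel D.G d a i y :=
    Finset.sum_congr rfl fun d _ => by rw [D.symmG y hy d j, mul_comm]
  have h2 : ∑ d, christoffel D.G d a j y * D.G y i d
      = ∑ d, D.G y i d * christoffel D.G d a j y :=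
    Finset.sum_congr rfl fun d _ => by rw [mul_comm]
  rw [Finset.sum_add_distrib, h1, h2, D.lower_christoffel hy, D.lower_christoffel hy,
    D.partialD_symm hy a j i, D.partialD_symm hy i a j, D.partialD_symm hy j a i]
  ring

lemma LocalData.contDiffAt_inv (i j : Fin n) : ContDiffAt ℝ ∞ (fun z => (D.G z)⁻¹ i j) y :=
  contDiffAt_matrix_inv (D.smoothG y hy) (D.detG y hy) i j

/-- Differentiate `G⁻¹ G = 1` and insert metric compatibility in the matrix form `∂G = Aᵀ G + G A`,
where `A` is the matrix of Christoffel symbols in the direction `a`. -/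
lemma LocalData.partialD_inv (a i j : Fin n) :
    partialD a (fun z => (D.G z)⁻¹ i j) y
      = - ∑ d, (christoffel D.G i a d y * (D.G y)⁻¹ d j
          + christoffel D.G j a d y * (D.G y)⁻¹ i d) := by
  set H := (D.G y)⁻¹ with hH
  set dH : Matrix (Fin n) (Fin n) ℝ := Matrix.of fun i j => partialD a (fun z => (D.G z)⁻¹ i j) y
    with hdH
  set dG : Matrix (Fin n) (Fin n) ℝ := Matrix.of fun i j => partialD a (fun z => D.G z i j) y
    with hdG
  set A : Matrix (Fin n) (Fin n) ℝ := Matrix.of fun c b => christoffel D.G c a b y with hA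
  have e1 : dG = A.transpose * D.G y + D.G y * A := by
    ext i j
    simp only [hdG, hA, Matrix.of_apply, Matrix.add_apply, Matrix.mul_apply,
      Matrix.transpose_apply]
    rw [D.partialD_metric hy, Finset.sum_add_distrib]
    congr 1
    exact Finset.sum_congr rfl fun d _ => mul_comm _ _
  have e2 : dH * D.G y + H * dG = 0 := by
    ext i j
    have h : partialD a (fun z => ∑ k, (D.G z)⁻¹ i k * D.G z k j) y = 0 := by
      rw [partialD_congr_on D.isOpen hy (h := fun _ => (1 : Matrix (Fin n) (Fin n) ℝ) i j)]
      · exact partialD_const _ _ _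
      · intro z hz
        rw [← D.inv_mul_cancel hz, Matrix.mul_apply]
    rw [partialD_sum] at h
    · simp only [Matrix.add_apply, Matrix.mul_apply, Matrix.zero_apply, ← Finset.sum_add_distrib]
      rw [← h]
      refine Finset.sum_congr rfl fun k _ => ?_
      rw [partialD_mul (smooth_diffAt (D.contDiffAt_inv hy i k))
        (smooth_diffAt (D.smoothG y hy k j))]
      simp only [hdH, hdG, Matrix.of_apply, hH]
      ring
    · intro k _
      exact (smooth_diffAt (D.contDiffAt_inv hy i k)).mul
        (smooth_diffAt (D.smoothG y hy k j))
  have e3 : dH = -(A * H + H * A.transpose) := by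
    have h1 : dH = dH * D.G y * H := by
      rw [mul_assoc, hH, D.mul_inv_cancel hy, mul_one]
    have h2 : dH * D.G y = - (H * dG) := eq_neg_of_add_eq_zero_left e2
    rw [h1, h2, e1, mul_add, ← mul_assoc H (D.G y), hH, D.inv_mul_cancel hy, one_mul, neg_mul,
      add_mul, ← hH, mul_assoc, mul_assoc, hH, D.mul_inv_cancel hy, mul_one, add_comm]
  have := congrFun (congrFun e3 i) j
  simp only [hdH, hA, Matrix.of_apply, Matrix.neg_apply, Matrix.add_apply, Matrix.mul_apply,
    Matrix.transpose_apply] at this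
  rw [this, Finset.sum_add_distrib]
  congr 2
  exact Finset.sum_congr rfl fun d _ => mul_comm _ _

end Metric

/-! ### Natural tensor families -/

/-- The natural tensor families of order `d` built from the curvature, from the covariant
derivatives of `v` divided by `v`, and from the metric. -/
inductive IsNat : ℕ → (ι : Type) → [Fintype ι] → Fam n ι → Prop
  | rm (N : ℕ) : IsNat (N + 2) (Fin (4 + N))
      (fun D idx y => iterCovDeriv D.G (riemann D.G) N idx y)
  | dv (P : ℕ) : IsNat (P + 1) (Fin (0 + (P + 1)))
      (fun D idx y => (D.v y)⁻¹ * iterCovDeriv D.G (r := 0) (fun _ => D.v) (P + 1) idx y)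
  | metric : IsNat 0 (Fin 2) (fun D idx y => D.G y (idx 0) (idx 1))
  | mul {d d' : ℕ} {ι κ : Type} [Fintype ι] [Fintype κ] {S : Fam n ι} {T : Fam n κ} :
      IsNat d ι S → IsNat d' κ T → IsNat (d + d') (ι ⊕ κ)
        (fun D idx y => S D (fun i => idx (Sum.inl i)) y * T D (fun i => idx (Sum.inr i)) y)
  | contract {d : ℕ} {ι : Type} [Fintype ι] {T : Fam n (ι ⊕ Fin 2)} : IsNat d (ι ⊕ Fin 2) T →
      IsNat d ι (fun D idx y => ∑ a, ∑ b, (D.G y)⁻¹ a b * T D (Sum.elim idx ![a, b]) y)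
  | reindex {d : ℕ} {ι κ : Type} [Fintype ι] [Fintype κ] {T : Fam n ι} (e : ι ≃ κ) :
      IsNat d ι T → IsNat d κ (fun D idx y => T D (fun i => idx (e i)) y)
  | zero (d : ℕ) (ι : Type) [Fintype ι] : IsNat d ι (fun _ _ _ => 0)
  | add {d : ℕ} {ι : Type} [Fintype ι] {S T : Fam n ι} : IsNat d ι S → IsNat d ι T →
      IsNat d ι (fun D idx y => S D idx y + T D idx y)
  | smul {d : ℕ} {ι : Type} [Fintype ι] {T : Fam n ι} (c : ℝ) : IsNat d ι T →
      IsNat d ι (fun D idx y => c * T D idx y)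
  | congr {d d' : ℕ} {ι : Type} [Fintype ι] {S T : Fam n ι} : IsNat d ι S → d = d' →
      (∀ (D : LocalData n) idx, ∀ y ∈ D.U, T D idx y = S D idx y) → IsNat d' ι T

lemma IsNat.sum {d : ℕ} {ι : Type} [Fintype ι] {κ : Type*} (s : Finset κ) {T : κ → Fam n ι}
    (h : ∀ i ∈ s, IsNat d ι (T i)) : IsNat d ι (fun D idx y => ∑ i ∈ s, T i D idx y) := by
  classical
  induction s using Finset.induction_on with
  | empty => simpa using IsNat.zero d ι
  | insert i s hi ih =>
    refine ((h i (Finset.mem_insert_self _ _)).add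
      (ih fun j hj => h j (Finset.mem_insert_of_mem hj))).congr rfl fun D idx y _ => ?_
    rw [Finset.sum_insert hi]

lemma LocalData.contDiffAt_iter_v (D : LocalData n) {y : Eucl n} (hy : y ∈ D.U) (P : ℕ)
    (idx : Fin (0 + P) → Fin n) :
    ContDiffAt ℝ ∞ (iterCovDeriv D.G (r := 0) (fun _ => D.v) P idx) y :=
  contDiffAt_iterCovDeriv (D.smoothG y hy) (D.detG y hy) (fun _ => D.smoothv y hy) P idx

theorem IsNat.smooth {d : ℕ} {ι : Type} [Fintype ι] {T : Fam n ι} (h : IsNat d ι T)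
    (D : LocalData n) (idx : ι → Fin n) {y : Eucl n} (hy : y ∈ D.U) :
    ContDiffAt ℝ ∞ (T D idx) y := by
  induction h with
  | rm N =>
    exact contDiffAt_iterCovDeriv (D.smoothG y hy) (D.detG y hy)
      (contDiffAt_riemann (D.smoothG y hy) (D.detG y hy)) N idx
  | dv P => exact ((D.smoothv y hy).inv (D.posv y hy).ne').mul (D.contDiffAt_iter_v hy _ _)
  | metric => exact D.smoothG y hy _ _
  | mul _ _ ihS ihT => exact (ihS _).mul (ihT _)
  | contract _ ih =>
    exact ContDiffAt.sum fun a _ => ContDiffAt.sum fun b _ => (D.contDiffAt_inv hy a b).mul (ih _)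
  | reindex e _ ih => exact ih _
  | zero d ι => exact contDiffAt_const
  | add _ _ ihS ihT => exact (ihS _).add (ihT _)
  | smul c _ ih => exact contDiffAt_const.mul (ih _)
  | congr _ _ hST ih =>
    exact (ih idx).congr_of_eventuallyEq
      (Filter.eventually_of_mem (D.isOpen.mem_nhds hy) fun z hz => hST D idx z hz)

/-- Moving the new slot to the left factor. -/
def optionSumLeft (ι κ : Type) : Option ι ⊕ κ ≃ Option (ι ⊕ κ) where
  toFun := Sum.elim (fun o => o.elim none fun i => some (Sum.inl i)) fun k => some (Sum.inr k)
  invFun o := o.elim (Sum.inl none) (Sum.elim (fun i => Sum.inl (some i)) Sum.inr)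
  left_inv := by rintro ((_ | _) | _) <;> rfl
  right_inv := by rintro (_ | _ | _) <;> rfl

/-- Moving the new slot to the right factor. -/
def optionSumRight (ι κ : Type) : ι ⊕ Option κ ≃ Option (ι ⊕ κ) where
  toFun := Sum.elim (fun i => some (Sum.inl i)) (fun o => o.elim none fun k => some (Sum.inr k))
  invFun o := o.elim (Sum.inr none) (Sum.elim Sum.inl fun k => Sum.inr (some k))
  left_inv := by rintro (_ | _ | _) <;> rfl
  right_inv := by rintro (_ | _ | _) <;> rfl

/-! ### Leibniz, contraction and relabelling rules for the covariant derivative -/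

section CovRules

variable {G : Eucl n → Matrix (Fin n) (Fin n) ℝ} {y : Eucl n}

lemma covI_congr_on {U : Set (Eucl n)} (hU : IsOpen U) (hy : y ∈ U) {ι : Type} [Fintype ι]
    {S T : (ι → Fin n) → Eucl n → ℝ} (h : ∀ idx, ∀ z ∈ U, S idx z = T idx z)
    (idx : Option ι → Fin n) : covI G S idx y = covI G T idx y := by
  unfold covI
  rw [partialD_congr_on hU hy (h _)]
  congr 1
  exact Finset.sum_congr rfl fun s _ => Finset.sum_congr rfl fun c _ => by rw [h _ y hy]

-- Leibniz rule: the Christoffel corrections over the slots `ι ⊕ κ` split into those of each factor.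
open Classical in
lemma covI_mul {ι κ : Type} [Fintype ι] [Fintype κ] {S : (ι → Fin n) → Eucl n → ℝ}
    {T : (κ → Fin n) → Eucl n → ℝ} (hS : ∀ idx, DifferentiableAt ℝ (S idx) y)
    (hT : ∀ idx, DifferentiableAt ℝ (T idx) y) (idx : Option (ι ⊕ κ) → Fin n) :
    covI G (fun idx y => S (fun i => idx (Sum.inl i)) y * T (fun i => idx (Sum.inr i)) y) idx y
      = covI G S (fun o => idx (optionSumLeft ι κ (Sum.inl o))) y
          * T (fun i => idx (some (Sum.inr i))) y
        + S (fun i => idx (some (Sum.inl i))) y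
          * covI G T (fun o => idx (optionSumRight ι κ (Sum.inr o))) y := by
  have hl : ∀ (inst : DecidableEq (ι ⊕ κ)) (f : ι ⊕ κ → Fin n) (s : ι) (c : Fin n), (fun i =>
      Function.update f (Sum.inl s) c (Sum.inl i)) = Function.update (fun i => f (Sum.inl i)) s c :=
    fun _ f s c => Sum.update_inl_comp_inl
  have hr : ∀ (inst : DecidableEq (ι ⊕ κ)) (f : ι ⊕ κ → Fin n) (s : κ) (c : Fin n), (fun i =>
      Function.update f (Sum.inr s) c (Sum.inr i)) = Function.update (fun i => f (Sum.inr i)) s c :=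
    fun _ f s c => Sum.update_inr_comp_inr
  have hlr : ∀ (inst : DecidableEq (ι ⊕ κ)) (f : ι ⊕ κ → Fin n) (s : ι) (c : Fin n), (fun i =>
      Function.update f (Sum.inl s) c (Sum.inr i)) = fun i => f (Sum.inr i) :=
    fun _ f s c => by funext i; simp
  have hrl : ∀ (inst : DecidableEq (ι ⊕ κ)) (f : ι ⊕ κ → Fin n) (s : κ) (c : Fin n), (fun i =>
      Function.update f (Sum.inr s) c (Sum.inl i)) = fun i => f (Sum.inl i) :=
    fun _ f s c => by funext i; simp
  unfold covI
  rw [partialD_mul (hS _) (hT _)]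
  simp only [Fintype.sum_sum_type, hl, hr, hlr, hrl, optionSumLeft, optionSumRight,
    Equiv.coe_fn_mk, Sum.elim_inl, Sum.elim_inr, Option.elim_none, Option.elim_some]
  simp only [sub_mul, mul_sub, Finset.sum_mul, Finset.mul_sum]
  have e1 : ∀ a b c d : ℝ, a * (b * c) = b * (a * c) := fun _ _ _ _ => by ring
  simp only [← mul_assoc]
  have e2 : ∀ a b c : ℝ, a * b * c = b * a * c := fun _ _ _ => by ring
  simp only [e2 (S _ _)]
  ring

lemma covI_reindex {ι κ : Type} [Fintype ι] [Fintype κ] {T : (ι → Fin n) → Eucl n → ℝ}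
    (e : ι ≃ κ) (idx : Option κ → Fin n) :
    covI G (fun idx y => T (fun i => idx (e i)) y) idx y
      = covI G T (fun o => idx (e.optionCongr o)) y := by
  unfold covI
  simp only [Equiv.optionCongr_apply, Option.map_none, Option.map_some]
  congr 1
  rw [← e.sum_comp]
  refine Finset.sum_congr rfl fun s _ => Finset.sum_congr rfl fun c _ => ?_
  congr 2
  funext i
  by_cases h : i = s <;> simp [h]

lemma covI_add {ι : Type} [Fintype ι] {S T : (ι → Fin n) → Eucl n → ℝ}
    (hS : ∀ idx, DifferentiableAt ℝ (S idx) y)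
    (hT : ∀ idx, DifferentiableAt ℝ (T idx) y) (idx : Option ι → Fin n) :
    covI G (fun idx y => S idx y + T idx y) idx y = covI G S idx y + covI G T idx y := by
  unfold covI
  rw [partialD_add (hS _) (hT _)]
  simp only [mul_add, Finset.sum_add_distrib]
  ring

lemma covI_smul {ι : Type} [Fintype ι] {T : (ι → Fin n) → Eucl n → ℝ} (c : ℝ)
    (idx : Option ι → Fin n) :
    covI G (fun idx y => c * T idx y) idx y = c * covI G T idx y := by
  unfold covI
  rw [partialD_const_mul]
  simp only [mul_sub, Finset.mul_sum]
  congr 1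
  exact Finset.sum_congr rfl fun s _ => Finset.sum_congr rfl fun d _ => by ring

lemma LocalData.covI_metric (D : LocalData n) (hy : y ∈ D.U) (idx : Option (Fin 2) → Fin n) :
    covI D.G (fun idx y => D.G y (idx 0) (idx 1)) idx y = 0 := by
  unfold covI
  rw [D.partialD_metric hy]
  simp [Fin.sum_univ_two, Finset.sum_add_distrib]

-- Contraction commutes with `∇` because the inverse metric is parallel: its derivative, written
-- with Christoffel symbols, cancels the corrections belonging to the two contracted slots (`t1` and
-- `t2`), while `t3` only rearranges the corrections of the free slots.
open Classical in
lemma LocalData.covI_contract (D : LocalData n) (hy : y ∈ D.U) {ι : Type} [Fintype ι]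
    {T : (ι ⊕ Fin 2 → Fin n) → Eucl n → ℝ} (hT : ∀ idx, DifferentiableAt ℝ (T idx) y)
    (idx : Option ι → Fin n) :
    covI D.G (fun idx y => ∑ a, ∑ b, (D.G y)⁻¹ a b * T (Sum.elim idx ![a, b]) y) idx y
      = ∑ a, ∑ b, (D.G y)⁻¹ a b * covI D.G T (fun o =>
          Sum.elim idx ![a, b] ((optionSumLeft ι (Fin 2)).symm o)) y := by
  have hH : ∀ a b, DifferentiableAt ℝ (fun z => (D.G z)⁻¹ a b) y := fun a b =>
    smooth_diffAt (D.contDiffAt_inv hy a b)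
  have h0 : ∀ a b c : Fin n, (Function.update (![a, b] : Fin 2 → Fin n) 0 c) = ![c, b] :=
    fun a b c => by ext i; fin_cases i <;> simp
  have h1 : ∀ a b c : Fin n, (Function.update (![a, b] : Fin 2 → Fin n) 1 c) = ![a, c] :=
    fun a b c => by ext i; fin_cases i <;> simp
  have helim : ∀ a b, (fun i : ι ⊕ Fin 2 => Sum.elim idx ![a, b]
      ((optionSumLeft ι (Fin 2)).symm (some i))) = Sum.elim (fun i => idx (some i)) ![a, b] :=
    fun a b => by funext i; rcases i with i | i <;> rfl
  have hn : ∀ a b, Sum.elim idx ![a, b] ((optionSumLeft ι (Fin 2)).symm none) = idx none :=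
    fun a b => rfl
  unfold covI
  simp only [hn, fun a b i => congrFun (helim a b) i]
  have hs := partialD_sum (s := Finset.univ) (a := idx none) (y := y)
    (f := fun a z => ∑ b, (D.G z)⁻¹ a b * T (Sum.elim (fun i => idx (some i)) ![a, b]) z)
    (fun a _ => DifferentiableAt.fun_sum fun b _ => (hH a b).mul (hT _))
  rw [hs]
  have hp : ∀ a, partialD (idx none) (fun z => ∑ b, (D.G z)⁻¹ a b
        * T (Sum.elim (fun i => idx (some i)) ![a, b]) z) y
      = ∑ b, ((D.G y)⁻¹ a b * partialD (idx none)
            (T (Sum.elim (fun i => idx (some i)) ![a, b])) y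
        - ∑ d, (christoffel D.G a (idx none) d y * (D.G y)⁻¹ d b
            + christoffel D.G b (idx none) d y * (D.G y)⁻¹ a d)
          * T (Sum.elim (fun i => idx (some i)) ![a, b]) y) := fun a => by
    have hs := partialD_sum (s := Finset.univ) (a := idx none) (y := y)
      (f := fun b z => (D.G z)⁻¹ a b * T (Sum.elim (fun i => idx (some i)) ![a, b]) z)
      (fun b _ => (hH a b).mul (hT _))
    rw [hs]
    refine Finset.sum_congr rfl fun b _ => ?_
    rw [partialD_mul (hH a b) (hT _), D.partialD_inv hy, ← Finset.sum_mul]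
    ring
  simp only [hp, Fintype.sum_sum_type, Fin.sum_univ_two, Sum.update_elim_inl,
    Sum.update_elim_inr, h0, h1, Sum.elim_inl, Sum.elim_inr, Matrix.cons_val_zero,
    Matrix.cons_val_one, mul_sub, mul_add, add_mul, Finset.sum_add_distrib, Finset.sum_sub_distrib,
    Finset.mul_sum]
  set X : Fin n → Fin n → ℝ := fun a b => T (Sum.elim (fun i => idx (some i)) ![a, b]) y
  set Γ : Fin n → Fin n → ℝ := fun a d => christoffel D.G a (idx none) d y
  set H := (D.G y)⁻¹
  have t1 : ∑ a, ∑ b, ∑ d, Γ a d * H d b * X a b = ∑ a, ∑ b, ∑ d, H a b * (Γ d a * X d b) := by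
    calc _ = ∑ b, ∑ a, ∑ d, Γ a d * H d b * X a b := Finset.sum_comm
      _ = ∑ b, ∑ d, ∑ a, Γ a d * H d b * X a b :=
          Finset.sum_congr rfl fun b _ => Finset.sum_comm
      _ = ∑ d, ∑ b, ∑ a, Γ a d * H d b * X a b := Finset.sum_comm
      _ = _ := Finset.sum_congr rfl fun a _ => Finset.sum_congr rfl fun b _ =>
          Finset.sum_congr rfl fun d _ => by ring
  have t2 : ∑ a, ∑ b, ∑ d, Γ b d * H a d * X a b = ∑ a, ∑ b, ∑ d, H a b * (Γ d b * X a d) := by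
    refine Finset.sum_congr rfl fun a _ => ?_
    rw [Finset.sum_comm]
    exact Finset.sum_congr rfl fun b _ => Finset.sum_congr rfl fun d _ => by ring
  have t3 : ∑ s : ι, ∑ c, ∑ a, ∑ b, christoffel D.G c (idx none) (idx (some s)) y * (H a b
        * T (Sum.elim (Function.update (fun i => idx (some i)) s c) ![a, b]) y)
      = ∑ a, ∑ b, ∑ s : ι, ∑ c, H a b * (christoffel D.G c (idx none) (idx (some s)) y
        * T (Sum.elim (Function.update (fun i => idx (some i)) s c) ![a, b]) y) := by
    calc _ = ∑ s : ι, ∑ a, ∑ c, ∑ b, christoffel D.G c (idx none) (idx (some s)) y * (H a b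
        * T (Sum.elim (Function.update (fun i => idx (some i)) s c) ![a, b]) y) :=
          Finset.sum_congr rfl fun s _ => Finset.sum_comm
      _ = ∑ a, ∑ s : ι, ∑ c, ∑ b, christoffel D.G c (idx none) (idx (some s)) y * (H a b
        * T (Sum.elim (Function.update (fun i => idx (some i)) s c) ![a, b]) y) := Finset.sum_comm
      _ = ∑ a, ∑ s : ι, ∑ b, ∑ c, christoffel D.G c (idx none) (idx (some s)) y * (H a b
        * T (Sum.elim (Function.update (fun i => idx (some i)) s c) ![a, b]) y) :=
          Finset.sum_congr rfl fun a _ => Finset.sum_congr rfl fun s _ => Finset.sum_comm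
      _ = ∑ a, ∑ b, ∑ s : ι, ∑ c, christoffel D.G c (idx none) (idx (some s)) y * (H a b
        * T (Sum.elim (Function.update (fun i => idx (some i)) s c) ![a, b]) y) :=
          Finset.sum_congr rfl fun a _ => Finset.sum_comm
      _ = _ := Finset.sum_congr rfl fun a _ => Finset.sum_congr rfl fun b _ =>
          Finset.sum_congr rfl fun s _ => Finset.sum_congr rfl fun c _ => by ring
  rw [t3]
  linarith [t1, t2]

end CovRules

/-- Natural tensor families are closed under covariant differentiation. -/
theorem IsNat.cov {d : ℕ} {ι : Type} [Fintype ι] {T : Fam n ι} (h : IsNat d ι T) :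
    IsNat (d + 1) (Option ι) (fun D idx y => covI D.G (T D) idx y) := by
  induction h with
  | rm N =>
    refine ((IsNat.rm (N + 1)).reindex (finSuccEquiv (4 + N))).congr rfl fun D idx y _ => ?_
    refine Eq.trans ?_ (covDeriv_eq_covI D.G (iterCovDeriv D.G (riemann D.G) N) _ y).symm
    congr 1
    funext o
    simp
  | dv P =>
    -- Quotient rule: `∇(v⁻¹ ∇^{P+1} v) = v⁻¹ ∇^{P+2} v - (v⁻¹ ∇v) ⊗ (v⁻¹ ∇^{P+1} v)`.
    refine (((IsNat.dv (P + 1)).reindex (finSuccEquiv (0 + (P + 1)))).add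
      ((((IsNat.dv 0).mul (IsNat.dv P)).reindex
        ((Equiv.sumCongr (finSuccEquiv 0) (Equiv.refl _)).trans
          ((optionSumLeft _ _).trans (Equiv.optionCongr (Equiv.emptySum (Fin 0) _))))).smul (-1)
        |>.congr (by omega : 0 + 1 + (P + 1) = P + 1 + 1) fun D idx y _ => rfl)).congr rfl
      fun D idx y hy => ?_
    have hv := smooth_diffAt (D.smoothv y hy)
    have hp := D.posv y hy
    have hX := fun idx => smooth_diffAt (D.contDiffAt_iter_v hy (P + 1) idx)
    have hinv : partialD (idx none) (fun z => (D.v z)⁻¹) y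
        = - ((D.v y)⁻¹ * (D.v y)⁻¹ * partialD (idx none) D.v y) := by
      have h := (hasDerivAt_inv hp.ne').comp_hasFDerivAt y hv.hasFDerivAt
      have h' : fderiv ℝ (fun z => (D.v z)⁻¹) y = _ := h.fderiv
      unfold partialD
      rw [h']
      simp [pow_two]
    have hmul := partialD_mul (a := idx none) (hv.fun_inv hp.ne') (hX fun i => idx (some i))
    have e1 : iterCovDeriv D.G (r := 0) (fun _ => D.v) (P + 1 + 1)
        (fun i => idx (finSuccEquiv (0 + (P + 1)) i)) y
        = covI D.G (iterCovDeriv D.G (r := 0) (fun _ => D.v) (P + 1)) idx y := by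
      refine (covDeriv_eq_covI D.G _ _ y).trans ?_
      congr 1
      funext o
      simp
    have e2 : iterCovDeriv D.G (r := 0) (fun _ => D.v) (0 + 1) (fun i => idx
        (((Equiv.sumCongr (finSuccEquiv 0) (Equiv.refl (Fin (0 + (P + 1))))).trans
          ((optionSumLeft _ _).trans (Equiv.optionCongr (Equiv.emptySum (Fin 0) _))))
            (Sum.inl i))) y = partialD (idx none) D.v y := by
      refine (covDeriv_eq_covI D.G _ _ y).trans ?_
      simp [covI, iterCovDeriv, optionSumLeft]
    refine Eq.trans ?_ (congrArg₂ (fun A B => (D.v y)⁻¹ * A + -1 * ((D.v y)⁻¹ * B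
      * ((D.v y)⁻¹ * iterCovDeriv D.G (r := 0) (fun _ => D.v) (P + 1)
        (fun i => idx (some i)) y))) e1 e2).symm
    unfold covI
    rw [hmul, hinv]
    simp only [mul_sub, Finset.mul_sum, mul_left_comm _ (D.v y)⁻¹]
    ring
  | metric =>
    exact (IsNat.zero 1 (Option (Fin 2))).congr rfl fun D idx y hy => D.covI_metric hy idx
  | mul hS hT ihS ihT =>
    refine (((ihS.mul hT).reindex (optionSumLeft _ _)).congr (by omega) fun D idx y _ => rfl).add
      (((hS.mul ihT).reindex (optionSumRight _ _))) |>.congr (by omega) fun D idx y hy => ?_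
    exact covI_mul (fun i => smooth_diffAt (hS.smooth D i hy))
      (fun i => smooth_diffAt (hT.smooth D i hy)) idx
  | contract hT ih =>
    refine (ih.reindex (optionSumLeft _ _).symm).contract.congr rfl fun D idx y hy => ?_
    exact D.covI_contract hy (fun i => smooth_diffAt (hT.smooth D i hy)) idx
  | reindex e _ ih =>
    exact (ih.reindex e.optionCongr).congr rfl fun D idx y _ => covI_reindex e idx
  | zero d ι =>
    exact (IsNat.zero (d + 1) (Option ι)).congr rfl fun D idx y _ => by
      simp [covI, partialD_const]
  | add hS hT ihS ihT =>
    exact (ihS.add ihT).congr rfl fun D idx y hy =>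
      covI_add (fun i => smooth_diffAt (hS.smooth D i hy))
        (fun i => smooth_diffAt (hT.smooth D i hy)) idx
  | smul c _ ih => exact (ih.smul c).congr rfl fun D idx y _ => covI_smul c idx
  | congr _ hd hST ih =>
    exact ih.congr (by omega) fun D idx y hy => covI_congr_on D.isOpen hy (hST D) idx

/-! ### Conformal change of the covariant derivative and of the curvature -/

/-- The conformally related matrix field `v^{2μ} G`. -/
def LocalData.conf (D : LocalData n) (μ : ℝ) (y : Eucl n) : Matrix (Fin n) (Fin n) ℝ :=
  (D.v y ^ (2 * μ)) • D.G y

/-- The logarithmic derivative of `v`. -/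
def LocalData.dlog (D : LocalData n) (a : Fin n) (y : Eucl n) : ℝ := (D.v y)⁻¹ * partialD a D.v y

/-- The difference of the Levi-Civita connections of `v^{2μ} G` and `G`. -/
def LocalData.connDiff (D : LocalData n) (μ : ℝ) (c a b : Fin n) (y : Eucl n) : ℝ :=
  μ * ((if c = a then D.dlog b y else 0) + (if c = b then D.dlog a y else 0)
    - (∑ d, (D.G y)⁻¹ c d * D.dlog d y) * D.G y a b)

section

variable (D : LocalData n) {y : Eucl n} (hy : y ∈ D.U)
include hy

lemma LocalData.contDiffAt_dlog (a : Fin n) : ContDiffAt ℝ ∞ (D.dlog a) y :=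
  ((D.smoothv y hy).inv (D.posv y hy).ne').mul (contDiffAt_partialD (D.smoothv y hy))

lemma LocalData.contDiffAt_connDiff (μ : ℝ) (c a b : Fin n) :
    ContDiffAt ℝ ∞ (D.connDiff μ c a b) y := by
  have h := fun a => D.contDiffAt_dlog hy a
  unfold connDiff
  refine contDiffAt_const.mul (ContDiffAt.sub (ContDiffAt.add ?_ ?_) ?_)
  · split_ifs
    exacts [h b, contDiffAt_const]
  · split_ifs
    exacts [h a, contDiffAt_const]
  · exact (ContDiffAt.sum fun d _ => (D.contDiffAt_inv hy c d).mul (h d)).mul (D.smoothG y hy a b)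

lemma LocalData.contDiffAt_rpow (μ : ℝ) : ContDiffAt ℝ ∞ (fun z => D.v z ^ μ) y :=
  (D.smoothv y hy).rpow_const_of_ne (D.posv y hy).ne'

lemma LocalData.partialD_rpow (μ : ℝ) (a : Fin n) :
    partialD a (fun z => D.v z ^ (2 * μ)) y = D.v y ^ (2 * μ) * (2 * μ * D.dlog a y) := by
  have hp := D.posv y hy
  have h := (smooth_diffAt (D.smoothv y hy)).hasFDerivAt.rpow_const (p := 2 * μ) (Or.inl hp.ne')
  unfold partialD dlog
  rw [h.fderiv, Real.rpow_sub_one hp.ne']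
  simp only [smul_apply, smul_eq_mul, partialD]
  field_simp

/-- In the formula for the Christoffel symbols, the factors `v^{2μ}` and `v^{-2μ}` cancel except
where the derivative falls on `v^{2μ}`, producing `2μ dlog v`; the three such terms form `connDiff`.
-/
lemma LocalData.christoffel_conf (μ : ℝ) (c a b : Fin n) :
    christoffel (D.conf μ) c a b y = christoffel D.G c a b y + D.connDiff μ c a b y := by
  have hp : 0 < D.v y ^ (2 * μ) := Real.rpow_pos_of_pos (D.posv y hy) _
  have hinv : (D.conf μ y)⁻¹ = (D.v y ^ (2 * μ))⁻¹ • (D.G y)⁻¹ := by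
    unfold conf
    have := Matrix.inv_smul' (A := D.G y) (Units.mk0 _ hp.ne') (D.detG y hy)
    simpa [Units.smul_def] using this
  have hpd : ∀ e i j, partialD e (fun z => D.conf μ z i j) y
      = D.v y ^ (2 * μ) * (partialD e (fun z => D.G z i j) y
        + 2 * μ * D.dlog e y * D.G y i j) := fun e i j => by
    have h := partialD_mul (a := e) (smooth_diffAt (D.contDiffAt_rpow hy (2 * μ)))
      (smooth_diffAt (D.smoothG y hy i j))
    rw [D.partialD_rpow hy] at h
    refine h.trans ?_
    ring
  have hone : ∀ c b, ∑ d, (D.G y)⁻¹ c d * D.G y d b = if c = b then 1 else 0 := fun c b => by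
    have := congrFun (congrFun (D.inv_mul_cancel hy) c) b
    rwa [Matrix.mul_apply, Matrix.one_apply] at this
  unfold christoffel connDiff
  have hterm : ∀ d, (D.conf μ y)⁻¹ c d * (partialD a (fun z => D.conf μ z d b) y
        + partialD b (fun z => D.conf μ z d a) y - partialD d (fun z => D.conf μ z a b) y)
      = (D.G y)⁻¹ c d * (partialD a (fun z => D.G z d b) y + partialD b (fun z => D.G z d a) y
          - partialD d (fun z => D.G z a b) y)
        + 2 * μ * (D.dlog a y * ((D.G y)⁻¹ c d * D.G y d b)
          + D.dlog b y * ((D.G y)⁻¹ c d * D.G y d a)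
          - (D.G y)⁻¹ c d * D.dlog d y * D.G y a b) := fun d => by
    rw [hpd, hpd, hpd, hinv, Matrix.smul_apply, smul_eq_mul]
    field_simp
    ring
  simp only [hterm, Finset.sum_add_distrib, ← Finset.mul_sum, Finset.sum_sub_distrib, hone,
    ← Finset.sum_mul]
  split_ifs <;> ring

-- The weight `v^{2μ}` of the tensor is the one carried by the curvature with lowered indices. The
-- new terms are `2μ dlog v ⊗ T`, from the weight, and one correction by `connDiff` for each slot;
-- all are natural of one order higher, with the same weight in front, so the formula can be
-- iterated.
open Classical in
lemma LocalData.covI_conf (μ : ℝ) {ι : Type} [Fintype ι] {T : (ι → Fin n) → Eucl n → ℝ}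
    (hT : ∀ idx, DifferentiableAt ℝ (T idx) y) (idx : Option ι → Fin n) :
    covI (D.conf μ) (fun idx z => D.v z ^ (2 * μ) * T idx z) idx y
      = D.v y ^ (2 * μ) * (covI D.G T idx y
        + (2 * μ) * (D.dlog (idx none) y * T (fun i => idx (some i)) y)
        + ∑ s : ι, ((-μ) * (D.dlog (idx (some s)) y
              * T (Function.update (fun i => idx (some i)) s (idx none)) y)
            + (-μ) * (D.dlog (idx none) y * T (fun i => idx (some i)) y)
            + μ * ∑ a, ∑ b, (D.G y)⁻¹ a b * (D.G y (idx none) (idx (some s))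
              * (D.dlog a y * T (Function.update (fun i => idx (some i)) s b) y)))) := by
  have h := partialD_mul (a := idx none) (smooth_diffAt (D.contDiffAt_rpow hy (2 * μ)))
    (hT fun i => idx (some i))
  unfold covI
  rw [h, D.partialD_rpow hy]
  have hs : ∀ s : ι, ∑ c, christoffel (D.conf μ) c (idx none) (idx (some s)) y
        * (D.v y ^ (2 * μ) * T (Function.update (fun i => idx (some i)) s c) y)
      = D.v y ^ (2 * μ) * (∑ c, christoffel D.G c (idx none) (idx (some s)) y
          * T (Function.update (fun i => idx (some i)) s c) y
        - ((-μ) * (D.dlog (idx (some s)) y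
              * T (Function.update (fun i => idx (some i)) s (idx none)) y)
            + (-μ) * (D.dlog (idx none) y * T (fun i => idx (some i)) y)
            + μ * ∑ a, ∑ b, (D.G y)⁻¹ a b * (D.G y (idx none) (idx (some s))
              * (D.dlog a y * T (Function.update (fun i => idx (some i)) s b) y)))) := fun s => by
    have hc : ∀ c, christoffel (D.conf μ) c (idx none) (idx (some s)) y
        * (D.v y ^ (2 * μ) * T (Function.update (fun i => idx (some i)) s c) y)
      = D.v y ^ (2 * μ) * (christoffel D.G c (idx none) (idx (some s)) y
          * T (Function.update (fun i => idx (some i)) s c) y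
        + μ * ((if c = idx none then D.dlog (idx (some s)) y
              * T (Function.update (fun i => idx (some i)) s c) y else 0)
          + (if c = idx (some s) then D.dlog (idx none) y
              * T (Function.update (fun i => idx (some i)) s c) y else 0)
          - ∑ a, (D.G y)⁻¹ a c * (D.G y (idx none) (idx (some s))
              * (D.dlog a y * T (Function.update (fun i => idx (some i)) s c) y)))) := fun c => by
      rw [D.christoffel_conf hy]
      have e : ∑ a, (D.G y)⁻¹ a c * (D.G y (idx none) (idx (some s))
              * (D.dlog a y * T (Function.update (fun i => idx (some i)) s c) y))
          = (∑ d, (D.G y)⁻¹ c d * D.dlog d y) * (D.G y (idx none) (idx (some s)))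
            * T (Function.update (fun i => idx (some i)) s c) y := by
        rw [Finset.sum_mul, Finset.sum_mul]
        exact Finset.sum_congr rfl fun a _ => by rw [D.inv_symm hy a c]; ring
      rw [e]
      unfold connDiff
      split_ifs <;> ring
    have hu : Function.update (fun i => idx (some i)) s (idx (some s)) = fun i => idx (some i) :=
      Function.update_eq_self s _
    simp only [hc, ← Finset.mul_sum, Finset.sum_add_distrib, Finset.sum_sub_distrib,
      Finset.sum_ite_eq', Finset.mem_univ, if_true, hu]
    rw [Finset.sum_comm]
    ring
  simp only [hs, ← Finset.mul_sum, Finset.sum_sub_distrib]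
  ring

/-- The curvature of `∇ + C` is `R + ∇_i C_j - ∇_j C_i + [C_i, C_j]`. Indices are lowered by `G`,
which commutes with `∇`, so that the difference tensor enters through the natural tensor `Cl`; the
Christoffel terms in the antisymmetrized slots `i, j` cancel because the connection is torsion free.
-/
lemma LocalData.lower_riemann_conf (μ : ℝ) (i j k l : Fin n) {Cl : (Fin 3 → Fin n) → Eucl n → ℝ}
    (hCl : ∀ idx, ∀ z ∈ D.U, Cl idx z = ∑ c, D.G z (idx 0) c * D.connDiff μ c (idx 1) (idx 2) z) :
    ∑ p, D.G y l p * riemannUp (D.conf μ) i j k p y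
      = ∑ p, D.G y l p * riemannUp D.G i j k p y
        + (covI D.G Cl (fun o => o.elim i ![l, j, k]) y
          - covI D.G Cl (fun o => o.elim j ![l, i, k]) y)
        + (∑ q, ∑ r, (D.G y)⁻¹ q r * (Cl ![r, j, k] y * Cl ![l, i, q] y)
          - ∑ q, ∑ r, (D.G y)⁻¹ q r * (Cl ![r, i, k] y * Cl ![l, j, q] y)) := by
  set Γ := fun c a b => christoffel D.G c a b y with hΓ
  set C := fun c a b => D.connDiff μ c a b y with hC
  set g := D.G y with hg
  have hdC : ∀ c a b, DifferentiableAt ℝ (D.connDiff μ c a b) y := fun c a b =>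
    smooth_diffAt (D.contDiffAt_connDiff hy μ c a b)
  have hdΓ : ∀ c a b, DifferentiableAt ℝ (christoffel D.G c a b) y := fun c a b =>
    smooth_diffAt (contDiffAt_christoffel (D.smoothG y hy) (D.detG y hy) c a b)
  have hpd : ∀ e c a b, partialD e (christoffel (D.conf μ) c a b) y
      = partialD e (christoffel D.G c a b) y + partialD e (D.connDiff μ c a b) y := by
    intro e c a b
    rw [← partialD_add (hdΓ c a b) (hdC c a b)]
    exact partialD_congr_on D.isOpen hy fun z hz => D.christoffel_conf hz μ c a b
  have hCly : ∀ a b c, Cl ![a, b, c] y = ∑ d, g a d * C d b c := fun a b c => by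
    rw [hCl _ y hy]; simp [hg, hC]
  -- the partial derivative of the lowered difference tensor
  have hA : ∀ i j k, ∑ p, g l p * (partialD i (D.connDiff μ p j k) y + ∑ q, C q j k * Γ p i q)
      = partialD i (Cl ![l, j, k]) y - ∑ c, Γ c i l * Cl ![c, j, k] y := by
    intro i j k
    have h1 : partialD i (Cl ![l, j, k]) y
        = ∑ c, (g l c * partialD i (D.connDiff μ c j k) y
          + (∑ d, (Γ d i l * g d c + Γ d i c * g l d)) * C c j k) := by
      rw [partialD_congr_on D.isOpen hy (h := fun z => ∑ c, D.G z l c * D.connDiff μ c j k z)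
        (fun z hz => by rw [hCl _ z hz]; simp), partialD_sum]
      · refine Finset.sum_congr rfl fun c _ => ?_
        rw [partialD_mul (smooth_diffAt (D.smoothG y hy l c)) (hdC c j k), D.partialD_metric hy]
      · exact fun c _ => (smooth_diffAt (D.smoothG y hy l c)).mul (hdC c j k)
    rw [h1]
    simp only [hCly, Finset.sum_add_distrib, mul_add, add_mul, Finset.sum_mul, Finset.mul_sum]
    have h2 : ∑ c, ∑ d, Γ d i l * g d c * C c j k = ∑ c, ∑ d, Γ c i l * (g c d * C d j k) := by
      rw [Finset.sum_comm]
      exact Finset.sum_congr rfl fun _ _ => Finset.sum_congr rfl fun _ _ => by ring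
    have h3 : ∑ c, ∑ d, Γ d i c * g l d * C c j k = ∑ c, ∑ d, g l c * (C d j k * Γ c i d) := by
      rw [Finset.sum_comm]
      exact Finset.sum_congr rfl fun _ _ => Finset.sum_congr rfl fun _ _ => by ring
    rw [h2, h3]; ring
  have hQ : ∀ i j, ∑ q, ∑ r, (D.G y)⁻¹ q r * (Cl ![r, j, k] y * Cl ![l, i, q] y)
      = ∑ q, C q j k * Cl ![l, i, q] y := by
    intro i j
    refine Finset.sum_congr rfl fun q _ => ?_
    have : ∑ r, (D.G y)⁻¹ q r * Cl ![r, j, k] y = C q j k := by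
      have h : ∀ d, ∑ r, (D.G y)⁻¹ q r * g r d = if q = d then 1 else 0 := fun d => by
        have := congrFun (congrFun (D.inv_mul_cancel hy) q) d
        rwa [Matrix.mul_apply, Matrix.one_apply] at this
      simp only [hCly, Finset.mul_sum, ← mul_assoc]
      rw [Finset.sum_comm]
      simp only [← Finset.sum_mul, h]
      simp
    rw [← this, Finset.sum_mul]
    exact Finset.sum_congr rfl fun r _ => by ring
  have hcov : ∀ i j, covI D.G Cl (fun o => o.elim i ![l, j, k]) y
      = partialD i (Cl ![l, j, k]) y - ∑ c, Γ c i l * Cl ![c, j, k] y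
        - ∑ c, Γ c i j * Cl ![l, c, k] y - ∑ c, Γ c i k * Cl ![l, j, c] y := by
    intro i j
    unfold covI
    simp only [Option.elim_none, Option.elim_some, Fin.sum_univ_three]
    have u0 : ∀ (inst : DecidableEq (Fin 3)) c,
        @Function.update _ _ inst (![l, j, k]) 0 c = ![c, j, k] := fun inst c => by
      obtain rfl := Subsingleton.elim inst (instDecidableEqFin 3)
      ext t; fin_cases t <;> simp
    have u1 : ∀ (inst : DecidableEq (Fin 3)) c,
        @Function.update _ _ inst (![l, j, k]) 1 c = ![l, c, k] := fun inst c => by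
      obtain rfl := Subsingleton.elim inst (instDecidableEqFin 3)
      ext t; fin_cases t <;> simp
    have u2 : ∀ (inst : DecidableEq (Fin 3)) c,
        @Function.update _ _ inst (![l, j, k]) 2 c = ![l, j, c] := fun inst c => by
      obtain rfl := Subsingleton.elim inst (instDecidableEqFin 3)
      ext t; fin_cases t <;> simp
    simp only [u0, u1, u2, Matrix.cons_val_zero, Matrix.cons_val_one, Matrix.cons_val]
    ring
  have hup1 : ∀ p, riemannUp (D.conf μ) i j k p y = riemannUp D.G i j k p y
      + (partialD i (D.connDiff μ p j k) y + ∑ q, C q j k * Γ p i q)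
      - (partialD j (D.connDiff μ p i k) y + ∑ q, C q i k * Γ p j q)
      + ∑ q, Γ q j k * C p i q - ∑ q, Γ q i k * C p j q
      + ∑ q, C q j k * C p i q - ∑ q, C q i k * C p j q := by
    intro p
    unfold riemannUp
    rw [hpd, hpd]
    simp only [D.christoffel_conf hy]
    simp only [add_mul, mul_add, Finset.sum_add_distrib, Finset.sum_sub_distrib, hΓ, hC]
    ring
  have hsw : ∀ (X : Fin n → ℝ) (a : Fin n), ∑ p, g l p * ∑ q, X q * C p a q
      = ∑ q, X q * Cl ![l, a, q] y := by
    intro X a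
    simp only [hCly, Finset.mul_sum]
    rw [Finset.sum_comm]
    exact Finset.sum_congr rfl fun _ _ => Finset.sum_congr rfl fun _ _ => by ring
  have hsym : ∑ c, Γ c i j * Cl ![l, c, k] y = ∑ c, Γ c j i * Cl ![l, c, k] y :=
    Finset.sum_congr rfl fun c _ => by simp only [hΓ]; rw [D.christoffel_symm hy c i j]
  -- `hQ` raises the index of one factor in the quadratic terms, and `hA` trades the derivative of
  -- `Cl` for that of `connDiff` by metric compatibility.
  rw [hQ, hQ, hcov, hcov, hsym, ← hA, ← hA]
  simp only [hup1]
  have hring : ∀ p, g l p * (riemannUp D.G i j k p y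
      + (partialD i (D.connDiff μ p j k) y + ∑ q, C q j k * Γ p i q)
      - (partialD j (D.connDiff μ p i k) y + ∑ q, C q i k * Γ p j q)
      + ∑ q, Γ q j k * C p i q - ∑ q, Γ q i k * C p j q
      + ∑ q, C q j k * C p i q - ∑ q, C q i k * C p j q)
    = g l p * riemannUp D.G i j k p y
      + g l p * (partialD i (D.connDiff μ p j k) y + ∑ q, C q j k * Γ p i q)
      - g l p * (partialD j (D.connDiff μ p i k) y + ∑ q, C q i k * Γ p j q)
      + g l p * ∑ q, Γ q j k * C p i q - g l p * ∑ q, Γ q i k * C p j q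
      + g l p * ∑ q, C q j k * C p i q - g l p * ∑ q, C q i k * C p j q := fun p => by ring
  simp only [hring, Finset.sum_add_distrib, Finset.sum_sub_distrib, hsw]
  ring

end

/-! ### Conformal change preserves natural families -/

lemma IsNat.dlog : IsNat 1 Unit (fun (D : LocalData n) idx y => D.dlog (idx ()) y) := by
  refine ((IsNat.dv 0).reindex ((finSuccEquiv 0).trans (Equiv.equivPUnit _))).congr rfl
    fun D idx y _ => ?_
  refine congrArg ((D.v y)⁻¹ * ·) ((covDeriv_eq_covI D.G _ _ y).trans ?_).symm
  simp [covI, iterCovDeriv]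

lemma IsNat.dlog_mul {d : ℕ} {ι : Type} [Fintype ι] {T : Fam n ι} (h : IsNat d ι T) :
    IsNat (d + 1) (Option ι)
      (fun D idx y => D.dlog (idx none) y * T D (fun i => idx (some i)) y) :=
  ((IsNat.dlog.mul h).reindex ((Equiv.sumComm _ _).trans (Equiv.optionEquivSumPUnit ι).symm)).congr
    (by omega) fun D idx y _ => by simp

open Classical in
lemma IsNat.swap_dlog_mul {d : ℕ} {ι : Type} [Fintype ι] {T : Fam n ι} (h : IsNat d ι T) (s : ι) :
    IsNat (d + 1) (Option ι) (fun D idx y => D.dlog (idx (some s)) y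
      * T D (Function.update (fun i => idx (some i)) s (idx none)) y) := by
  refine (h.dlog_mul.reindex (Equiv.swap none (some s))).congr rfl fun D idx y _ => ?_
  have e0 : Equiv.swap none (some s) none = some s := Equiv.swap_apply_left _ _
  have e1 : (fun i => idx (Equiv.swap none (some s) (some i)))
      = Function.update (fun i => idx (some i)) s (idx none) := by
    funext i
    by_cases hi : i = s
    · subst hi; simp
    · rw [Function.update_of_ne hi, Equiv.swap_apply_of_ne_of_ne (by simp) (by simpa using hi)]
  simp only [e0, e1]

-- In the product `g ⊗ dlog v ⊗ T`, the slot of `dlog v` is contracted with the slot `s` of `T`. The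
-- two transpositions exchange these slots with the two slots of `g`, which thereby become the free
-- slots `none` and `s`.
open Classical in
lemma IsNat.metric_dlog_mul {d : ℕ} {ι : Type} [Fintype ι] {T : Fam n ι} (h : IsNat d ι T)
    (s : ι) :
    IsNat (d + 1) (Option ι) (fun D idx y => ∑ a, ∑ b, (D.G y)⁻¹ a b
      * (D.G y (idx none) (idx (some s))
        * (D.dlog a y * T D (Function.update (fun i => idx (some i)) s b) y))) := by
  refine ((IsNat.metric.mul h.dlog_mul).reindex ((Equiv.sumComm (Fin 2) (Option ι)).trans
    ((Equiv.swap (Sum.inl none) (Sum.inr 0)).trans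
      (Equiv.swap (Sum.inl (some s)) (Sum.inr 1))))).contract.congr (by omega)
    fun D idx y _ => ?_
  refine Finset.sum_congr rfl fun a _ => Finset.sum_congr rfl fun b _ => ?_
  have i1 : (Equiv.swap (Sum.inl none : Option ι ⊕ Fin 2) (Sum.inr 0)) (Sum.inr 1) = Sum.inr 1 :=
    Equiv.swap_apply_of_ne_of_ne (by simp) (by simp)
  have i2 : ∀ i : ι, (Equiv.swap (Sum.inl none : Option ι ⊕ Fin 2) (Sum.inr 0))
      (Sum.inl (some i)) = Sum.inl (some i) := fun i =>
    Equiv.swap_apply_of_ne_of_ne (by simp) (by simp)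
  have e0 : (Equiv.swap (Sum.inl (some s) : Option ι ⊕ Fin 2) (Sum.inr 1))
      ((Equiv.swap (Sum.inl none) (Sum.inr 0)) (Sum.inr 0)) = Sum.inl none := by
    rw [Equiv.swap_apply_right, Equiv.swap_apply_of_ne_of_ne (by simp) (by simp)]
  have e1 : (Equiv.swap (Sum.inl (some s) : Option ι ⊕ Fin 2) (Sum.inr 1))
      ((Equiv.swap (Sum.inl none) (Sum.inr 0)) (Sum.inr 1)) = Sum.inl (some s) := by
    rw [i1, Equiv.swap_apply_right]
  have e2 : (Equiv.swap (Sum.inl (some s) : Option ι ⊕ Fin 2) (Sum.inr 1))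
      ((Equiv.swap (Sum.inl none) (Sum.inr 0)) (Sum.inl none)) = Sum.inr 0 := by
    rw [Equiv.swap_apply_left, Equiv.swap_apply_of_ne_of_ne (by simp) (by simp)]
  have e3 : (fun i : ι => Sum.elim idx ![a, b]
      ((Equiv.swap (Sum.inl (some s) : Option ι ⊕ Fin 2) (Sum.inr 1))
      ((Equiv.swap (Sum.inl none) (Sum.inr 0)) (Sum.inl (some i)))))
      = Function.update (fun i => idx (some i)) s b := by
    funext i
    rw [i2]
    by_cases hi : i = s
    · subst hi
      rw [Equiv.swap_apply_left]
      simp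
    · rw [Equiv.swap_apply_of_ne_of_ne (by simp [hi]) (by simp)]
      simp [hi]
  simp only [Equiv.trans_apply, Equiv.sumComm_apply, Sum.swap_inl, Sum.swap_inr, e0, e1, e2, e3,
    Sum.elim_inl, Sum.elim_inr, Matrix.cons_val_zero]

/-- The conformal covariant derivative of a natural family, rescaled. -/
lemma IsNat.exists_covI_conf {d : ℕ} {ι : Type} [Fintype ι] {T : Fam n ι} (h : IsNat d ι T)
    (μ : ℝ) : ∃ T' : Fam n (Option ι), IsNat (d + 1) (Option ι) T' ∧
      ∀ (D : LocalData n) idx, ∀ y ∈ D.U,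
        covI (D.conf μ) (fun idx z => D.v z ^ (2 * μ) * T D idx z) idx y
          = D.v y ^ (2 * μ) * T' D idx y := by
  classical
  refine ⟨_, (h.cov.add (h.dlog_mul.smul (2 * μ))).add (IsNat.sum Finset.univ fun s _ =>
      (((h.swap_dlog_mul s).smul (-μ)).add (h.dlog_mul.smul (-μ))).add
        ((h.metric_dlog_mul s).smul μ)), fun D idx y hy => ?_⟩
  rw [D.covI_conf hy μ fun i => smooth_diffAt (h.smooth D i hy)]

/-- Lowering the upper index turns the Kronecker deltas into metrics: the tensor is `μ (g_{01}
dlog_2 + g_{02} dlog_1 - dlog_0 g_{12})`. -/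
lemma IsNat.connDiff (μ : ℝ) : IsNat 1 (Fin 3) (fun (D : LocalData n) idx y =>
    ∑ c, D.G y (idx 0) c * D.connDiff μ c (idx 1) (idx 2) y) := by
  have hm : IsNat 1 (Unit ⊕ Fin 2) (fun (D : LocalData n) idx y =>
      D.dlog (idx (Sum.inl ())) y * D.G y (idx (Sum.inr 0)) (idx (Sum.inr 1))) :=
    (IsNat.dlog.mul IsNat.metric).congr rfl fun D idx y _ => rfl
  have key : ∀ f : Unit ⊕ Fin 2 → Fin 3, Function.Bijective f →
      IsNat 1 (Fin 3) (fun (D : LocalData n) idx y => D.dlog (idx (f (Sum.inl ()))) y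
        * D.G y (idx (f (Sum.inr 0))) (idx (f (Sum.inr 1)))) := fun f hf =>
    (hm.reindex (Equiv.ofBijective f hf)).congr rfl fun D idx y _ => rfl
  have k1 := key (Sum.elim (fun _ => 2) ![0, 1]) (by decide)
  have k2 := key (Sum.elim (fun _ => 1) ![0, 2]) (by decide)
  have k3 := key (Sum.elim (fun _ => 0) ![1, 2]) (by decide)
  refine (((k1.add k2).add (k3.smul (-1))).smul μ).congr rfl fun D idx y hy => ?_
  have hone : ∀ d, ∑ c, D.G y (idx 0) c * (D.G y)⁻¹ c d = if idx 0 = d then 1 else 0 := fun d => by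
    have := congrFun (congrFun (D.mul_inv_cancel hy) (idx 0)) d
    rwa [Matrix.mul_apply, Matrix.one_apply] at this
  have hs : ∑ c, D.G y (idx 0) c * ∑ d, (D.G y)⁻¹ c d * D.dlog d y = D.dlog (idx 0) y := by
    simp only [Finset.mul_sum, ← mul_assoc]
    rw [Finset.sum_comm]
    simp only [← Finset.sum_mul, hone]
    simp
  simp only [Sum.elim_inl, Sum.elim_inr, Matrix.cons_val_zero, Matrix.cons_val_one]
  have hterm : ∀ c, D.G y (idx 0) c * D.connDiff μ c (idx 1) (idx 2) y
      = μ * ((if c = idx 1 then D.G y (idx 0) c * D.dlog (idx 2) y else 0)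
        + (if c = idx 2 then D.G y (idx 0) c * D.dlog (idx 1) y else 0)
        - D.G y (idx 0) c * (∑ d, (D.G y)⁻¹ c d * D.dlog d y) * D.G y (idx 1) (idx 2)) := by
    intro c
    unfold LocalData.connDiff
    split_ifs <;> ring
  simp only [hterm, ← Finset.mul_sum, Finset.sum_add_distrib, Finset.sum_sub_distrib,
    Finset.sum_ite_eq', Finset.mem_univ, if_true, ← Finset.sum_mul, hs]
  ring

/-- Lowering the index with `v^{2μ} G` gives the power of `v`; what remains is the expression of
`lower_riemann_conf`, whose five terms are natural of order two. -/
lemma exists_riemann_conf (μ : ℝ) : ∃ T : Fam n (Fin 4), IsNat 2 (Fin 4) T ∧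
    ∀ (D : LocalData n) idx, ∀ y ∈ D.U,
      riemann (D.conf μ) idx y = D.v y ^ (2 * μ) * T D idx y := by
  have hC := IsNat.connDiff (n := n) μ
  have hcov : ∀ f : Option (Fin 3) → Fin 4, Function.Bijective f → IsNat 2 (Fin 4)
      (fun (D : LocalData n) idx y => covI D.G (fun idx y =>
        ∑ c, D.G y (idx 0) c * D.connDiff μ c (idx 1) (idx 2) y) (fun o => idx (f o)) y) :=
    fun f hf => (hC.cov.reindex (Equiv.ofBijective f hf)).congr rfl fun D idx y _ => rfl
  have hcc : ∀ f : Fin 3 ⊕ Fin 3 → Fin 4 ⊕ Fin 2, Function.Bijective f → IsNat 2 (Fin 4)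
      (fun (D : LocalData n) idx y => ∑ a, ∑ b, (D.G y)⁻¹ a b *
        ((fun idx y => ∑ c, D.G y (idx 0) c * D.connDiff μ c (idx 1) (idx 2) y)
            (fun i => Sum.elim idx ![a, b] (f (Sum.inl i))) y
          * (fun idx y => ∑ c, D.G y (idx 0) c * D.connDiff μ c (idx 1) (idx 2) y)
            (fun i => Sum.elim idx ![a, b] (f (Sum.inr i))) y)) :=
    fun f hf => ((hC.mul hC).reindex (Equiv.ofBijective f hf)).contract.congr rfl
      fun D idx y _ => rfl
  have c1 := hcov (fun o => o.elim 0 ![3, 1, 2]) (by decide)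
  have c2 := hcov (fun o => o.elim 1 ![3, 0, 2]) (by decide)
  have q1 := hcc (Sum.elim ![Sum.inr 1, Sum.inl 1, Sum.inl 2]
    ![Sum.inl 3, Sum.inl 0, Sum.inr 0]) (by decide)
  have q2 := hcc (Sum.elim ![Sum.inr 1, Sum.inl 0, Sum.inl 2]
    ![Sum.inl 3, Sum.inl 1, Sum.inr 0]) (by decide)
  have hr : IsNat 2 (Fin 4) (fun (D : LocalData n) idx y => riemann D.G idx y) := IsNat.rm 0
  refine ⟨_, (hr.add (c1.add (c2.smul (-1)))).add (q1.add (q2.smul (-1))), fun D idx y hy => ?_⟩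
  have h := D.lower_riemann_conf hy μ (idx 0) (idx 1) (idx 2) (idx 3)
    (Cl := fun idx y => ∑ c, D.G y (idx 0) c * D.connDiff μ c (idx 1) (idx 2) y)
    fun _ _ _ => rfl
  have hl : riemann (D.conf μ) idx y = D.v y ^ (2 * μ)
      * ∑ p, D.G y (idx 3) p * riemannUp (D.conf μ) (idx 0) (idx 1) (idx 2) p y := by
    unfold riemann
    rw [Finset.mul_sum]
    refine Finset.sum_congr rfl fun p _ => ?_
    rw [← mul_assoc]
    rfl
  have e1 : ∀ i j k : Fin 4, (fun o : Option (Fin 3) => idx (o.elim i ![3, j, k]))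
      = fun o => o.elim (idx i) ![idx 3, idx j, idx k] := by
    intro i j k
    funext o
    rcases o with _ | o
    · rfl
    · fin_cases o <;> rfl
  rw [hl, h]
  simp only [e1, Sum.elim_inl, Sum.elim_inr]
  simp only [riemann, Sum.elim_inl, Sum.elim_inr, Matrix.cons_val_zero, Matrix.cons_val_one,
    Matrix.cons_val]
  ring

lemma covI_congr {G : Eucl n → Matrix (Fin n) (Fin n) ℝ} {y : Eucl n} {U : Set (Eucl n)}
    (hU : IsOpen U) (hy : y ∈ U) {r : ℕ} {S : Tensor n r} {T : (Fin r → Fin n) → Eucl n → ℝ}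
    (h : ∀ idx, ∀ z ∈ U, S idx z = T idx z) (idx : Fin (r + 1) → Fin n) :
    covDeriv G S idx y = covI G T (idx ∘ (finSuccEquiv r).symm) y :=
  (covDeriv_eq_covI G S idx y).trans (covI_congr_on hU hy h _)

/-- The weight `2μ` does not depend on the number of derivatives, so the induction stays within
tensors of the form `v^{2μ}` times a natural family. -/
theorem exists_iterCovDeriv_riemann_conf (μ : ℝ) (N : ℕ) : ∃ T : Fam n (Fin (4 + N)),
    IsNat (N + 2) (Fin (4 + N)) T ∧ ∀ (D : LocalData n) idx, ∀ y ∈ D.U,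
      iterCovDeriv (D.conf μ) (riemann (D.conf μ)) N idx y = D.v y ^ (2 * μ) * T D idx y := by
  induction N with
  | zero =>
    obtain ⟨T, hT, h⟩ := exists_riemann_conf (n := n) μ
    exact ⟨T, hT, h⟩
  | succ N ih =>
    obtain ⟨T, hT, h⟩ := ih
    obtain ⟨T', hT', h'⟩ := hT.exists_covI_conf μ
    refine ⟨_, (hT'.reindex (finSuccEquiv (4 + N)).symm).congr (by omega) fun D idx y _ => rfl,
      fun D idx y hy => ?_⟩
    exact (covI_congr D.isOpen hy (fun i z hz => h D i z hz) idx).trans (h' D _ y hy)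

/-! ### Elimination of a metric factor from a complete contraction -/

open Classical in
/-- The weight of a perfect matching: the product of `H` over the pairs. -/
def pairWeight (H : Matrix (Fin n) (Fin n) ℝ) {K : Type} [Fintype K] (κ : K × Fin 2 → Fin n) : ℝ :=
  ∏ p, H (κ (p, 0)) (κ (p, 1))

open Classical in
/-- The sum over the indices of matched slots, weighted by `H`. -/
def pairSum (H : Matrix (Fin n) (Fin n) ℝ) {K : Type} [Fintype K]
    (F : (K × Fin 2 → Fin n) → ℝ) : ℝ :=
  ∑ κ, pairWeight H κ * F κ

lemma pairSum_eq (H : Matrix (Fin n) (Fin n) ℝ) {K : Type} [Fintype K] [DecidableEq K]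
    (F : (K × Fin 2 → Fin n) → ℝ) : pairSum H F = ∑ κ, pairWeight H κ * F κ := by
  unfold pairSum
  congr!

lemma pairSum_mul_left (H : Matrix (Fin n) (Fin n) ℝ) {K : Type} [Fintype K] (c : ℝ)
    (F : (K × Fin 2 → Fin n) → ℝ) : pairSum H (fun κ => c * F κ) = c * pairSum H F := by
  simp [pairSum, Finset.mul_sum, mul_left_comm]

lemma pairSum_add (H : Matrix (Fin n) (Fin n) ℝ) {K : Type} [Fintype K]
    (F F' : (K × Fin 2 → Fin n) → ℝ) :
    pairSum H (fun κ => F κ + F' κ) = pairSum H F + pairSum H F' := by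
  simp [pairSum, mul_add, Finset.sum_add_distrib]

lemma pairSum_sum (H : Matrix (Fin n) (Fin n) ℝ) {L K : Type} [Fintype L] [Fintype K]
    (F : ((L ⊕ K) × Fin 2 → Fin n) → ℝ) :
    pairSum H F = pairSum H fun l : L × Fin 2 → Fin n => pairSum H fun κ : K × Fin 2 → Fin n =>
      F (fun q => Sum.elim l κ (Equiv.sumProdDistrib L K (Fin 2) q)) := by
  classical
  rw [pairSum_eq, pairSum_eq]
  simp only [pairSum_eq, Finset.mul_sum]
  rw [← Fintype.sum_prod_type', ← ((Equiv.sumArrowEquivProdArrow _ _ _).symm.trans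
    (Equiv.arrowCongr (Equiv.sumProdDistrib L K (Fin 2)).symm (Equiv.refl (Fin n)))).sum_comp]
  refine Finset.sum_congr rfl fun q _ => ?_
  rw [← mul_assoc]
  congr 1
  simp [pairWeight, Fintype.prod_sum_type, Equiv.sumArrowEquivProdArrow, Equiv.arrowCongr]

lemma pairSum_equiv (H : Matrix (Fin n) (Fin n) ℝ) {L K : Type} [Fintype L] [Fintype K] (e : L ≃ K)
    (F : (L × Fin 2 → Fin n) → ℝ) :
    pairSum H F = pairSum H fun κ : K × Fin 2 → Fin n => F fun q => κ (e q.1, q.2) := by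
  classical
  rw [pairSum_eq, pairSum_eq]
  refine Fintype.sum_equiv (Equiv.arrowCongr (Equiv.prodCongr e (Equiv.refl _)) (Equiv.refl _))
    _ _ fun κ => ?_
  congr 1
  · unfold pairWeight
    rw [← e.prod_comp]
    simp [Equiv.arrowCongr]
  · congr 1
    funext q
    simp [Equiv.arrowCongr]

open Classical in
lemma sum_elim_fin_two {S : Type} [Fintype S] (F : (S ⊕ Fin 2 → Fin n) → ℝ) :
    ∑ f, F f = ∑ g : S → Fin n, ∑ a, ∑ b, F (Sum.elim g ![a, b]) := by
  rw [← (Equiv.sumArrowEquivProdArrow S (Fin 2) (Fin n)).symm.sum_comp, Fintype.sum_prod_type]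
  refine Finset.sum_congr rfl fun g _ => ?_
  rw [← (finTwoArrowEquiv (Fin n)).symm.sum_comp, Fintype.sum_prod_type]
  rfl

-- A metric contracted with inverse metrics disappears: `tr(H G) = n` if its two slots form a pair,
-- and `H G H = H` if they belong to two different pairs. The new matching and the constant `c`
-- depend only on the old matching, not on `G` and `H`.
open Classical in
lemma exists_elim_metric {S K : Type} [Fintype S] [Fintype K] (e : S ⊕ Fin 2 ≃ K × Fin 2) :
    ∃ (K' : Type) (_ : Fintype K') (e' : S ≃ K' × Fin 2) (c : ℝ),
      ∀ G H : Matrix (Fin n) (Fin n) ℝ, (∀ i j, H i j = H j i) → H * G = 1 →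
        (∀ i j, G i j = G j i) → ∀ X : (S → Fin n) → ℝ,
          (pairSum H fun κ : K × Fin 2 → Fin n =>
              G (κ (e (Sum.inr 0))) (κ (e (Sum.inr 1))) * X fun s => κ (e (Sum.inl s)))
            = c * pairSum H fun κ : K' × Fin 2 → Fin n => X fun s => κ (e' s) := by
  unfold pairSum
  have hcard : Fintype.card S + 2 = Fintype.card K * 2 := by
    simpa using Fintype.card_congr e
  have hinl : ∀ q : K × Fin 2, q ≠ e (Sum.inr 0) → q ≠ e (Sum.inr 1) →
      ∃ s, e.symm q = Sum.inl s := by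
    intro q h0 h1
    rcases h : e.symm q with s | i
    · exact ⟨s, rfl⟩
    · have hq : q = e (Sum.inr i) := by rw [← h, e.apply_symm_apply]
      fin_cases i
      exacts [absurd hq h0, absurd hq h1]
  have hrw : ∀ (G H : Matrix (Fin n) (Fin n) ℝ) (X : (S → Fin n) → ℝ),
      ∑ κ : K × Fin 2 → Fin n, pairWeight H κ
          * (G (κ (e (Sum.inr 0))) (κ (e (Sum.inr 1))) * X fun s => κ (e (Sum.inl s)))
        = ∑ g : S → Fin n, (∑ a, ∑ b, (∏ p, H (Sum.elim g ![a, b] (e.symm (p, 0)))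
            (Sum.elim g ![a, b] (e.symm (p, 1)))) * G a b) * X g := by
    intro G H X
    rw [← (Equiv.arrowCongr e (Equiv.refl (Fin n))).sum_comp, sum_elim_fin_two]
    refine Finset.sum_congr rfl fun g _ => ?_
    simp only [Finset.sum_mul]
    refine Finset.sum_congr rfl fun a _ => Finset.sum_congr rfl fun b _ => ?_
    simp [pairWeight, Equiv.arrowCongr, mul_assoc]
  rcases h0 : e (Sum.inr 0) with ⟨p0, i0⟩
  rcases h1 : e (Sum.inr 1) with ⟨p1, i1⟩
  have h0' : e.symm (p0, i0) = Sum.inr 0 := by rw [← h0, e.symm_apply_apply]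
  have h1' : e.symm (p1, i1) = Sum.inr 1 := by rw [← h1, e.symm_apply_apply]
  rw [h0, h1] at hinl
  have hne : (p0, i0) ≠ (p1, i1) := by
    rw [← h0, ← h1]; intro h; simpa using e.injective h
  have hfin : ∀ i : Fin 2, i.rev ≠ i := by decide
  have hpair : ∀ (H : Matrix (Fin n) (Fin n) ℝ), (∀ i j, H i j = H j i) →
      ∀ (f : Fin 2 → Fin n) (i : Fin 2), H (f 0) (f 1) = H (f i) (f i.rev) := by
    intro H hH f i
    fin_cases i
    · rfl
    · exact hH _ _
  -- If the two slots of the metric are paired with each other, that pair is deleted and contributes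
  -- the trace `n`.
  by_cases hp : p0 = p1
  · subst hp
    have hi : i1 = i0.rev := by
      have h : i0 ≠ i1 := fun h => hne (by rw [h])
      have hd : ∀ i j : Fin 2, i ≠ j → j = i.rev := by decide
      exact hd _ _ h
    subst hi
    have hs : ∀ q : {p // p ≠ p0} × Fin 2, ∃ s, e.symm (q.1.1, q.2) = Sum.inl s := fun q =>
      hinl _ (fun h => q.1.2 (congrArg Prod.fst h)) (fun h => q.1.2 (congrArg Prod.fst h))
    choose φ hφ using hs
    have hinj : Function.Injective φ := by
      intro q q' h
      have h2 := e.symm.injective ((hφ q).trans ((congrArg Sum.inl h).trans (hφ q').symm))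
      rw [Prod.mk.injEq] at h2
      exact Prod.ext (Subtype.ext h2.1) h2.2
    have hbij : Function.Bijective φ := by
      rw [Fintype.bijective_iff_injective_and_card]
      refine ⟨hinj, ?_⟩
      have : 0 < Fintype.card K := Fintype.card_pos_iff.2 ⟨p0⟩
      simp only [Fintype.card_prod, Fintype.card_fin, Fintype.card_subtype_compl,
        Fintype.card_unique]
      omega
    refine ⟨{p // p ≠ p0}, inferInstance, (Equiv.ofBijective φ hbij).symm, n,
      fun G H hH hHG hG X => ?_⟩
    rw [← h0, ← h1, hrw, Finset.mul_sum]
    refine Finset.sum_equiv (Equiv.arrowCongr (Equiv.ofBijective φ hbij).symm (Equiv.refl (Fin n)))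
      (by simp) fun g _ => ?_
    have hX : (fun s => (Equiv.arrowCongr (Equiv.ofBijective φ hbij).symm (Equiv.refl (Fin n))) g
        ((Equiv.ofBijective φ hbij).symm s)) = g := by
      funext s; exact congrArg g ((Equiv.ofBijective φ hbij).apply_symm_apply s)
    beta_reduce
    rw [hX, ← mul_assoc]
    congr 1
    have hprod : ∀ a b, (∏ p, H (Sum.elim g ![a, b] (e.symm (p, 0)))
        (Sum.elim g ![a, b] (e.symm (p, 1)))) = H a b * pairWeight H
          ((Equiv.arrowCongr (Equiv.ofBijective φ hbij).symm (Equiv.refl (Fin n))) g) := by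
      intro a b
      rw [← (Equiv.optionSubtypeNe p0).prod_comp, Fintype.prod_option]
      congr 1
      · rw [Equiv.optionSubtypeNe_none,
          hpair H hH (fun i => Sum.elim g ![a, b] (e.symm (p0, i))) i0]
        simp only [h0', h1']
        simp
      · refine Finset.prod_congr rfl fun p _ => ?_
        rw [Equiv.optionSubtypeNe_some, hφ (p, 0), hφ (p, 1)]
        rfl
    simp only [hprod]
    have htr : ∑ a, ∑ b, H a b * G a b = n := by
      have : ∀ a, ∑ b, H a b * G a b = 1 := fun a => by
        have h := congrFun (congrFun hHG a) a
        rw [Matrix.mul_apply, Matrix.one_apply_eq] at h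
        rw [← h]
        exact Finset.sum_congr rfl fun b _ => by rw [hG a b]
      simp [this]
    rw [← htr]
    simp only [Finset.sum_mul]
    exact Finset.sum_congr rfl fun a _ => Finset.sum_congr rfl fun b _ => by ring
  -- Otherwise they are paired with slots `s0` and `s1` of the other factors. The pair `p1` is
  -- deleted, and `s0` and `s1` become the two members of `p0`.
  · obtain ⟨s0, hs0⟩ := hinl (p0, i0.rev) (fun h => hfin i0 (congrArg Prod.snd h))
      (fun h => hp (congrArg Prod.fst h))
    obtain ⟨s1, hs1⟩ := hinl (p1, i1.rev) (fun h => hp (congrArg Prod.fst h).symm)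
      (fun h => hfin i1 (congrArg Prod.snd h))
    -- At `p0` the chosen slot is a dummy value, overridden in the definition of `φ`.
    have hs : ∀ q : {p // p ≠ p1} × Fin 2, ∃ s, q.1.1 ≠ p0 → e.symm (q.1.1, q.2) = Sum.inl s := by
      intro q
      by_cases hq : q.1.1 = p0
      · exact ⟨s0, fun h => absurd hq h⟩
      · obtain ⟨s, hs⟩ := hinl (q.1.1, q.2) (fun h => hq (congrArg Prod.fst h))
          (fun h => q.1.2 (congrArg Prod.fst h))
        exact ⟨s, fun _ => hs⟩
    choose ψ hψ using hs
    set φ : {p // p ≠ p1} × Fin 2 → S := fun q =>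
      if q.1.1 = p0 then (if q.2 = 0 then s0 else s1) else ψ q with hφ
    -- the position of `φ q` in the old matching
    have hpos : ∀ q, e (Sum.inl (φ q)) = if q.1.1 = p0 then
        (if q.2 = 0 then (p0, i0.rev) else (p1, i1.rev)) else (q.1.1, q.2) := by
      intro q
      simp only [hφ]
      split_ifs with h h'
      · rw [← hs0, e.apply_symm_apply]
      · rw [← hs1, e.apply_symm_apply]
      · rw [← hψ q h, e.apply_symm_apply]
    have hinj : Function.Injective φ := by
      intro q q' h
      have h2 := (hpos q).symm.trans ((congrArg (fun s => e (Sum.inl s)) h).trans (hpos q'))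
      obtain ⟨⟨p, hp1⟩, i⟩ := q
      obtain ⟨⟨p', hp1'⟩, i'⟩ := q'
      simp only [] at h2
      split_ifs at h2 with a1 a2 a3 a4 a5 a6 a7 a8
      · subst a1 a2 a3 a4; rfl
      · exact absurd (congrArg Prod.fst h2) hp
      · exact absurd (congrArg Prod.fst h2).symm a3
      · exact absurd (congrArg Prod.fst h2).symm hp
      · have hd : ∀ i j : Fin 2, i ≠ 0 → j ≠ 0 → i = j := by decide
        have := hd i i' (by assumption) (by assumption)
        subst this
        congr 2
        exact Eq.trans (by assumption) (Eq.symm (by assumption))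
      · exact absurd (congrArg Prod.fst h2).symm hp1'
      · exact absurd (congrArg Prod.fst h2) a1
      · exact absurd (congrArg Prod.fst h2) hp1
      · simp only [Prod.mk.injEq] at h2
        obtain ⟨rfl, rfl⟩ := h2; rfl
    have hbij : Function.Bijective φ := by
      rw [Fintype.bijective_iff_injective_and_card]
      refine ⟨hinj, ?_⟩
      have : 0 < Fintype.card K := Fintype.card_pos_iff.2 ⟨p0⟩
      simp only [Fintype.card_prod, Fintype.card_fin, Fintype.card_subtype_compl,
        Fintype.card_unique]
      omega
    refine ⟨{p // p ≠ p1}, inferInstance, (Equiv.ofBijective φ hbij).symm, 1,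
      fun G H hH hHG hG X => ?_⟩
    rw [← h0, ← h1, hrw, one_mul]
    refine Finset.sum_equiv (Equiv.arrowCongr (Equiv.ofBijective φ hbij).symm (Equiv.refl (Fin n)))
      (by simp) fun g _ => ?_
    have hX : (fun s => (Equiv.arrowCongr (Equiv.ofBijective φ hbij).symm (Equiv.refl (Fin n))) g
        ((Equiv.ofBijective φ hbij).symm s)) = g := by
      funext s; exact congrArg g ((Equiv.ofBijective φ hbij).apply_symm_apply s)
    beta_reduce
    rw [hX]
    congr 1
    set p0' : {p // p ≠ p1} := ⟨p0, hp⟩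
    set R : ℝ := ∏ x ∈ (Finset.univ.erase p0' : Finset {p // p ≠ p1}), H (g (ψ (x, 0))) (g (ψ (x, 1)))
    have hprod : ∀ a b, (∏ p, H (Sum.elim g ![a, b] (e.symm (p, 0)))
        (Sum.elim g ![a, b] (e.symm (p, 1)))) = H b (g s1) * (H a (g s0) * R) := by
      intro a b
      rw [← (Equiv.optionSubtypeNe p1).prod_comp, Fintype.prod_option,
        ← Finset.mul_prod_erase _ _ (Finset.mem_univ p0')]
      congr 1
      · rw [Equiv.optionSubtypeNe_none,
          hpair H hH (fun i => Sum.elim g ![a, b] (e.symm (p1, i))) i1]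
        simp only [hs1, h1']
        simp
      · congr 1
        · rw [Equiv.optionSubtypeNe_some,
            hpair H hH (fun i => Sum.elim g ![a, b] (e.symm (p0, i))) i0]
          simp only [hs0, h0']
          simp
        · refine Finset.prod_congr rfl fun p hp' => ?_
          have hpp : p.1 ≠ p0 := fun h => Finset.ne_of_mem_erase hp' (Subtype.ext h)
          rw [Equiv.optionSubtypeNe_some, hψ (p, 0) hpp, hψ (p, 1) hpp]
          rfl
    have hR : pairWeight H ((Equiv.arrowCongr (Equiv.ofBijective φ hbij).symm
        (Equiv.refl (Fin n))) g) = H (g s0) (g s1) * R := by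
      unfold pairWeight
      rw [← Finset.mul_prod_erase _ _ (Finset.mem_univ p0')]
      congr 1
      · simp [Equiv.arrowCongr, hφ, p0']
      · refine Finset.prod_congr rfl fun p hp' => ?_
        have hpp : p.1 ≠ p0 := fun h => Finset.ne_of_mem_erase hp' (Subtype.ext h)
        simp [Equiv.arrowCongr, hφ, hpp]
    rw [hR]
    simp only [hprod]
    have hsum : ∑ a, ∑ b, H a (g s0) * G a b * H b (g s1) = H (g s0) (g s1) := by
      have h1 : ∀ b, ∑ a, H a (g s0) * G a b = if g s0 = b then 1 else 0 := fun b => by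
        have h := congrFun (congrFun hHG (g s0)) b
        rw [Matrix.mul_apply, Matrix.one_apply] at h
        rw [← h]
        exact Finset.sum_congr rfl fun a _ => by rw [hH a]
      rw [Finset.sum_comm]
      simp only [← Finset.sum_mul, h1]
      simp
    rw [← hsum]
    simp only [Finset.sum_mul]
    exact Finset.sum_congr rfl fun a _ => Finset.sum_congr rfl fun b _ => by ring

/-! ### Normal form of natural families -/

/-- The slots of a product of curvature factors, derivatives of `v`, and metrics. -/
abbrev Slots {J₁ J₂ : Type} (N : J₁ → ℕ) (P : J₂ → ℕ) (J₃ : Type) : Type :=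
  ((Σ i : J₁, Fin (4 + N i)) ⊕ (Σ j : J₂, Fin (0 + (P j + 1)))) ⊕ (J₃ × Fin 2)

/-- A partial contraction of a product of curvature factors (indexed by `J₁`), derivatives of `v`
(indexed by `J₂`) and metrics (indexed by `J₃`): the slots are matched with the free slots `ι` and
with the members of the pairs `K`. -/
structure Mono (ι : Type) where
  J₁ : Type
  J₂ : Type
  J₃ : Type
  K : Type
  [f₁ : Fintype J₁]
  [f₂ : Fintype J₂]
  [f₃ : Fintype J₃]
  [fK : Fintype K]
  N : J₁ → ℕ
  P : J₂ → ℕ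
  e : Slots N P J₃ ≃ ι ⊕ (K × Fin 2)

attribute [instance] Mono.f₁ Mono.f₂ Mono.f₃ Mono.fK

/-- The number of derivatives, the curvature counting for two. -/
def Mono.order {ι : Type} (m : Mono ι) : ℕ := ∑ i, (m.N i + 2) + ∑ j, (m.P j + 1)

/-- The product of the curvature factors and of the derivatives of `v`. -/
def facProd {J₁ J₂ : Type} [Fintype J₁] [Fintype J₂] (N : J₁ → ℕ) (P : J₂ → ℕ)
    (D : LocalData n) (y : Eucl n)
    (f : (Σ i : J₁, Fin (4 + N i)) ⊕ (Σ j : J₂, Fin (0 + (P j + 1))) → Fin n) : ℝ :=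
  (∏ i, iterCovDeriv D.G (riemann D.G) (N i) (fun s => f (Sum.inl ⟨i, s⟩)) y)
    * ∏ j, ((D.v y)⁻¹
      * iterCovDeriv D.G (r := 0) (fun _ => D.v) (P j + 1) (fun s => f (Sum.inr ⟨j, s⟩)) y)

/-- The product of all the factors. -/
def fullProd {J₁ J₂ J₃ : Type} [Fintype J₁] [Fintype J₂] [Fintype J₃] (N : J₁ → ℕ) (P : J₂ → ℕ)
    (D : LocalData n) (y : Eucl n) (f : Slots N P J₃ → Fin n) : ℝ :=
  facProd N P D y (fun s => f (Sum.inl s)) * ∏ l, D.G y (f (Sum.inr (l, 0))) (f (Sum.inr (l, 1)))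

/-- The value of the partial contraction. -/
def Mono.eval {ι : Type} (m : Mono ι) (D : LocalData n) (y : Eucl n) (idx : ι → Fin n) : ℝ :=
  pairSum (D.G y)⁻¹ fun κ : m.K × Fin 2 → Fin n => fullProd m.N m.P D y fun s => Sum.elim idx κ (m.e s)

/-- Pointed local data. -/
abbrev LocPt (n : ℕ) : Type := {p : LocalData n × Eucl n // p.2 ∈ p.1.U}

/-- The span of the partial contractions of order `d`. -/
def monoSpan (n d : ℕ) (ι : Type) : Submodule ℝ (LocPt n → (ι → Fin n) → ℝ) :=
  Submodule.span ℝ {f | ∃ m : Mono ι, m.order = d ∧ f = fun p => m.eval p.1.1 p.1.2}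

lemma Mono.mem_span {ι : Type} (m : Mono ι) {d : ℕ} (h : m.order = d) :
    (fun p : LocPt n => m.eval p.1.1 p.1.2) ∈ monoSpan n d ι :=
  Submodule.subset_span ⟨m, h, rfl⟩

/-- A linear operation preserves the spans of partial contractions as soon as it maps each of them
to one. -/
lemma monoSpan_induction {d d' : ℕ} {ι κ : Type}
    (L : (LocPt n → (ι → Fin n) → ℝ) →ₗ[ℝ] (LocPt n → (κ → Fin n) → ℝ))
    (hL : ∀ m : Mono ι, m.order = d → L (fun p => m.eval p.1.1 p.1.2) ∈ monoSpan n d' κ)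
    {f : LocPt n → (ι → Fin n) → ℝ} (hf : f ∈ monoSpan n d ι) : L f ∈ monoSpan n d' κ := by
  have : monoSpan n d ι ≤ (monoSpan n d' κ).comap L := by
    refine Submodule.span_le.2 ?_
    rintro _ ⟨m, hm, rfl⟩
    exact hL m hm
  exact this hf

/-- Contracting the pairs of slots indexed by `L`. -/
def Mono.contr {ι L : Type} [Fintype L] (m : Mono (ι ⊕ (L × Fin 2))) : Mono ι where
  J₁ := m.J₁
  J₂ := m.J₂
  J₃ := m.J₃
  K := L ⊕ m.K
  N := m.N
  P := m.P
  e := m.e.trans ((Equiv.sumAssoc _ _ _).trans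
    (Equiv.sumCongr (Equiv.refl _) (Equiv.sumProdDistrib _ _ _).symm))

lemma Mono.contr_eval {ι L : Type} [Fintype L] (m : Mono (ι ⊕ (L × Fin 2))) (D : LocalData n)
    (y : Eucl n) (idx : ι → Fin n) :
    m.contr.eval D y idx
      = pairSum (D.G y)⁻¹ fun l : L × Fin 2 → Fin n => m.eval D y (Sum.elim idx l) := by
  refine (pairSum_sum (L := L) (K := m.K) _ _).trans ?_
  congr 1
  funext l
  unfold eval
  congr 1
  funext κ
  change fullProd m.N m.P D y _ = fullProd m.N m.P D y _
  congr 1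
  funext s
  change Sum.elim idx _ ((Equiv.sumCongr (Equiv.refl _) (Equiv.sumProdDistrib _ _ _).symm)
    ((Equiv.sumAssoc _ _ _) (m.e s))) = _
  rcases m.e s with (i | l) | q <;> simp

lemma monoSpan_contr {d : ℕ} {ι L : Type} [Fintype L] {f : LocPt n → (ι ⊕ (L × Fin 2) → Fin n) → ℝ}
    (hf : f ∈ monoSpan n d (ι ⊕ (L × Fin 2))) :
    (fun p idx => pairSum (p.1.1.G p.1.2)⁻¹ fun l : L × Fin 2 → Fin n => f p (Sum.elim idx l))
      ∈ monoSpan n d ι := by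
  refine monoSpan_induction (d := d) ⟨⟨fun f p idx => pairSum (p.1.1.G p.1.2)⁻¹
    fun l : L × Fin 2 → Fin n => f p (Sum.elim idx l), fun f g => ?_⟩, fun c f => ?_⟩
      (fun m hm => ?_) hf
  · funext p idx
    exact pairSum_add _ _ _
  · funext p idx
    exact pairSum_mul_left _ _ _
  · have : (fun p : LocPt n => m.contr.eval p.1.1 p.1.2) ∈ monoSpan n d ι := m.contr.mem_span hm
    convert this using 1
    funext p idx
    exact (m.contr_eval _ _ _).symm

lemma monoSpan_reindex {d : ℕ} {ι κ : Type} (e : ι ≃ κ) {f : LocPt n → (ι → Fin n) → ℝ}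
    (hf : f ∈ monoSpan n d ι) : (fun p idx => f p (fun i => idx (e i))) ∈ monoSpan n d κ := by
  refine monoSpan_induction (d := d) (ι := ι) (κ := κ)
    ⟨⟨fun f p idx => f p (fun i => idx (e i)), fun f g => rfl⟩,
    fun c f => rfl⟩ (fun m hm => ?_) hf
  let m' : Mono κ := { m with e := m.e.trans (Equiv.sumCongr e (Equiv.refl _)) }
  have : (fun p : LocPt n => m'.eval p.1.1 p.1.2) ∈ monoSpan n d κ := m'.mem_span hm
  convert this using 1
  funext p idx
  change m.eval _ _ _ = m'.eval _ _ _
  unfold Mono.eval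
  congr 1
  funext l
  change fullProd m.N m.P _ _ _ = fullProd m.N m.P _ _ _
  congr 1
  funext s
  change _ = Sum.elim idx l ((Equiv.sumCongr e (Equiv.refl _)) (m.e s))
  rcases m.e s with i | q <;> simp

/-- The slots of a product of two products. -/
def slotsSum {J₁ J₂ J₁' J₂' : Type} (N : J₁ → ℕ) (P : J₂ → ℕ) (J₃ : Type) (N' : J₁' → ℕ)
    (P' : J₂' → ℕ) (J₃' : Type) :
    Slots (Sum.elim N N') (Sum.elim P P') (J₃ ⊕ J₃') ≃ Slots N P J₃ ⊕ Slots N' P' J₃' :=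
  (Equiv.sumCongr (Equiv.sumCongr (Equiv.sumSigmaDistrib _) (Equiv.sumSigmaDistrib _))
      (Equiv.sumProdDistrib _ _ _)).trans
    ((Equiv.sumCongr (Equiv.sumSumSumComm _ _ _ _) (Equiv.refl _)).trans
      (Equiv.sumSumSumComm _ _ _ _))

lemma fullProd_sum {J₁ J₂ J₃ J₁' J₂' J₃' : Type} [Fintype J₁] [Fintype J₂] [Fintype J₃]
    [Fintype J₁'] [Fintype J₂'] [Fintype J₃'] (N : J₁ → ℕ) (P : J₂ → ℕ) (N' : J₁' → ℕ)
    (P' : J₂' → ℕ) (D : LocalData n) (y : Eucl n) (f : Slots N P J₃ → Fin n)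
    (f' : Slots N' P' J₃' → Fin n) :
    fullProd (Sum.elim N N') (Sum.elim P P') D y
        (fun s => Sum.elim f f' (slotsSum N P J₃ N' P' J₃' s))
      = fullProd N P D y f * fullProd N' P' D y f' := by
  unfold fullProd facProd
  simp only [Fintype.prod_sum_type]
  change (_ * ∏ i, iterCovDeriv D.G (riemann D.G) (N' i) (fun s => f' (Sum.inl (Sum.inl ⟨i, s⟩))) y)
    * (_ * ∏ j, ((D.v y)⁻¹ * iterCovDeriv D.G (r := 0) (fun _ => D.v) (P' j + 1)
        (fun s => f' (Sum.inl (Sum.inr ⟨j, s⟩))) y))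
    * (_ * ∏ l, D.G y (f' (Sum.inr (l, 0))) (f' (Sum.inr (l, 1)))) = _
  change ((∏ i, iterCovDeriv D.G (riemann D.G) (N i) (fun s => f (Sum.inl (Sum.inl ⟨i, s⟩))) y) * _)
    * ((∏ j, ((D.v y)⁻¹ * iterCovDeriv D.G (r := 0) (fun _ => D.v) (P j + 1)
        (fun s => f (Sum.inl (Sum.inr ⟨j, s⟩))) y)) * _)
    * ((∏ l, D.G y (f (Sum.inr (l, 0))) (f (Sum.inr (l, 1)))) * _) = _
  ring

/-- The tensor product of two partial contractions. -/
def Mono.mul {ι κ : Type} (m : Mono ι) (m' : Mono κ) : Mono (ι ⊕ κ) where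
  J₁ := m.J₁ ⊕ m'.J₁
  J₂ := m.J₂ ⊕ m'.J₂
  J₃ := m.J₃ ⊕ m'.J₃
  K := m.K ⊕ m'.K
  N := Sum.elim m.N m'.N
  P := Sum.elim m.P m'.P
  e := (slotsSum m.N m.P m.J₃ m'.N m'.P m'.J₃).trans ((Equiv.sumCongr m.e m'.e).trans
        ((Equiv.sumSumSumComm _ _ _ _).trans
          (Equiv.sumCongr (Equiv.refl _) (Equiv.sumProdDistrib _ _ _).symm)))

lemma Mono.mul_order {ι κ : Type} (m : Mono ι) (m' : Mono κ) :
    (m.mul m').order = m.order + m'.order := by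
  have h1 : ∑ i : m.J₁ ⊕ m'.J₁, (Sum.elim m.N m'.N i + 2)
      = ∑ i, (m.N i + 2) + ∑ i, (m'.N i + 2) := by simp [Fintype.sum_sum_type]
  have h2 : ∑ i : m.J₂ ⊕ m'.J₂, (Sum.elim m.P m'.P i + 1)
      = ∑ i, (m.P i + 1) + ∑ i, (m'.P i + 1) := by simp [Fintype.sum_sum_type]
  change ∑ i : m.J₁ ⊕ m'.J₁, (Sum.elim m.N m'.N i + 2)
    + ∑ i : m.J₂ ⊕ m'.J₂, (Sum.elim m.P m'.P i + 1) = _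
  rw [h1, h2]
  unfold order
  omega

lemma Mono.mul_eval {ι κ : Type} (m : Mono ι) (m' : Mono κ) (D : LocalData n)
    (y : Eucl n) (idx : ι ⊕ κ → Fin n) :
    (m.mul m').eval D y idx
      = m.eval D y (fun i => idx (Sum.inl i)) * m'.eval D y (fun i => idx (Sum.inr i)) := by
  refine (pairSum_sum (L := m.K) (K := m'.K) _ _).trans ?_
  unfold eval
  rw [mul_comm, ← pairSum_mul_left]
  congr 1
  funext l
  rw [mul_comm, ← pairSum_mul_left]
  congr 1
  funext l'
  rw [← fullProd_sum]
  change fullProd (Sum.elim m.N m'.N) (Sum.elim m.P m'.P) D y _ = _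
  congr 1
  funext s
  change Sum.elim idx _ ((Equiv.sumCongr (Equiv.refl _) (Equiv.sumProdDistrib _ _ _).symm)
    ((Equiv.sumSumSumComm _ _ _ _) ((Equiv.sumCongr m.e m'.e)
      (slotsSum m.N m.P m.J₃ m'.N m'.P m'.J₃ s)))) = _
  rcases slotsSum m.N m.P m.J₃ m'.N m'.P m'.J₃ s with z | z
  · simp only [Equiv.sumCongr_apply, Sum.map_inl, Sum.elim_inl]
    rcases m.e z with i | q <;> simp
  · simp only [Equiv.sumCongr_apply, Sum.map_inr, Sum.elim_inr]
    rcases m'.e z with i | q <;> simp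

lemma monoSpan_mul {d d' : ℕ} {ι κ : Type} {f : LocPt n → (ι → Fin n) → ℝ}
    {f' : LocPt n → (κ → Fin n) → ℝ} (hf : f ∈ monoSpan n d ι) (hf' : f' ∈ monoSpan n d' κ) :
    (fun p (idx : ι ⊕ κ → Fin n) => f p (fun i => idx (Sum.inl i)) * f' p (fun i => idx (Sum.inr i)))
      ∈ monoSpan n (d + d') (ι ⊕ κ) := by
  refine monoSpan_induction (d := d) (ι := ι) (κ := ι ⊕ κ)
    ⟨⟨fun f p idx => f p (fun i => idx (Sum.inl i)) * f' p (fun i => idx (Sum.inr i)),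
      fun f g => ?_⟩, fun c f => ?_⟩ (fun m hm => ?_) hf
  · funext p idx
    exact add_mul _ _ _
  · funext p idx
    exact mul_assoc _ _ _
  · refine monoSpan_induction (d := d') (ι := κ) (κ := ι ⊕ κ)
      ⟨⟨fun f' p idx => m.eval p.1.1 p.1.2 (fun i => idx (Sum.inl i))
        * f' p (fun i => idx (Sum.inr i)), fun f g => ?_⟩, fun c f => ?_⟩ (fun m' hm' => ?_) hf'
    · funext p idx
      exact mul_add _ _ _
    · funext p idx
      exact mul_left_comm _ _ _
    · have : (fun p : LocPt n => (m.mul m').eval p.1.1 p.1.2) ∈ monoSpan n (d + d') (ι ⊕ κ) :=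
        (m.mul m').mem_span (by rw [m.mul_order, hm, hm'])
      convert this using 1
      funext p idx
      exact (m.mul_eval m' _ _ _).symm

lemma pairSum_empty (H : Matrix (Fin n) (Fin n) ℝ) (F : (Empty × Fin 2 → Fin n) → ℝ) :
    pairSum H F = F (fun q => q.1.elim) := by
  rw [pairSum_eq, Fintype.sum_subsingleton _ (fun q => q.1.elim)]
  simp [pairWeight]

/-- The curvature factor as a partial contraction. -/
def Mono.rm (N : ℕ) : Mono (Fin (4 + N)) where
  J₁ := Unit
  J₂ := Empty
  J₃ := Empty
  K := Empty
  N _ := N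
  P j := j.elim
  e := Equiv.sumCongr ((Equiv.sumEmpty _ _).trans (Equiv.uniqueSigma (fun _ : Unit => Fin (4 + N))))
    (Equiv.refl _)

lemma Mono.rm_eval (N : ℕ) (D : LocalData n) (y : Eucl n) (idx : Fin (4 + N) → Fin n) :
    (Mono.rm N).eval D y idx = iterCovDeriv D.G (riemann D.G) N idx y := by
  refine (pairSum_empty _ _).trans ?_
  change fullProd (J₁ := Unit) (J₂ := Empty) (J₃ := Empty) (fun _ => N) (fun j => j.elim) D y _ = _
  unfold fullProd facProd
  rw [Fintype.prod_unique, Fintype.prod_empty, Fintype.prod_empty, mul_one, mul_one]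
  rfl

/-- A derivative of `v` as a partial contraction. -/
def Mono.dv (P : ℕ) : Mono (Fin (0 + (P + 1))) where
  J₁ := Empty
  J₂ := Unit
  J₃ := Empty
  K := Empty
  N j := j.elim
  P _ := P
  e := Equiv.sumCongr ((Equiv.emptySum _ _).trans
    (Equiv.uniqueSigma (fun _ : Unit => Fin (0 + (P + 1))))) (Equiv.refl _)

lemma Mono.dv_eval (P : ℕ) (D : LocalData n) (y : Eucl n) (idx : Fin (0 + (P + 1)) → Fin n) :
    (Mono.dv P).eval D y idx
      = (D.v y)⁻¹ * iterCovDeriv D.G (r := 0) (fun _ => D.v) (P + 1) idx y := by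
  refine (pairSum_empty _ _).trans ?_
  change fullProd (J₁ := Empty) (J₂ := Unit) (J₃ := Empty) (fun j => j.elim) (fun _ => P) D y _ = _
  unfold fullProd facProd
  rw [Fintype.prod_unique (ι := Unit), Fintype.prod_empty (ι := Empty),
    Fintype.prod_empty (ι := Empty)]
  simp only [mul_one, one_mul]
  rfl

/-- The metric as a partial contraction. -/
def Mono.metric : Mono (Fin 2) where
  J₁ := Empty
  J₂ := Empty
  J₃ := Unit
  K := Empty
  N j := j.elim
  P j := j.elim
  e := (Equiv.emptySum _ _).trans ((Equiv.punitProd _).trans (Equiv.sumEmpty _ _).symm)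

lemma Mono.metric_eval (D : LocalData n) (y : Eucl n) (idx : Fin 2 → Fin n) :
    Mono.metric.eval D y idx = D.G y (idx 0) (idx 1) := by
  refine (pairSum_empty _ _).trans ?_
  change fullProd (J₁ := Empty) (J₂ := Empty) (J₃ := Unit) (fun j => j.elim) (fun j => j.elim) D y _
    = _
  unfold fullProd facProd
  rw [Fintype.prod_unique (ι := Unit), Fintype.prod_empty (ι := Empty),
    Fintype.prod_empty (ι := Empty)]
  simp only [mul_one, one_mul]
  rfl

/-- Natural families are linear combinations of partial contractions. -/
theorem IsNat.mem_monoSpan {d : ℕ} {ι : Type} [Fintype ι] {T : Fam n ι} (h : IsNat d ι T) :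
    (fun (p : LocPt n) idx => T p.1.1 idx p.1.2) ∈ monoSpan n d ι := by
  induction h with
  | rm N =>
    have := (Mono.rm N).mem_span (n := n) (d := N + 2) (by
      change ∑ _ : Unit, (N + 2) + ∑ j : Empty, (Empty.elim j + 1) = N + 2
      simp)
    convert this using 1
    funext p idx
    exact (Mono.rm_eval N _ _ _).symm
  | dv P =>
    have := (Mono.dv P).mem_span (n := n) (d := P + 1) (by
      change ∑ j : Empty, (Empty.elim j + 2) + ∑ _ : Unit, (P + 1) = P + 1
      simp)
    convert this using 1
    funext p idx
    exact (Mono.dv_eval P _ _ _).symm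
  | metric =>
    have := Mono.metric.mem_span (n := n) (d := 0) (by
      change ∑ j : Empty, (Empty.elim j + 2) + ∑ j : Empty, (Empty.elim j + 1) = 0
      simp)
    convert this using 1
    funext p idx
    exact (Mono.metric_eval _ _ _).symm
  | mul _ _ ihS ihT => exact monoSpan_mul ihS ihT
  | @contract d ι _ T _ ih =>
    have h := monoSpan_contr (L := Unit) (monoSpan_reindex (Equiv.sumCongr (Equiv.refl ι)
      (Equiv.punitProd (Fin 2)).symm) ih)
    convert h using 1
    funext p idx
    rw [pairSum_eq, ← (Equiv.arrowCongr (Equiv.punitProd (Fin 2)).symm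
      (Equiv.refl (Fin n))).sum_comp, ← (finTwoArrowEquiv (Fin n)).symm.sum_comp,
      Fintype.sum_prod_type]
    refine Finset.sum_congr rfl fun a _ => Finset.sum_congr rfl fun b _ => ?_
    congr 1
    · simp [pairWeight, Equiv.arrowCongr]
    · congr 1
      funext i
      rcases i with i | i
      · rfl
      · fin_cases i <;> rfl
  | reindex e _ ih => exact monoSpan_reindex e ih
  | zero d ι => exact Submodule.zero_mem _
  | add _ _ ihS ihT => exact Submodule.add_mem _ ihS ihT
  | smul c _ ih => exact Submodule.smul_mem _ c ih
  | congr _ hd hST ih =>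
    subst hd
    convert ih using 1
    funext p idx
    exact hST p.1.1 idx p.1.2 p.2

/-- In a complete contraction, the metric factors can be eliminated. -/
theorem Mono.exists_elim_metrics (t : ℕ) (m : Mono Empty) (ht : Fintype.card m.J₃ = t) :
    ∃ (m' : Mono Empty) (c : ℝ), IsEmpty m'.J₃ ∧ m'.order = m.order ∧
      ∀ (D : LocalData n), ∀ y ∈ D.U, ∀ idx, m.eval D y idx = c * m'.eval D y idx := by
  classical
  induction t generalizing m with
  | zero => exact ⟨m, 1, Fintype.card_eq_zero_iff.1 ht, rfl, fun D y _ idx => (one_mul _).symm⟩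
  | succ t ih =>
    obtain ⟨l0⟩ : Nonempty m.J₃ := Fintype.card_pos_iff.1 (by omega)
    let J := {l // l ≠ l0}
    let S := ((Σ i : m.J₁, Fin (4 + m.N i)) ⊕ (Σ j : m.J₂, Fin (0 + (m.P j + 1))))
    -- The slots of the metric factor `l0` are singled out as the last two, the position required by
    -- `exists_elim_metric`.
    let E : (S ⊕ (J × Fin 2)) ⊕ Fin 2 ≃ S ⊕ (m.J₃ × Fin 2) :=
      (Equiv.sumAssoc _ _ _).trans (Equiv.sumCongr (Equiv.refl _)
        ((Equiv.sumCongr (Equiv.refl _) (Equiv.punitProd _).symm).trans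
          ((Equiv.sumProdDistrib _ _ _).symm.trans (Equiv.prodCongr
            ((Equiv.optionEquivSumPUnit.{0} J).symm.trans (Equiv.optionSubtypeNe l0))
            (Equiv.refl _)))))
    have E0 : ∀ i : Fin 2, E (Sum.inr i) = Sum.inr (l0, i) := fun i => by
      change Sum.inr (Equiv.optionSubtypeNe l0 none, i) = _
      rw [Equiv.optionSubtypeNe_none]
    have E1 : ∀ s : S, E (Sum.inl (Sum.inl s)) = Sum.inl s := fun s => rfl
    have E2 : ∀ (l : J) (i : Fin 2), E (Sum.inl (Sum.inr (l, i))) = Sum.inr (l.1, i) :=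
      fun l i => by
      change Sum.inr (Equiv.optionSubtypeNe l0 (some l), i) = _
      rw [Equiv.optionSubtypeNe_some]
    let e' : (S ⊕ (J × Fin 2)) ⊕ Fin 2 ≃ m.K × Fin 2 := E.trans (m.e.trans (Equiv.emptySum _ _))
    obtain ⟨K', fK', e'', c, hc⟩ := exists_elim_metric (n := n) e'
    let m₁ : Mono Empty :=
      { J₁ := m.J₁, J₂ := m.J₂, J₃ := J, K := K', fK := fK', N := m.N, P := m.P
        e := e''.trans (Equiv.emptySum Empty _).symm }
    obtain ⟨m', c', h0, h1, h2⟩ := ih m₁ (by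
      change Fintype.card J = t
      simp only [J, Fintype.card_subtype_compl, Fintype.card_unique]
      omega)
    refine ⟨m', c * c', h0, h1, fun D y hy idx => ?_⟩
    rw [mul_assoc, ← h2 D y hy]
    refine Eq.trans ?_ ((hc (D.G y) (D.G y)⁻¹ (D.inv_symm hy) (D.inv_mul_cancel hy)
      (D.symmG y hy) fun f => fullProd m.N m.P D y f).trans ?_)
    · unfold eval
      congr 1
      funext κ
      have hκ : ∀ s, Sum.elim idx κ (m.e s) = κ (e' (E.symm s)) := fun s => by
        simp only [e', Equiv.trans_apply, Equiv.apply_symm_apply]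
        rcases m.e s with i | q
        · exact i.elim
        · simp
      simp only [hκ]
      unfold fullProd
      rw [← (Equiv.optionSubtypeNe l0).prod_comp, Fintype.prod_option]
      have F0 : ∀ i : Fin 2, E.symm (Sum.inr (l0, i)) = Sum.inr i := fun i => by
        rw [← E0, E.symm_apply_apply]
      have F1 : ∀ s : S, E.symm (Sum.inl s) = Sum.inl (Sum.inl s) := fun s => by
        rw [← E1, E.symm_apply_apply]
      have F2 : ∀ (l : J) (i : Fin 2), E.symm (Sum.inr (l.1, i)) = Sum.inl (Sum.inr (l, i)) :=
        fun l i => by rw [← E2, E.symm_apply_apply]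
      simp only [Equiv.optionSubtypeNe_none, Equiv.optionSubtypeNe_some, F0]
      have F1' : ∀ s, κ (e' (E.symm (Sum.inl s))) = κ (e' (Sum.inl (Sum.inl s))) := fun s => by
        rw [F1]
      have F2' : ∀ (l : J) (i : Fin 2), κ (e' (E.symm (Sum.inr (l.1, i))))
          = κ (e' (Sum.inl (Sum.inr (l, i)))) := fun l i => by rw [F2]
      simp only [F1', F2']
      ring
    · congr 1

/-! ### Complete contractions of matrix fields -/

/-- The value of a complete contraction, for a matrix field `G` and functions on `ℝⁿ`. -/
def Contraction.evalG {ℓ : ℕ} (α : Contraction ℓ) (G : Eucl n → Matrix (Fin n) (Fin n) ℝ)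
    (u : Fin ℓ → Eucl n → ℝ) (y : Eucl n) : ℝ :=
  ∑ idx : ((Σ i : Fin α.q, Fin (4 + α.N i)) ⊕ (Σ j : Fin ℓ, Fin (0 + α.P j))) → Fin n,
    (∏ p : Fin α.m, (G y)⁻¹ (idx (α.pairing (p, 0))) (idx (α.pairing (p, 1))))
      * (∏ i : Fin α.q, iterCovDeriv G (riemann G) (α.N i) (fun s => idx (Sum.inl ⟨i, s⟩)) y)
      * (∏ j : Fin ℓ, iterCovDeriv G (r := 0) (fun _ => u j) (α.P j)
            (fun s => idx (Sum.inr ⟨j, s⟩)) y)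

lemma Contraction.eval_eq_evalG {ℓ : ℕ} (α : Contraction ℓ) {M : SmoothManifold n} (g : Metric M)
    (u : Fin ℓ → Smooth M) (e : OpenPartialHomeomorph M (Eucl n)) (y : Eucl n) :
    α.eval g u e y = α.evalG (gram g e) (fun j z => u j (e.symm z)) y := rfl

/-- The number of derivatives, the curvature counting for two. -/
def Contraction.order {ℓ : ℕ} (α : Contraction ℓ) : ℕ := ∑ i, (α.N i + 2) + ∑ j, α.P j

/-- Count the slots: a curvature factor has `4 + N i` of them but contributes only `N i + 2` to the
order. -/
lemma Contraction.two_mul_m {ℓ : ℕ} (α : Contraction ℓ) : 2 * α.m = α.order + 2 * α.q := by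
  have h := Fintype.card_congr α.pairing
  simp only [Fintype.card_prod, Fintype.card_fin, Fintype.card_sum, Fintype.card_sigma] at h
  unfold order
  simp only [Finset.sum_add_distrib, Finset.sum_const, Finset.card_univ, Fintype.card_fin,
    smul_eq_mul, zero_add] at h ⊢
  omega

/-- A complete contraction with arbitrary index types. -/
def contrSum {J₁ J₂ K : Type} [Fintype J₁] [Fintype J₂] [Fintype K] (N : J₁ → ℕ) (P : J₂ → ℕ)
    (e : (Σ i : J₁, Fin (4 + N i)) ⊕ (Σ j : J₂, Fin (0 + P j)) ≃ K × Fin 2)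
    (G : Eucl n → Matrix (Fin n) (Fin n) ℝ) (u : J₂ → Eucl n → ℝ) (y : Eucl n) : ℝ :=
  pairSum (G y)⁻¹ fun κ : K × Fin 2 → Fin n =>
    (∏ i, iterCovDeriv G (riemann G) (N i) (fun s => κ (e (Sum.inl ⟨i, s⟩))) y)
      * ∏ j, iterCovDeriv G (r := 0) (fun _ => u j) (P j) (fun s => κ (e (Sum.inr ⟨j, s⟩))) y

lemma Contraction.evalG_eq_contrSum {ℓ : ℕ} (α : Contraction ℓ)
    (G : Eucl n → Matrix (Fin n) (Fin n) ℝ) (u : Fin ℓ → Eucl n → ℝ) (y : Eucl n) :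
    α.evalG G u y = contrSum α.N α.P α.pairing.symm G u y := by
  unfold contrSum
  rw [pairSum_eq]
  refine Fintype.sum_equiv (Equiv.arrowCongr α.pairing.symm (Equiv.refl _)) _ _ fun idx => ?_
  rw [mul_assoc]
  simp [pairWeight, Equiv.arrowCongr]

/-- The return from arbitrary finite index types to the numbered contractions in the definition of
natural operators. -/
theorem exists_contraction {J₁ J₂ K : Type} [Fintype J₁] [Fintype J₂] [Fintype K] {ℓ : ℕ}
    (N : J₁ → ℕ) (P : J₂ → ℕ)
    (e : (Σ i : J₁, Fin (4 + N i)) ⊕ (Σ j : J₂, Fin (0 + P j)) ≃ K × Fin 2) (b : J₂ ≃ Fin ℓ) :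
    ∃ α : Contraction ℓ, α.q = Fintype.card J₁ ∧ (∀ j, α.P (b j) = P j) ∧
      α.order = ∑ i, (N i + 2) + ∑ j, P j ∧
      ∀ (G : Eucl n → Matrix (Fin n) (Fin n) ℝ) (u : Fin ℓ → Eucl n → ℝ) (y : Eucl n),
        α.evalG G u y = contrSum N P e G (fun j => u (b j)) y := by
  let a := Fintype.equivFin J₁
  let k := Fintype.equivFin K
  let α : Contraction ℓ :=
    { q := Fintype.card J₁
      N := fun i => N (a.symm i)
      P := fun j => P (b.symm j)
      m := Fintype.card K
      pairing := (Equiv.prodCongr k.symm (Equiv.refl _)).trans (e.symm.trans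
        (Equiv.sumCongr (Equiv.sigmaCongrLeft' a) (Equiv.sigmaCongrLeft' b))) }
  refine ⟨α, rfl, fun j => congrArg P (b.symm_apply_apply j), ?_, fun G u y => ?_⟩
  · change ∑ i, (N (a.symm i) + 2) + ∑ j, P (b.symm j) = _
    rw [a.symm.sum_comp fun i => N i + 2, b.symm.sum_comp P]
  · rw [α.evalG_eq_contrSum]
    unfold contrSum
    rw [pairSum_equiv _ k]
    congr 1
    funext κ
    congr 1
    · exact a.symm.prod_comp fun i => iterCovDeriv G (riemann G) (N i)
        (fun s => κ (k (e (Sum.inl ⟨i, s⟩)).1, (e (Sum.inl ⟨i, s⟩)).2)) y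
    · refine Eq.trans ?_ (b.symm.prod_comp fun j => iterCovDeriv G (r := 0) (fun _ => u (b j)) (P j)
        (fun s => κ (k (e (Sum.inr ⟨j, s⟩)).1, (e (Sum.inr ⟨j, s⟩)).2)) y)
      refine Finset.prod_congr rfl fun j _ => ?_
      rw [b.apply_symm_apply]
      rfl

/-- Permuting the arguments of a complete contraction. -/
theorem Contraction.exists_perm {ℓ : ℕ} (α : Contraction ℓ) (σ : Equiv.Perm (Fin ℓ)) :
    ∃ β : Contraction ℓ, ∀ (G : Eucl n → Matrix (Fin n) (Fin n) ℝ) (u : Fin ℓ → Eucl n → ℝ)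
      (y : Eucl n), β.evalG G u y = α.evalG G (fun j => u (σ j)) y := by
  obtain ⟨β, -, -, -, h⟩ := exists_contraction (n := n) α.N α.P α.pairing.symm σ
  exact ⟨β, fun G u y => by rw [h, α.evalG_eq_contrSum]⟩

/-- Adding arguments that are not differentiated. -/
theorem Contraction.exists_pad {p ℓ : ℕ} (α : Contraction p) (hp : p ≤ ℓ) :
    ∃ β : Contraction ℓ, ∀ (G : Eucl n → Matrix (Fin n) (Fin n) ℝ) (v : Eucl n → ℝ)
      (y : Eucl n), β.evalG G (fun _ => v) y = v y ^ (ℓ - p) * α.evalG G (fun _ => v) y := by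
  let b : Fin p ⊕ Fin (ℓ - p) ≃ Fin ℓ := finSumFinEquiv.trans (finCongr (by omega))
  let P : Fin p ⊕ Fin (ℓ - p) → ℕ := Sum.elim α.P fun _ => 0
  have : IsEmpty (Σ j : Fin (ℓ - p), Fin (0 + P (Sum.inr j))) := ⟨fun x => x.2.elim0⟩
  let E : (Σ j, Fin (0 + P j)) ≃ Σ j, Fin (0 + α.P j) :=
    (Equiv.sumSigmaDistrib _).trans (Equiv.sumEmpty _ _)
  obtain ⟨β, -, -, -, h⟩ := exists_contraction (n := n) α.N P
    ((Equiv.sumCongr (Equiv.refl _) E).trans α.pairing.symm) b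
  refine ⟨β, fun G v y => ?_⟩
  rw [h, α.evalG_eq_contrSum]
  unfold contrSum
  rw [← pairSum_mul_left]
  congr 1
  funext κ
  rw [Fintype.prod_sum_type, ← mul_assoc, mul_comm]
  congr 1
  exact (Finset.prod_const _).trans (by simp)

lemma contrSum_congr {J₁ J₂ K : Type} [Fintype J₁] [Fintype J₂] [Fintype K] (N : J₁ → ℕ)
    (P : J₂ → ℕ) (e : (Σ i : J₁, Fin (4 + N i)) ⊕ (Σ j : J₂, Fin (0 + P j)) ≃ K × Fin 2)
    (G : Eucl n → Matrix (Fin n) (Fin n) ℝ) (u : J₂ → Eucl n → ℝ) (y : Eucl n)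
    (T : (i : J₁) → (Fin (4 + N i) → Fin n) → ℝ) (a : ℝ)
    (h : ∀ i idx, iterCovDeriv G (riemann G) (N i) idx y = a * T i idx) :
    contrSum N P e G u y = a ^ Fintype.card J₁ * pairSum (G y)⁻¹ fun κ : K × Fin 2 → Fin n =>
      (∏ i, T i (fun s => κ (e (Sum.inl ⟨i, s⟩))))
      * ∏ j, iterCovDeriv G (r := 0) (fun _ => u j) (P j) (fun s => κ (e (Sum.inr ⟨j, s⟩))) y := by
  unfold contrSum
  rw [← pairSum_mul_left]
  congr 1
  funext κ
  simp only [h, Finset.prod_mul_distrib, Finset.prod_const, Finset.card_univ, mul_assoc]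

lemma pairSum_smul_matrix (H : Matrix (Fin n) (Fin n) ℝ) (a : ℝ) {K : Type} [Fintype K]
    (F : (K × Fin 2 → Fin n) → ℝ) :
    pairSum (a • H) F = a ^ Fintype.card K * pairSum H F := by
  simp only [pairSum, pairWeight, Matrix.smul_apply, smul_eq_mul, Finset.prod_mul_distrib,
    Finset.prod_const, Finset.card_univ, Finset.mul_sum, mul_assoc]

/-! ### The conformal expansion -/

/-- Splitting off the first member of a dependent sum. -/
def sigmaFinSucc {q : ℕ} (F : Fin (q + 1) → Type) : F 0 ⊕ (Σ i : Fin q, F i.succ) ≃ (Σ i, F i) where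
  toFun := Sum.elim (Sigma.mk 0) (fun x => ⟨x.1.succ, x.2⟩)
  invFun x := Fin.cases (motive := fun i => F i → F 0 ⊕ (Σ i : Fin q, F i.succ)) Sum.inl
    (fun i s => Sum.inr ⟨i, s⟩) x.1 x.2
  left_inv := by rintro (s | ⟨i, s⟩) <;> rfl
  right_inv := by
    rintro ⟨i, s⟩
    induction i using Fin.cases <;> rfl

/-- The empty product. -/
def Mono.one : Mono Empty where
  J₁ := Empty
  J₂ := Empty
  J₃ := Empty
  K := Empty
  N j := j.elim
  P j := j.elim
  e :=
    have : IsEmpty (Slots (J₁ := Empty) (J₂ := Empty) (fun j => j.elim) (fun j => j.elim) Empty) :=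
      ⟨fun s => by rcases s with (s | s) | s <;> exact s.1.elim⟩
    Equiv.equivOfIsEmpty _ _

lemma one_mem_monoSpan : (fun _ _ => 1) ∈ monoSpan n 0 Empty := by
  have := Mono.one.mem_span (n := n) (d := 0) (by
    change ∑ j : Empty, (Empty.elim j + 2) + ∑ j : Empty, (Empty.elim j + 1) = 0
    simp)
  convert this using 1
  funext p idx
  refine Eq.symm ((pairSum_empty _ _).trans ?_)
  change fullProd (J₁ := Empty) (J₂ := Empty) (J₃ := Empty) (fun j => j.elim) (fun j => j.elim)
    _ _ _ = _
  unfold fullProd facProd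
  rw [Fintype.prod_empty (ι := Empty), Fintype.prod_empty (ι := Empty),
    Fintype.prod_empty (ι := Empty)]
  simp only [mul_one]

lemma monoSpan_prod {q : ℕ} (d : Fin q → ℕ) (F : Fin q → Type)
    (T : (i : Fin q) → LocPt n → (F i → Fin n) → ℝ) (hT : ∀ i, T i ∈ monoSpan n (d i) (F i)) :
    (fun p idx => ∏ i, T i p (fun s => idx ⟨i, s⟩)) ∈ monoSpan n (∑ i, d i) (Σ i, F i) := by
  induction q with
  | zero =>
    have := monoSpan_reindex (Equiv.equivOfIsEmpty Empty (Σ i, F i)) (one_mem_monoSpan (n := n))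
    simpa using this
  | succ q ih =>
    have := monoSpan_reindex (sigmaFinSucc F) (monoSpan_mul (hT 0)
      (ih (fun i => d i.succ) (fun i => F i.succ) (fun i => T i.succ) fun i => hT i.succ))
    simp only [Fin.prod_univ_succ, Fin.sum_univ_succ]
    exact this

/-- The complete contractions of a conformally related metric, in terms of complete contractions of
the original one and of the derivatives of the conformal factor. -/
theorem Contraction.conformal_expansion (α : Contraction 0) (μ : ℝ) :
    ∃ (K : ℕ) (c : Fin K → ℝ) (p : Fin K → ℕ) (β : (s : Fin K) → Contraction (p s)),
      (∀ s j, 1 ≤ (β s).P j) ∧ (∀ s, (β s).order = α.order) ∧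
      ∀ (D : LocalData n) (u : Fin 0 → Eucl n → ℝ), ∀ y ∈ D.U,
        α.evalG (D.conf μ) u y = D.v y ^ (-(μ * α.order)) *
          ∑ s, c s * ((D.v y)⁻¹ ^ p s * (β s).evalG D.G (fun _ => D.v) y) := by
  -- Each curvature factor of the new metric is `v^{2μ}` times a natural family of the old one, so
  -- up to a power of `v` the contraction is a complete contraction of a product of natural
  -- families, hence in the span of the partial contractions without free slots.
  choose T hT hRm using fun N => exists_iterCovDeriv_riemann_conf (n := n) μ N
  have h1 := monoSpan_prod (fun i => α.N i + 2) (fun i => Fin (4 + α.N i))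
    (fun i (p : LocPt n) idx => T (α.N i) p.1.1 idx p.1.2) fun i => (hT (α.N i)).mem_monoSpan
  have : IsEmpty (Σ j : Fin 0, Fin (0 + α.P j)) := ⟨fun x => x.1.elim0⟩
  have h2 := monoSpan_contr (monoSpan_reindex (((Equiv.sumEmpty _ _).symm.trans
    α.pairing.symm).trans (Equiv.emptySum Empty _).symm) h1)
  have horder : α.order = ∑ i, (α.N i + 2) := by simp [order]
  rw [← horder] at h2
  obtain ⟨K, c, f, hf⟩ := (Submodule.mem_span_set' (R := ℝ)).1 h2
  choose m0 hm0 hm0' using fun s => (f s).2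
  -- A `Contraction` has no metric factors; those created by the conformal change have to be
  -- contracted away.
  choose m c' hJ hmo hme using fun s => (m0 s).exists_elim_metrics (n := n) _ rfl
  let p : Fin K → ℕ := fun s => Fintype.card (m s).J₂
  have hβ : ∀ s, ∃ β : Contraction (p s), (∀ j, 1 ≤ β.P j) ∧ β.order = (m s).order ∧
      ∀ (D : LocalData n), ∀ y ∈ D.U, ∀ idx, (m s).eval D y idx
        = (D.v y)⁻¹ ^ p s * β.evalG D.G (fun _ => D.v) y := by
    intro s
    have := hJ s
    let b := Fintype.equivFin (m s).J₂
    obtain ⟨β, -, hP, ho, hβ⟩ := exists_contraction (n := n) (m s).N (fun j => (m s).P j + 1)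
      ((Equiv.sumEmpty _ _).symm.trans ((m s).e.trans (Equiv.emptySum _ _))) b
    refine ⟨β, fun j => ?_, ho, fun D y hy idx => ?_⟩
    · rw [← b.apply_symm_apply j, hP]
      omega
    · rw [hβ]
      unfold contrSum Mono.eval
      rw [← pairSum_mul_left]
      congr 1
      funext κ
      unfold fullProd facProd
      rw [Fintype.prod_empty (ι := (m s).J₃), mul_one, Finset.prod_mul_distrib, mul_left_comm]
      have hκ : ∀ t, Sum.elim idx κ ((m s).e t) = κ (Equiv.emptySum Empty _ ((m s).e t)) := by
        intro t
        rcases (m s).e t with i | q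
        · exact i.elim
        · simp
      simp only [hκ, Finset.prod_const, Finset.card_univ]
      rfl
  choose β hP ho he using hβ
  refine ⟨K, fun s => c s * c' s, p, β, hP, fun s => by rw [ho, hmo, hm0], fun D u y hy => ?_⟩
  have h3 := congrFun (congrFun hf ⟨(D, y), hy⟩) (fun i => i.elim)
  simp only [Finset.sum_apply, Pi.smul_apply, hm0', smul_eq_mul] at h3
  have h4 : ∑ s, c s * c' s * ((D.v y)⁻¹ ^ p s * (β s).evalG D.G (fun _ => D.v) y)
      = pairSum (D.G y)⁻¹ fun κ : Fin α.m × Fin 2 → Fin n =>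
        ∏ i, T (α.N i) D (fun s => κ (α.pairing.symm (Sum.inl ⟨i, s⟩))) y := by
    refine Eq.trans ?_ (h3.trans ?_)
    · refine Finset.sum_congr rfl fun s _ => ?_
      rw [hme s D y hy, he s D y hy, mul_assoc]
    · rfl
  rw [h4, α.evalG_eq_contrSum,
    contrSum_congr _ _ _ _ _ _ (fun i idx => T (α.N i) D idx y) _ fun i idx => hRm _ D idx y hy]
  have hv := D.posv y hy
  have hinv : (D.conf μ y)⁻¹ = (D.v y ^ (2 * μ))⁻¹ • (D.G y)⁻¹ := by
    have hp : 0 < D.v y ^ (2 * μ) := Real.rpow_pos_of_pos hv _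
    have := Matrix.inv_smul' (A := D.G y) (Units.mk0 _ hp.ne') (D.detG y hy)
    simpa [LocalData.conf, Units.smul_def] using this
  simp only [hinv, pairSum_smul_matrix, Fintype.card_fin, Finset.univ_eq_empty, Finset.prod_empty,
    mul_one]
  rw [← mul_assoc]
  congr 1
  -- The `q` curvatures contribute `2μq` to the exponent and the `m` inverse metrics `-2μm`; the
  -- total is `-μ` times the order because `2m = order + 2q`.
  rw [← Real.rpow_neg hv.le, ← Real.rpow_natCast, ← Real.rpow_natCast, ← Real.rpow_mul hv.le,
    ← Real.rpow_mul hv.le, ← Real.rpow_add hv]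
  congr 1
  have := congrArg (fun t : ℕ => (t : ℝ)) α.two_mul_m
  push_cast at this
  linear_combination (-μ) * this

/-! ### Metrics in charts -/

section Charts

variable {M : SmoothManifold n} (g : Metric M) {e : OpenPartialHomeomorph M (Eucl n)}

lemma contMDiffOn_chart_symm (he : e ∈ charts M) : ContMDiffOn (𝓡 n) (𝓡 n) ∞ e.symm e.target :=
  contMDiffOn_symm_of_mem_maximalAtlas he

lemma contMDiffAt_chart_symm (he : e ∈ charts M) {y : Eucl n} (hy : y ∈ e.target) :
    ContMDiffAt (𝓡 n) (𝓡 n) ∞ e.symm y :=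
  (contMDiffOn_chart_symm he).contMDiffAt (e.open_target.mem_nhds hy)

lemma contMDiffAt_chart (he : e ∈ charts M) {x : M} (hx : x ∈ e.source) :
    ContMDiffAt (𝓡 n) (𝓡 n) ∞ e x :=
  (contMDiffOn_of_mem_maximalAtlas he).contMDiffAt (e.open_source.mem_nhds hx)

lemma mdifferentiable_chart' (he : e ∈ charts M) : e.MDifferentiable (𝓡 n) (𝓡 n) :=
  ⟨(contMDiffOn_of_mem_maximalAtlas he).mdifferentiableOn (by simp),
    (contMDiffOn_chart_symm he).mdifferentiableOn (by simp)⟩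

lemma contDiffAt_comp_chart_symm (he : e ∈ charts M) (u : Smooth M) {y : Eucl n}
    (hy : y ∈ e.target) : ContDiffAt ℝ ∞ (fun z => u (e.symm z)) y := by
  have := u.contMDiff.contMDiffAt.comp y (contMDiffAt_chart_symm he hy)
  exact this.contDiffAt

lemma contMDiffOn_coordField (he : e ∈ charts M) (w : Eucl n) :
    ContMDiffOn (𝓡 n) ((𝓡 n).prod 𝓘(ℝ, Eucl n)) ∞
      (fun y => (Bundle.TotalSpace.mk' (Eucl n) (E := fun x : M => TangentSpace (𝓡 n) x) (e.symm y)
        (mfderiv (𝓡 n) (𝓡 n) e.symm y w))) e.target := by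
  have h1 := (contMDiffOn_chart_symm he).contMDiffOn_tangentMapWithin (m := ∞) (by simp)
    e.open_target.uniqueMDiffOn
  have h2 : ContMDiff (𝓡 n) (𝓡 n).tangent ∞
      (fun y : Eucl n => (⟨y, w⟩ : TangentBundle (𝓡 n) (Eucl n))) :=
    contMDiff_vectorSpace_iff_contDiff.2 contDiff_const
  have h3 := h1.comp (s := e.target) h2.contMDiffOn (fun y hy => hy)
  refine h3.congr fun y hy => ?_
  simp only [Function.comp, tangentMapWithin, mfderivWithin_of_isOpen e.open_target hy]

lemma contDiffAt_gram (he : e ∈ charts M) {y : Eucl n} (hy : y ∈ e.target) (i j : Fin n) :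
    ContDiffAt ℝ ∞ (fun z => gram g e z i j) y := by
  have h1 := (g.contMDiff.contMDiffAt (x := e.symm y)).comp y (contMDiffAt_chart_symm he hy)
  have hv := fun i : Fin n => (contMDiffOn_coordField he (EuclideanSpace.single i (1 : ℝ))).contMDiffAt
    (e.open_target.mem_nhds hy)
  have h := ContMDiffAt.clm_bundle_apply₂ (E₃ := fun _ : M => ℝ) (F₃ := ℝ)
    (E₁ := fun x : M => TangentSpace (𝓡 n) x)
    (E₂ := fun x : M => TangentSpace (𝓡 n) x) h1 (hv i) (hv j)
  have h' := (Bundle.contMDiffAt_totalSpace.1 h).2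
  exact h'.contDiffAt

lemma gram_apply (y a b : Eucl n) :
    g.inner (e.symm y) (mfderiv (𝓡 n) (𝓡 n) e.symm y a) (mfderiv (𝓡 n) (𝓡 n) e.symm y b)
      = ∑ i, ∑ j, a i * b j * gram g e y i j := by
  have ha : ∀ a : Eucl n, a = ∑ i, a i • EuclideanSpace.single i (1 : ℝ) := fun a => by
    simpa using ((EuclideanSpace.basisFun (Fin n) ℝ).sum_repr a).symm
  let A : Eucl n →L[ℝ] Eucl n := mfderiv (𝓡 n) (𝓡 n) e.symm y
  let B : Eucl n →L[ℝ] Eucl n →L[ℝ] ℝ := g.inner (e.symm y)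
  change B (A a) (A b) = ∑ i, ∑ j, a i * b j *
    B (A (EuclideanSpace.single i 1)) (A (EuclideanSpace.single j 1))
  conv_lhs => rw [ha a, ha b]
  simp only [map_sum, map_smul, sum_apply, smul_apply,
    smul_eq_mul, Finset.mul_sum, mul_assoc]
  rw [Finset.sum_comm]
  exact Finset.sum_congr rfl fun i _ => Finset.sum_congr rfl fun j _ => by ring

lemma gram_symm (y : Eucl n) (i j : Fin n) : gram g e y i j = gram g e y j i := g.symm _ _ _

lemma gram_posDef (he : e ∈ charts M) {y : Eucl n} (hy : y ∈ e.target) : (gram g e y).PosDef := by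
  refine Matrix.PosDef.of_dotProduct_mulVec_pos ?_ fun x hx => ?_
  · ext i j
    simpa using gram_symm g y j i
  · have hinj := (mdifferentiable_chart' he).symm.mfderiv_injective (x := y) hy
    have hne : mfderiv (𝓡 n) (𝓡 n) e.symm y (WithLp.toLp 2 x : Eucl n) ≠ 0 := by
      intro h0
      have := hinj (h0.trans (map_zero _).symm)
      exact hx (congrArg WithLp.ofLp this)
    have hp := g.pos _ _ hne
    rw [gram_apply] at hp
    refine hp.trans_eq ?_
    simp only [dotProduct, Matrix.mulVec, Finset.mul_sum, star_trivial]
    exact Finset.sum_congr rfl fun i _ => Finset.sum_congr rfl fun j _ => by ring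

lemma gram_conformal (Υ : Smooth M) (y : Eucl n) :
    gram (conformal g Υ) e y = Real.exp (2 * Υ (e.symm y)) • gram g e y := rfl

/-- The local data of a metric and a positive function in a chart. -/
def localData (he : e ∈ charts M) (v : Smooth M) (hv : ∀ x, 0 < v x) : LocalData n where
  U := e.target
  isOpen := e.open_target
  G := gram g e
  smoothG _ hy i j := contDiffAt_gram g he hy i j
  symmG y _ i j := gram_symm g y i j
  detG _ hy := (gram_posDef g he hy).det_pos.ne'.isUnit
  v z := v (e.symm z)
  smoothv _ hy := contDiffAt_comp_chart_symm he v hy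
  posv _ _ := hv _

/-- The change of the components of a metric under a change of charts. -/
lemma gram_change {e' : OpenPartialHomeomorph M (Eucl n)} (he : e ∈ charts M) (he' : e' ∈ charts M)
    {y : Eucl n} (hy : y ∈ e'.target) (hy' : e'.symm y ∈ e.source) :
    (gram g e' y).det = (fderiv ℝ (fun z => e (e'.symm z)) y).det ^ 2 * (gram g e (e (e'.symm y))).det := by
  set τ : Eucl n → Eucl n := fun z => e (e'.symm z) with hτ
  have hd : MDifferentiableAt (𝓡 n) (𝓡 n) τ y :=
    ((contMDiffAt_chart he hy').comp y (contMDiffAt_chart_symm he' hy)).mdifferentiableAt (by simp)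
  have hty : τ y ∈ e.target := e.map_source hy'
  have hmf : mfderiv (𝓡 n) (𝓡 n) e'.symm y
      = (mfderiv (𝓡 n) (𝓡 n) e.symm (τ y)).comp (mfderiv (𝓡 n) (𝓡 n) τ y) := by
    rw [← mfderiv_comp y ((contMDiffAt_chart_symm he hty).mdifferentiableAt (by simp)) hd]
    refine Filter.EventuallyEq.mfderiv_eq ?_
    have : e'.target ∩ e'.symm ⁻¹' e.source ∈ nhds y :=
      (e'.symm.isOpen_inter_preimage e.open_source).mem_nhds ⟨hy, hy'⟩
    filter_upwards [this] with z hz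
    exact (e.left_inv hz.2).symm
  -- With `J` the Jacobian matrix of the transition map `τ`, the new matrix of the metric is `Jᵀ G
  -- J`.
  have hmat : gram g e' y = (LinearMap.toMatrix (EuclideanSpace.basisFun (Fin n) ℝ).toBasis
      (EuclideanSpace.basisFun (Fin n) ℝ).toBasis (fderiv ℝ τ y)).transpose * gram g e (τ y)
      * LinearMap.toMatrix (EuclideanSpace.basisFun (Fin n) ℝ).toBasis
      (EuclideanSpace.basisFun (Fin n) ℝ).toBasis (fderiv ℝ τ y) := by
    ext i j
    have hpt : e.symm (τ y) = e'.symm y := e.left_inv hy'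
    have hg : ∀ {p q : M}, p = q → ∀ a b : Eucl n,
        (g.inner p : Eucl n →L[ℝ] Eucl n →L[ℝ] ℝ) a b
          = (g.inner q : Eucl n →L[ℝ] Eucl n →L[ℝ] ℝ) a b := by
      rintro _ _ rfl a b
      rfl
    have hL : ∀ k l, LinearMap.toMatrix (EuclideanSpace.basisFun (Fin n) ℝ).toBasis
        (EuclideanSpace.basisFun (Fin n) ℝ).toBasis (fderiv ℝ τ y : Eucl n →ₗ[ℝ] Eucl n) k l
        = fderiv ℝ τ y (EuclideanSpace.single l 1) k := fun k l => by
      simp [LinearMap.toMatrix_apply]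
    have h1 : gram g e' y i j = ∑ k, ∑ l, fderiv ℝ τ y (EuclideanSpace.single i 1) k
        * fderiv ℝ τ y (EuclideanSpace.single j 1) l * gram g e (τ y) k l := by
      rw [← gram_apply]
      change g.inner _ _ _ = _
      rw [hmf, mfderiv_eq_fderiv]
      exact hg hpt.symm _ _
    rw [h1, Matrix.mul_apply]
    simp only [Matrix.mul_apply, Matrix.transpose_apply, hL, Finset.sum_mul]
    rw [Finset.sum_comm]
    exact Finset.sum_congr rfl fun k _ => Finset.sum_congr rfl fun l _ => by ring
  rw [hmat, Matrix.det_mul, Matrix.det_mul, Matrix.det_transpose, LinearMap.det_toMatrix]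
  change _ * _ * _ = LinearMap.det _ ^ 2 * _
  ring

end Charts

/-! ### The Riemannian volume -/

section Volume

variable {M : SmoothManifold n} (g : Metric M) {e e' : OpenPartialHomeomorph M (Eucl n)}

/-- The density of the Riemannian volume in a chart. -/
def volDensity (e : OpenPartialHomeomorph M (Eucl n)) (y : Eucl n) : ℝ := Real.sqrt (gram g e y).det

lemma volDensity_pos (he : e ∈ charts M) {y : Eucl n} (hy : y ∈ e.target) :
    0 < volDensity g e y := Real.sqrt_pos.2 (gram_posDef g he hy).det_pos

lemma continuousOn_volDensity (he : e ∈ charts M) : ContinuousOn (volDensity g e) e.target := by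
  refine Real.continuous_sqrt.comp_continuousOn fun y hy => ?_
  have : ContinuousAt (fun z => (gram g e z).det) y := by
    simp only [Matrix.det_apply]
    refine tendsto_finsetSum _ fun σ _ => ?_
    refine Filter.Tendsto.const_smul ?_ _
    exact tendsto_finsetProd _ fun i _ => (contDiffAt_gram g he hy _ _).continuousAt
  exact this.continuousWithinAt

lemma aemeasurable_symm (e : OpenPartialHomeomorph M (Eucl n)) (f : Eucl n → ENNReal) :
    AEMeasurable e.symm ((volume.restrict e.target).withDensity f) :=
  (e.continuousOn_symm.aemeasurable e.open_target.measurableSet).mono_ac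
    (withDensity_absolutelyContinuous _ _)

lemma aemeasurable_volDensity (he : e ∈ charts M) :
    AEMeasurable (fun y => ENNReal.ofReal (volDensity g e y)) (volume.restrict e.target) :=
  ((continuousOn_volDensity g he).aemeasurable e.open_target.measurableSet).ennreal_ofReal

lemma chartMeasure_apply {A : Set M} (hA : MeasurableSet A) :
    chartMeasure g e A
      = ∫⁻ y in e.target ∩ e.symm ⁻¹' A, ENNReal.ofReal (volDensity g e y) := by
  unfold chartMeasure
  rw [Measure.map_apply_of_aemeasurable (aemeasurable_symm e _) hA, withDensity_apply',
    Measure.restrict_restrict' e.open_target.measurableSet, Set.inter_comm]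
  rfl

lemma measurableSet_chart_preimage {A : Set M} (hA : MeasurableSet A) :
    MeasurableSet (e.target ∩ e.symm ⁻¹' A) := by
  have h := (continuousOn_iff_continuous_domRestrict.1 e.continuousOn_symm).measurable hA
  have := MeasurableSet.subtype_image e.open_target.measurableSet h
  convert this using 1
  ext y
  simp [and_comm]

/-- Change of variables for the transition map: the square root of `gram_change` supplies exactly
the absolute value of its Jacobian determinant. -/
lemma chartMeasure_eq_on (he : e ∈ charts M) (he' : e' ∈ charts M) {A : Set M}
    (hA : MeasurableSet A) (h : A ⊆ e.source) (h' : A ⊆ e'.source) :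
    chartMeasure g e A = chartMeasure g e' A := by
  rw [chartMeasure_apply g hA, chartMeasure_apply g hA]
  set τ : Eucl n → Eucl n := fun z => e (e'.symm z)
  have himg : e.target ∩ e.symm ⁻¹' A = τ '' (e'.target ∩ e'.symm ⁻¹' A) := by
    ext y
    constructor
    · rintro ⟨hy, hyA⟩
      refine ⟨e' (e.symm y), ⟨e'.map_source (h' hyA), ?_⟩, ?_⟩
      · simpa [e'.left_inv (h' hyA)] using hyA
      · simp [τ, e'.left_inv (h' hyA), e.right_inv hy]
    · rintro ⟨z, ⟨hz, hzA⟩, rfl⟩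
      refine ⟨e.map_source (h hzA), ?_⟩
      simpa [τ, e.left_inv (h hzA)] using hzA
  have hdiff : ∀ z ∈ e'.target ∩ e'.symm ⁻¹' A, DifferentiableAt ℝ τ z := fun z hz =>
    (((contMDiffAt_chart he (h hz.2)).comp z
      (contMDiffAt_chart_symm he' hz.1)).mdifferentiableAt (by simp)).differentiableAt
  rw [himg, lintegral_image_eq_lintegral_abs_det_fderiv_mul volume (measurableSet_chart_preimage hA)
    (fun z hz => (hdiff z hz).hasFDerivAt.hasFDerivWithinAt)]
  · refine setLIntegral_congr_fun (measurableSet_chart_preimage hA) fun z hz => ?_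
    rw [← ENNReal.ofReal_mul (abs_nonneg _)]
    congr 1
    unfold volDensity
    rw [gram_change g he he' hz.1 (h hz.2), Real.sqrt_mul (sq_nonneg _), Real.sqrt_sq_eq_abs]
  · rintro z ⟨hz, hzA⟩ w ⟨hw, hwA⟩ hzw
    exact e'.symm.injOn hz hw (e.injOn (h hzA) (h hwA) hzw)

lemma chartMeasure_compl_source : chartMeasure g e e.sourceᶜ = 0 := by
  rw [chartMeasure_apply g e.open_source.measurableSet.compl]
  have : e.target ∩ e.symm ⁻¹' e.sourceᶜ = ∅ := by
    ext y
    simp only [Set.mem_inter_iff, Set.mem_preimage, Set.mem_compl_iff, Set.mem_empty_iff_false,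
      iff_false, not_and, not_not]
    exact fun hy => e.map_target hy
  rw [this, Measure.restrict_empty, lintegral_zero_measure]

lemma chartMeasure_le_vol (he : e ∈ charts M) : chartMeasure g e ≤ vol g :=
  le_iSup₂ (f := fun e (_ : e ∈ charts M) => chartMeasure g e) e he

/-- In the domain of a chart, the Riemannian volume is the measure of the chart. -/
theorem vol_restrict (he : e ∈ charts M) : (vol g).restrict e.source = chartMeasure g e := by
  have hms := e.open_source.measurableSet
  have hres : (chartMeasure g e).restrict e.source = chartMeasure g e := by
    rw [Measure.restrict_eq_self_of_ae_mem]
    exact chartMeasure_compl_source g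
  refine le_antisymm ?_ ?_
  -- It suffices to dominate each chart measure: inside `e.source` it agrees with that of `e` on the
  -- overlap, and outside it is bounded by `vol g`. Restricting the bound to `e.source` kills the
  -- second term.
  · have : vol g ≤ chartMeasure g e + (vol g).restrict e.sourceᶜ := by
      refine iSup₂_le fun e' he' => ?_
      have hle : (chartMeasure g e').restrict e.source ≤ chartMeasure g e := by
        refine Measure.le_iff.2 fun A hA => ?_
        rw [Measure.restrict_apply hA]
        have h0 : chartMeasure g e' (A ∩ e.source) = chartMeasure g e' (A ∩ e.source ∩ e'.source) := by
          exact (measure_inter_conull (chartMeasure_compl_source g)).symm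
        rw [h0, ← chartMeasure_eq_on g he he'
          ((hA.inter hms).inter e'.open_source.measurableSet)
          (fun x hx => hx.1.2) (fun x hx => hx.2)]
        exact measure_mono fun x hx => hx.1.1
      rw [← Measure.restrict_add_restrict_compl (μ := chartMeasure g e') hms]
      exact add_le_add hle (Measure.restrict_mono subset_rfl (chartMeasure_le_vol g he'))
    refine (Measure.restrict_mono (s := e.source) subset_rfl this).trans ?_
    rw [Measure.restrict_add, Measure.restrict_restrict hms, Set.inter_compl_self,
      Measure.restrict_empty, add_zero, hres]
  · rw [← hres]
    exact Measure.restrict_mono subset_rfl (chartMeasure_le_vol g he)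

/-- The integral of a function supported in the domain of a chart. -/
theorem integral_vol_chart (he : e ∈ charts M) {f : M → ℝ} (hf : Continuous f)
    (hs : ∀ x ∉ e.source, f x = 0) :
    ∫ x, f x ∂(vol g) = ∫ y in e.target, volDensity g e y * f (e.symm y) := by
  rw [← setIntegral_eq_integral_of_forall_compl_eq_zero hs, vol_restrict g he]
  unfold chartMeasure
  rw [integral_map (aemeasurable_symm e _) hf.aestronglyMeasurable]
  change ∫ y, _ ∂((volume.restrict e.target).withDensity
    fun y => ENNReal.ofReal (volDensity g e y)) = _
  rw [integral_withDensity_eq_integral_toReal_smul₀ (aemeasurable_volDensity g he)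
      (Filter.Eventually.of_forall fun _ => ENNReal.ofReal_lt_top)]
  refine setIntegral_congr_fun e.open_target.measurableSet fun y hy => ?_
  rw [ENNReal.toReal_ofReal (volDensity_pos g he hy).le, smul_eq_mul]

lemma chartAt_mem_charts (x : M) : chartAt (Eucl n) x ∈ charts M :=
  IsManifold.chart_mem_maximalAtlas x

instance : IsLocallyFiniteMeasure (vol g) := by
  refine ⟨fun x => ?_⟩
  set e := chartAt (Eucl n) x
  have he : e ∈ charts M := chartAt_mem_charts x
  have hx : x ∈ e.source := mem_chart_source _ x
  obtain ⟨r, hr, hball⟩ := Metric.isOpen_iff.1 e.open_target (e x) (e.map_source hx)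
  have hcl : Metric.closedBall (e x) (r / 2) ⊆ e.target :=
    (Metric.closedBall_subset_ball (by linarith)).trans hball
  obtain ⟨C, hC⟩ := (isCompact_closedBall (e x) (r / 2)).bddAbove_image
    ((continuousOn_volDensity g he).mono hcl)
  let V := e.source ∩ e ⁻¹' Metric.ball (e x) (r / 2)
  have hVo : IsOpen V := e.isOpen_inter_preimage Metric.isOpen_ball
  refine ⟨V, hVo.mem_nhds ⟨hx, Metric.mem_ball_self (by linarith)⟩, ?_⟩
  have h1 : vol g V = chartMeasure g e V := by
    rw [← vol_restrict g he, Measure.restrict_apply hVo.measurableSet]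
    congr 1
    exact (Set.inter_eq_left.2 fun x hx => hx.1).symm
  rw [h1, chartMeasure_apply g hVo.measurableSet]
  have hsub : e.target ∩ e.symm ⁻¹' V ⊆ Metric.closedBall (e x) (r / 2) := by
    rintro y ⟨hy, -, hy2⟩
    have : e (e.symm y) ∈ Metric.ball (e x) (r / 2) := hy2
    rw [e.right_inv hy] at this
    exact Metric.ball_subset_closedBall this
  refine (lintegral_mono_set hsub).trans_lt ?_
  refine (setLIntegral_mono' (g := fun _ => ENNReal.ofReal C) Metric.isClosed_closedBall.measurableSet
    fun y hy => ENNReal.ofReal_le_ofReal (hC ⟨y, hy, rfl⟩)).trans_lt ?_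
  rw [setLIntegral_const]
  exact ENNReal.mul_lt_top ENNReal.ofReal_lt_top (isCompact_closedBall _ _).measure_lt_top

instance : (vol g).IsOpenPosMeasure := by
  refine ⟨fun O hO ⟨x, hx⟩ h0 => ?_⟩
  set e := chartAt (Eucl n) x
  have he : e ∈ charts M := chartAt_mem_charts x
  have h1 : chartMeasure g e O = 0 := le_antisymm ((chartMeasure_le_vol g he O).trans_eq h0) bot_le
  rw [chartMeasure_apply g hO.measurableSet] at h1
  have hSo : IsOpen (e.target ∩ e.symm ⁻¹' O) := e.symm.isOpen_inter_preimage hO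
  have hne : (e.target ∩ e.symm ⁻¹' O).Nonempty :=
    ⟨e x, e.map_source (mem_chart_source _ x), by
      simpa [e.left_inv (mem_chart_source _ x)] using hx⟩
  have hae := (aemeasurable_volDensity g he).mono_measure
    (Measure.restrict_mono (Set.inter_subset_left (t := e.symm ⁻¹' O)) le_rfl)
  have h2 := (ae_restrict_iff' hSo.measurableSet).1 ((lintegral_eq_zero_iff' hae).1 h1)
  refine (hSo.measure_pos volume hne).ne' (measure_eq_zero_iff_ae_notMem.2 ?_)
  filter_upwards [h2] with y hy hyS
  exact (ENNReal.ofReal_pos.2 (volDensity_pos g he hyS.1)).ne' (hy hyS)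

lemma volDensity_conformal (Υ : Smooth M) (y : Eucl n) :
    volDensity (conformal g Υ) e y = Real.exp (n * Υ (e.symm y)) * volDensity g e y := by
  unfold volDensity
  rw [gram_conformal, Matrix.det_smul, Fintype.card_fin, Real.sqrt_mul (by positivity)]
  congr 1
  rw [Real.sqrt_eq_iff_eq_sq (by positivity) (by positivity), ← Real.exp_nat_mul, ← Real.exp_nat_mul]
  congr 1
  push_cast
  ring

/-- The volume of a conformally related metric. -/
theorem vol_conformal (Υ : Smooth M) :
    vol (conformal g Υ) = (vol g).withDensity fun x => ENNReal.ofReal (Real.exp (n * Υ x)) := by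
  -- Countably many chart domains cover `M`, so the two measures may be compared in a single chart.
  obtain ⟨s, hs, hs'⟩ := TopologicalSpace.countable_cover_nhds
    (fun x : M => (chartAt (Eucl n) x).open_source.mem_nhds (mem_chart_source (Eucl n) x))
  rw [← Measure.restrict_univ (μ := vol (conformal g Υ)), ← Measure.restrict_univ
    (μ := (vol g).withDensity _), ← hs', Measure.restrict_biUnion_congr hs]
  intro x _
  have hcont : Continuous fun x => ENNReal.ofReal (Real.exp (n * Υ x)) :=
    ENNReal.continuous_ofReal.comp (Real.continuous_exp.comp
      (continuous_const.mul Υ.contMDiff.continuous))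
  have he := chartAt_mem_charts x
  set e := chartAt (Eucl n) x
  rw [restrict_withDensity e.open_source.measurableSet, vol_restrict _ he, vol_restrict _ he]
  ext A hA
  rw [chartMeasure_apply _ hA, withDensity_apply _ hA, ← lintegral_indicator hA]
  unfold chartMeasure
  rw [lintegral_map' (hcont.measurable.indicator hA).aemeasurable (aemeasurable_symm e _)]
  change _ = ∫⁻ y, _ ∂((volume.restrict e.target).withDensity
    fun y => ENNReal.ofReal (volDensity g e y))
  have haem : AEMeasurable (fun y => A.indicator (fun x => ENNReal.ofReal (Real.exp (n * Υ x)))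
      (e.symm y)) (volume.restrict e.target) := ((hcont.measurable.indicator hA).comp_aemeasurable
      (e.continuousOn_symm.aemeasurable e.open_target.measurableSet))
  rw [lintegral_withDensity_eq_lintegral_mul₀ (aemeasurable_volDensity g he) haem,
    ← lintegral_indicator (measurableSet_chart_preimage hA),
    ← lintegral_indicator e.open_target.measurableSet]
  congr 1
  funext y
  by_cases hy : y ∈ e.target
  · by_cases hyA : e.symm y ∈ A
    · rw [Set.indicator_of_mem (show y ∈ e.target ∩ e.symm ⁻¹' A from ⟨hy, hyA⟩),
        Set.indicator_of_mem hy, Pi.mul_apply, Set.indicator_of_mem hyA, volDensity_conformal,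
        ENNReal.ofReal_mul (Real.exp_pos _).le, mul_comm]
    · rw [Set.indicator_of_notMem (fun h => hyA h.2), Set.indicator_of_mem hy, Pi.mul_apply,
        Set.indicator_of_notMem hyA, mul_zero]
  · rw [Set.indicator_of_notMem (fun h => hy h.1), Set.indicator_of_notMem hy]

theorem integral_vol_conformal (Υ : Smooth M) (f : M → ℝ) :
    ∫ x, f x ∂(vol (conformal g Υ)) = ∫ x, Real.exp (n * Υ x) * f x ∂(vol g) := by
  have hcont : Continuous fun x => ENNReal.ofReal (Real.exp (n * Υ x)) :=
    ENNReal.continuous_ofReal.comp (Real.continuous_exp.comp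
      (continuous_const.mul Υ.contMDiff.continuous))
  rw [vol_conformal, integral_withDensity_eq_integral_toReal_smul hcont.measurable
    (Filter.Eventually.of_forall fun _ => ENNReal.ofReal_lt_top)]
  simp only [ENNReal.toReal_ofReal (Real.exp_pos _).le, smul_eq_mul]

end Volume

/-! ### Locality -/

section Local

variable {G G' : Eucl n → Matrix (Fin n) (Fin n) ℝ} {y : Eucl n}

lemma partialD_eventuallyEq (a : Fin n) {f h : Eucl n → ℝ} (hf : f =ᶠ[nhds y] h) :
    partialD a f =ᶠ[nhds y] partialD a h := by
  filter_upwards [hf.fderiv (𝕜 := ℝ)] with z hz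
  unfold partialD
  rw [hz]

lemma christoffel_eventuallyEq (hG : G =ᶠ[nhds y] G') (c a b : Fin n) :
    christoffel G c a b =ᶠ[nhds y] christoffel G' c a b := by
  have h : ∀ a i j, partialD a (fun z => G z i j) =ᶠ[nhds y] partialD a (fun z => G' z i j) :=
    fun a i j => partialD_eventuallyEq a (hG.mono fun z hz => by simp only [hz])
  have h1 := Filter.eventually_all.2 fun d => h a d b
  have h2 := Filter.eventually_all.2 fun d => h b d a
  have h3 := Filter.eventually_all.2 fun d => h d a b
  filter_upwards [hG, h1, h2, h3] with z hz h1 h2 h3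
  simp only [christoffel, hz, h1, h2, h3]

lemma covDeriv_eventuallyEq (hG : G =ᶠ[nhds y] G') {r : ℕ} {T T' : Tensor n r}
    (hT : ∀ idx, T idx =ᶠ[nhds y] T' idx) (idx : Fin (r + 1) → Fin n) :
    covDeriv G T idx =ᶠ[nhds y] covDeriv G' T' idx := by
  have h1 := Filter.eventually_all.2 fun c => Filter.eventually_all.2 fun a =>
    Filter.eventually_all.2 fun b => christoffel_eventuallyEq hG c a b
  filter_upwards [h1, Filter.eventually_all.2 hT, partialD_eventuallyEq (idx 0) (hT (Fin.tail idx))]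
    with z h1 h2 h3
  simp only [covDeriv, h1, h2, h3]

lemma iterCovDeriv_eventuallyEq (hG : G =ᶠ[nhds y] G') {r : ℕ} {T T' : Tensor n r}
    (hT : ∀ idx, T idx =ᶠ[nhds y] T' idx) (N : ℕ) (idx : Fin (r + N) → Fin n) :
    iterCovDeriv G T N idx =ᶠ[nhds y] iterCovDeriv G' T' N idx := by
  induction N with
  | zero => exact hT idx
  | succ N ih => exact covDeriv_eventuallyEq hG ih idx

lemma riemann_eventuallyEq (hG : G =ᶠ[nhds y] G') (idx : Fin 4 → Fin n) :
    riemann G idx =ᶠ[nhds y] riemann G' idx := by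
  have h1 := Filter.eventually_all.2 fun c => Filter.eventually_all.2 fun a =>
    Filter.eventually_all.2 fun b => christoffel_eventuallyEq hG c a b
  have h2 := Filter.eventually_all.2 fun d => Filter.eventually_all.2 fun c =>
    Filter.eventually_all.2 fun a => Filter.eventually_all.2 fun b =>
      partialD_eventuallyEq d (christoffel_eventuallyEq hG c a b)
  filter_upwards [hG, h1, h2] with z hz h1 h2
  simp only [riemann, riemannUp, hz, h1, h2]

lemma Contraction.evalG_congr {ℓ : ℕ} (α : Contraction ℓ) (hG : G =ᶠ[nhds y] G')
    {u u' : Fin ℓ → Eucl n → ℝ} (hu : ∀ j, u j =ᶠ[nhds y] u' j) :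
    α.evalG G u y = α.evalG G' u' y := by
  unfold evalG
  refine Finset.sum_congr rfl fun idx _ => ?_
  rw [hG.eq_of_nhds]
  congr 1
  · congr 1
    exact Finset.prod_congr rfl fun i _ =>
      (iterCovDeriv_eventuallyEq hG (riemann_eventuallyEq hG) _ _).eq_of_nhds
  · exact Finset.prod_congr rfl fun j _ =>
      (iterCovDeriv_eventuallyEq hG (fun _ => hu j) _ _).eq_of_nhds

end Local

/-! ### Linearity of iterated covariant derivatives and their orders of vanishing -/

section Linear

variable (D : LocalData n)

lemma LocalData.contDiffAt_iter (D : LocalData n) {f : Eucl n → ℝ}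
    (hf : ∀ y ∈ D.U, ContDiffAt ℝ ∞ f y) (P : ℕ) (idx : Fin (0 + P) → Fin n) {y : Eucl n}
    (hy : y ∈ D.U) : ContDiffAt ℝ ∞ (iterCovDeriv D.G (r := 0) (fun _ => f) P idx) y :=
  contDiffAt_iterCovDeriv (D.smoothG y hy) (D.detG y hy) (fun _ => hf y hy) P idx

lemma LocalData.iter_add (D : LocalData n) {f h : Eucl n → ℝ}
    (hf : ∀ y ∈ D.U, ContDiffAt ℝ ∞ f y) (hh : ∀ y ∈ D.U, ContDiffAt ℝ ∞ h y) (P : ℕ)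
    (idx : Fin (0 + P) → Fin n) {y : Eucl n} (hy : y ∈ D.U) :
    iterCovDeriv D.G (r := 0) (fun _ z => f z + h z) P idx y
      = iterCovDeriv D.G (r := 0) (fun _ => f) P idx y
        + iterCovDeriv D.G (r := 0) (fun _ => h) P idx y := by
  induction P generalizing y with
  | zero => rfl
  | succ P ih =>
    change covDeriv _ _ _ _ = covDeriv _ _ _ _ + covDeriv _ _ _ _
    unfold covDeriv
    rw [partialD_congr_on D.isOpen hy (fun z hz => ih (Fin.tail idx) hz),
      partialD_add (smooth_diffAt (D.contDiffAt_iter hf _ _ hy))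
        (smooth_diffAt (D.contDiffAt_iter hh _ _ hy))]
    simp only [ih _ hy, mul_add, Finset.sum_add_distrib]
    ring

lemma LocalData.iter_const_mul (D : LocalData n) {f : Eucl n → ℝ}
    (c : ℝ) (P : ℕ)
    (idx : Fin (0 + P) → Fin n) {y : Eucl n} (hy : y ∈ D.U) :
    iterCovDeriv D.G (r := 0) (fun _ z => c * f z) P idx y
      = c * iterCovDeriv D.G (r := 0) (fun _ => f) P idx y := by
  induction P generalizing y with
  | zero => rfl
  | succ P ih =>
    change covDeriv _ _ _ _ = _ * covDeriv _ _ _ _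
    unfold covDeriv
    rw [partialD_congr_on D.isOpen hy (fun z hz => ih (Fin.tail idx) hz), partialD_const_mul]
    simp only [ih _ hy, mul_sub, Finset.mul_sum, mul_left_comm c]

lemma LocalData.covDeriv_pow_mul (D : LocalData n) {z : Eucl n → ℝ}
    (hz : ∀ y ∈ D.U, ContDiffAt ℝ ∞ z y) {r m : ℕ} {T h : Tensor n r}
    (hh : ∀ idx, ∀ y ∈ D.U, ContDiffAt ℝ ∞ (h idx) y)
    (he : ∀ idx, ∀ y ∈ D.U, T idx y = z y ^ (m + 1) * h idx y) (idx : Fin (r + 1) → Fin n)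
    {y : Eucl n} (hy : y ∈ D.U) :
    covDeriv D.G T idx y = z y ^ m * ((m + 1) * partialD (idx 0) z y * h (Fin.tail idx) y
      + z y * covDeriv D.G h idx y) := by
  have hpow : partialD (idx 0) (fun y => z y ^ (m + 1)) y
      = (m + 1) * z y ^ m * partialD (idx 0) z y := by
    unfold partialD
    rw [fderiv_fun_pow _ (smooth_diffAt (hz y hy))]
    simp
  unfold covDeriv
  rw [partialD_congr_on D.isOpen hy (fun w hw => he (Fin.tail idx) w hw),
    partialD_mul (smooth_diffAt ((hz y hy).pow _)) (smooth_diffAt (hh _ y hy)), hpow]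
  simp only [he _ y hy, mul_left_comm _ (z y ^ (m + 1)), ← Finset.mul_sum]
  ring

/-- A function vanishing to order `m + P` has a `P`-th covariant derivative vanishing to order `m`. -/
lemma LocalData.iter_pow_mul (D : LocalData n) {z f : Eucl n → ℝ}
    (hz : ∀ y ∈ D.U, ContDiffAt ℝ ∞ z y) (hf : ∀ y ∈ D.U, ContDiffAt ℝ ∞ f y) (P : ℕ) :
    ∀ m : ℕ, ∃ h : Tensor n (0 + P), (∀ idx, ∀ y ∈ D.U, ContDiffAt ℝ ∞ (h idx) y) ∧
      ∀ idx, ∀ y ∈ D.U, iterCovDeriv D.G (r := 0) (fun _ y => z y ^ (m + P) * f y) P idx y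
        = z y ^ m * h idx y := by
  induction P with
  | zero => exact fun m => ⟨fun _ => f, fun _ => hf, fun _ _ _ => rfl⟩
  | succ P ih =>
    intro m
    -- Each derivative costs one power of `z`.
    obtain ⟨h, hh, he⟩ := ih (m + 1)
    have hc : ∀ (idx : Fin (0 + P + 1) → Fin n), ∀ y ∈ D.U,
        ContDiffAt ℝ ∞ (covDeriv D.G h idx) y := by
      intro idx y hy
      rw [show covDeriv D.G h idx = covI D.G h (idx ∘ (finSuccEquiv (0 + P)).symm) from
        funext fun z => covDeriv_eq_covI D.G h idx z]
      exact contDiffAt_covI (D.smoothG y hy) (D.detG y hy) (fun idx => hh idx y hy) _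
    refine ⟨fun (idx : Fin (0 + P + 1) → Fin n) y => (m + 1) * partialD (idx 0) z y
      * h (Fin.tail idx) y + z y * covDeriv D.G h idx y, fun idx y hy => ?_, fun idx y hy => ?_⟩
    · exact ((contDiffAt_const.mul (contDiffAt_partialD (hz y hy))).mul (hh _ y hy)).add
        ((hz y hy).mul (hc idx y hy))
    · rw [show m + (P + 1) = m + 1 + P by ring]
      exact D.covDeriv_pow_mul hz hh he idx hy

end Linear

/-! ### Polarization -/

/-- The polarization identity for multilinear maps. -/
theorem multilinear_polarization {V : Type*} [AddCommGroup V] [Module ℝ V] {m : ℕ}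
    (f : MultilinearMap ℝ (fun _ : Fin m => V) ℝ) (C : V) (u : Fin m → V) :
    ∑ T : Finset (Fin m), (-1 : ℝ) ^ T.card * f (fun _ => C + ∑ i ∈ Tᶜ, u i)
      = ∑ σ : Equiv.Perm (Fin m), f fun i => u (σ i) := by
  classical
  let w : Option (Fin m) → V := fun o => o.elim C u
  -- Expand by choosing for each argument either `C`, encoded by `none`, or some `u j` with `j ∉ T`.
  have h1 : ∀ T : Finset (Fin m), f (fun _ => C + ∑ i ∈ Tᶜ, u i)
      = ∑ κ : Fin m → Option (Fin m), if (∀ i, ∀ j ∈ κ i, j ∉ T) then f (fun i => w (κ i)) else 0 := by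
    intro T
    have : (fun _ : Fin m => C + ∑ i ∈ Tᶜ, u i) = fun _ => ∑ o ∈ Finset.insertNone Tᶜ, w o := by
      funext _
      rw [Finset.sum_insertNone]
      rfl
    rw [this, f.map_sum_finset, ← Finset.sum_filter]
    refine Finset.sum_congr ?_ fun _ _ => rfl
    ext κ
    simp [Fintype.mem_piFinset, Finset.mem_insertNone]
  simp only [h1, Finset.mul_sum]
  rw [Finset.sum_comm]
  -- For a fixed choice `κ`, the sum runs over the subsets `T` of the set `A` of indices missed by
  -- `κ`. Its alternating sum is zero unless `A` is empty; then `κ` hits every index, so it is a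
  -- permutation and `C` does not occur.
  have h2 : ∀ κ : Fin m → Option (Fin m),
      ∑ T : Finset (Fin m), (-1 : ℝ) ^ T.card *
          (if (∀ i, ∀ j ∈ κ i, j ∉ T) then f (fun i => w (κ i)) else 0)
        = if (∀ j, ∃ i, κ i = some j) then f (fun i => w (κ i)) else 0 := by
    intro κ
    let A : Finset (Fin m) := Finset.univ.filter fun j => ∀ i, κ i ≠ some j
    have hA : ∀ T : Finset (Fin m), (∀ i, ∀ j ∈ κ i, j ∉ T) ↔ T ∈ A.powerset := by
      intro T
      simp only [A, Finset.mem_powerset, Finset.subset_iff, Finset.mem_filter, Finset.mem_univ,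
        true_and, Option.mem_def]
      exact ⟨fun h j hj i hi => h i j hi hj, fun h i j hi hj => h hj i hi⟩
    have hA' : A = ∅ ↔ ∀ j, ∃ i, κ i = some j := by
      simp [A, Finset.filter_eq_empty_iff]
    simp only [mul_ite, mul_zero, hA]
    rw [← Finset.sum_filter, Finset.filter_mem_eq_inter, Finset.univ_inter, ← Finset.sum_mul]
    have h3 := congrArg (fun t : ℤ => (t : ℝ)) (Finset.sum_powerset_neg_one_pow_card (x := A))
    push_cast at h3
    rw [h3]
    simp only [hA']
    split_ifs <;> simp
  simp only [h2]
  rw [← Finset.sum_filter]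
  symm
  refine Finset.sum_bij (fun σ _ i => some (σ i)) ?_ ?_ ?_ ?_
  · intro σ _
    simp only [Finset.mem_filter, Finset.mem_univ, true_and, Option.some.injEq]
    exact fun j => ⟨σ.symm j, σ.apply_symm_apply j⟩
  · intro σ _ τ _ h
    ext i
    have := congrFun h i
    simp only [Option.some.injEq] at this
    rw [this]
  · intro κ hκ
    simp only [Finset.mem_filter, Finset.mem_univ, true_and] at hκ
    choose τ hτ using hκ
    have hinj : Function.Injective τ := fun a b hab => by
      have := (hτ a).symm.trans ((congrArg κ hab).trans (hτ b))
      simpa using this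
    let σ := Equiv.ofBijective τ (Finite.injective_iff_bijective.1 hinj)
    refine ⟨σ.symm, Finset.mem_univ _, funext fun i => ?_⟩
    have := hτ (σ.symm i)
    rw [show τ (σ.symm i) = i from σ.apply_symm_apply i] at this
    exact this.symm
  · intro σ _
    rfl

/-! ### Complete contractions as multilinear maps -/

section Multi

variable {M : SmoothManifold n} (g : Metric M) {e : OpenPartialHomeomorph M (Eucl n)}
  (he : e ∈ charts M) {y : Eucl n} (hy : y ∈ e.target)

/-- A component of an iterated covariant derivative, as a linear form. -/
def jetL (P : ℕ) (idx : Fin (0 + P) → Fin n) : Smooth M →ₗ[ℝ] ℝ where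
  toFun u := iterCovDeriv (gram g e) (r := 0) (fun _ z => u (e.symm z)) P idx y
  map_add' u v := (localData g he 1 (fun _ => one_pos)).iter_add
    (fun _ hy => contDiffAt_comp_chart_symm he u hy)
    (fun _ hy => contDiffAt_comp_chart_symm he v hy) P idx hy
  map_smul' c _ := (localData g he 1 (fun _ => one_pos)).iter_const_mul c P idx hy

/-- A complete contraction, as a multilinear map. -/
def evalMulti {ℓ : ℕ} (α : Contraction ℓ) : MultilinearMap ℝ (fun _ : Fin ℓ => Smooth M) ℝ :=
  ∑ idx : ((Σ i : Fin α.q, Fin (4 + α.N i)) ⊕ (Σ j : Fin ℓ, Fin (0 + α.P j))) → Fin n,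
    ((∏ p : Fin α.m, (gram g e y)⁻¹ (idx (α.pairing (p, 0))) (idx (α.pairing (p, 1))))
      * (∏ i : Fin α.q,
          iterCovDeriv (gram g e) (riemann (gram g e)) (α.N i) (fun s => idx (Sum.inl ⟨i, s⟩)) y)) •
      (MultilinearMap.mkPiAlgebra ℝ (Fin ℓ) ℝ).compLinearMap
        fun j => jetL g he hy (α.P j) fun s => idx (Sum.inr ⟨j, s⟩)

lemma evalMulti_apply {ℓ : ℕ} (α : Contraction ℓ) (u : Fin ℓ → Smooth M) :
    evalMulti g he hy α u = α.evalG (gram g e) (fun j z => u j (e.symm z)) y := by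
  unfold evalMulti
  rw [sum_apply]
  rfl

end Multi

lemma isNatural_of_fintype {ℓ : ℕ} {D : PolyOp n ℓ} {κ : Type} [Fintype κ] (c : κ → ℝ)
    (α : κ → Contraction ℓ)
    (h : ∀ (M : SmoothManifold n) (g : Metric M) (u : Fin ℓ → Smooth M),
      ∀ e ∈ charts M, ∀ x ∈ e.source, D M g u x = ∑ s, c s * (α s).eval g u e (e x)) :
    IsNatural D := by
  let f := (Fintype.equivFin κ).symm
  refine ⟨Fintype.card κ, fun s => c (f s), fun s => α (f s), fun M g u e he x hx => ?_⟩
  rw [h M g u e he x hx, ← f.sum_comp]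

/-- A positive function dominating the sums of the `u_i`. -/
def majorant {M : SmoothManifold n} {m : ℕ} (u : Fin m → Smooth M) : Smooth M :=
  1 + ∑ i, (1 + u i * u i)

/-- Both `1 + u²` and `1 + u² + u` are positive. Polarization based at the majorant thus uses only
positive functions, the ones for which `v^{2μ} g` is a metric. -/
lemma majorant_add_pos {M : SmoothManifold n} {m : ℕ} (u : Fin m → Smooth M) (S : Finset (Fin m))
    (x : M) : 0 < (majorant u + ∑ i ∈ S, u i) x := by
  have hsum : ∀ (S : Finset (Fin m)) (f : Fin m → Smooth M), (∑ i ∈ S, f i) x = ∑ i ∈ S, f i x :=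
    fun S f => map_sum (ContMDiffMap.evalRingHom x) f S
  have h1 : (majorant u + ∑ i ∈ S, u i) x = 1 + ∑ i, (1 + u i x * u i x) + ∑ i ∈ S, u i x := by
    rw [← hsum, show ∑ i, (1 + u i x * u i x) = ∑ i, (1 + u i * u i : Smooth M) x from rfl, ← hsum]
    rfl
  have h2 : 0 ≤ ∑ i, (1 + u i x * u i x) + ∑ i ∈ S, u i x := by
    have : ∑ i ∈ S, u i x = ∑ i, if i ∈ S then u i x else 0 := by simp
    rw [this, ← Finset.sum_add_distrib]
    refine Finset.sum_nonneg fun i _ => ?_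
    split_ifs <;> nlinarith [sq_nonneg (u i x + 1), sq_nonneg (u i x)]
  rw [h1]
  linarith

/-- A linear combination of complete contractions whose value on the diagonal is well defined
defines a symmetric polydifferential operator. -/
theorem exists_polyOp {ℓ : ℕ} {κ : Type} [Fintype κ] (c : κ → ℝ) (α : κ → Contraction ℓ)
    (H : ∀ M : SmoothManifold n, Metric M → ∀ v : Smooth M, (∀ x, 0 < v x) → Smooth M)
    (hH : ∀ M g v hv, ∀ e ∈ charts M, ∀ x ∈ e.source,
      H M g v hv x = ∑ s, c s * (α s).evalG (gram g e) (fun _ z => v (e.symm z)) (e x)) :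
    ∃ D : PolyOp n ℓ, IsNatural D ∧ (∀ M g v hv, D M g (fun _ => v) = H M g v hv) ∧
      ∀ M g u (σ : Equiv.Perm (Fin ℓ)), D M g (fun i => u (σ i)) = D M g u := by
  classical
  let S : ∀ (M : SmoothManifold n) (g : Metric M) (e : OpenPartialHomeomorph M (Eucl n))
    (_ : e ∈ charts M) (y : Eucl n) (_ : y ∈ e.target),
      MultilinearMap ℝ (fun _ : Fin ℓ => Smooth M) ℝ := fun M g e he y hy =>
    ∑ s, c s • evalMulti g he hy (α s)
  -- The polarization of `H` is globally defined and smooth because `H` is. In every chart it is the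
  -- symmetrization of the given combination of contractions, which shows that it is multilinear and
  -- natural.
  let X : ∀ (M : SmoothManifold n), Metric M → (Fin ℓ → Smooth M) → Smooth M := fun M g u =>
    ((ℓ.factorial : ℝ)⁻¹) • ∑ T : Finset (Fin ℓ), ((-1 : ℝ) ^ T.card) •
      H M g (majorant u + ∑ i ∈ Tᶜ, u i) (majorant_add_pos u Tᶜ)
  have hX : ∀ M g u e (he : e ∈ charts M) x (hx : x ∈ e.source),
      X M g u x = (ℓ.factorial : ℝ)⁻¹ *
        ∑ σ : Equiv.Perm (Fin ℓ), S M g e he (e x) (e.map_source hx) fun i => u (σ i) := by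
    intro M g u e he x hx
    rw [← multilinear_polarization _ (majorant u)]
    have hsum : ∀ (f : Finset (Fin ℓ) → Smooth M), (∑ T, f T) x = ∑ T, f T x :=
      fun f => map_sum (ContMDiffMap.evalRingHom x) f _
    change (ℓ.factorial : ℝ)⁻¹ * (∑ T : Finset (Fin ℓ), ((-1 : ℝ) ^ T.card) •
      H M g (majorant u + ∑ i ∈ Tᶜ, u i) (majorant_add_pos u Tᶜ)) x = _
    rw [hsum]
    congr 1
    refine Finset.sum_congr rfl fun T _ => ?_
    change (-1 : ℝ) ^ T.card * H M g _ _ x = _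
    rw [hH M g _ _ e he x hx]
    simp only [S, sum_apply, smul_apply, evalMulti_apply, smul_eq_mul]
  let SS : ∀ (M : SmoothManifold n) (g : Metric M) (e : OpenPartialHomeomorph M (Eucl n))
    (_ : e ∈ charts M) (y : Eucl n) (_ : y ∈ e.target),
      MultilinearMap ℝ (fun _ : Fin ℓ => Smooth M) ℝ := fun M g e he y hy =>
    (ℓ.factorial : ℝ)⁻¹ • ∑ σ : Equiv.Perm (Fin ℓ), (S M g e he y hy).domDomCongr σ
  have hXS : ∀ M g u e (he : e ∈ charts M) x (hx : x ∈ e.source),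
      X M g u x = SS M g e he (e x) (e.map_source hx) u := by
    intro M g u e he x hx
    rw [hX M g u e he x hx]
    simp only [SS, smul_apply, sum_apply,
      MultilinearMap.domDomCongr_apply, smul_eq_mul]
  let D : PolyOp n ℓ := fun M g =>
    { toFun := X M g
      map_update_add' := fun u i a b => by
        ext x
        have hx := mem_chart_source (Eucl n) x
        change X M g _ x = X M g _ x + X M g _ x
        simp only [hXS M g _ _ (chartAt_mem_charts x) x hx]
        exact MultilinearMap.map_update_add _ _ _ _ _
      map_update_smul' := fun u i a b => by
        ext x
        have hx := mem_chart_source (Eucl n) x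
        change X M g _ x = a * X M g _ x
        simp only [hXS M g _ _ (chartAt_mem_charts x) x hx]
        exact MultilinearMap.map_update_smul _ _ _ _ _ }
  refine ⟨D, ?_, fun M g v hv => ?_, fun M g u σ => ?_⟩
  · choose β hβ using fun (p : κ × Equiv.Perm (Fin ℓ)) => (α p.1).exists_perm (n := n) p.2
    refine isNatural_of_fintype (κ := κ × Equiv.Perm (Fin ℓ))
      (fun p => (ℓ.factorial : ℝ)⁻¹ * c p.1) β fun M g u e he x hx => ?_
    change X M g u x = _
    rw [hX M g u e he x hx, Fintype.sum_prod_type_right, Finset.mul_sum]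
    refine Finset.sum_congr rfl fun σ _ => ?_
    simp only [S, sum_apply, smul_apply, evalMulti_apply, smul_eq_mul,
      Finset.mul_sum, Contraction.eval_eq_evalG, hβ, mul_assoc]
  · ext x
    have hx := mem_chart_source (Eucl n) x
    change X M g _ x = _
    rw [hX M g _ _ (chartAt_mem_charts x) x hx, hH M g v hv _ (chartAt_mem_charts x) x hx]
    simp only [S, sum_apply, smul_apply, evalMulti_apply, smul_eq_mul,
      Finset.sum_const, Finset.card_univ, Fintype.card_perm, Fintype.card_fin, nsmul_eq_mul]
    rw [inv_mul_cancel_left₀ (by positivity)]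
  · ext x
    have hx := mem_chart_source (Eucl n) x
    change X M g _ x = X M g _ x
    rw [hX M g _ _ (chartAt_mem_charts x) x hx, hX M g u _ (chartAt_mem_charts x) x hx]
    congr 1
    exact Equiv.sum_comp (Equiv.mulLeft σ) fun τ : Equiv.Perm (Fin ℓ) => S M g _ (chartAt_mem_charts x) _
      (OpenPartialHomeomorph.map_source _ hx) fun i => u (τ i)

/-! ### The conformal expansion of a homogeneous invariant -/

lemma LocalData.evalG_const_mul (D : LocalData n) {p : ℕ} (β : Contraction p) (c : ℝ)
    (f : Eucl n → ℝ) {y : Eucl n} (hy : y ∈ D.U) :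
    β.evalG D.G (fun _ z => c * f z) y = c ^ p * β.evalG D.G (fun _ => f) y := by
  unfold Contraction.evalG
  simp only [D.iter_const_mul c _ _ hy, Finset.prod_mul_distrib, Finset.prod_const, Finset.card_univ,
    Fintype.card_fin, Finset.mul_sum]
  exact Finset.sum_congr rfl fun idx _ => by ring

/-- The conformal expansion with `μ = 1` and the constant function `t`: the factor `t^{-p}` cancels
the degree `p` of each term, and comparison with `t = 1` identifies the remaining sum. -/
lemma evalG_homothety {M : SmoothManifold n} (g : Metric M) {e : OpenPartialHomeomorph M (Eucl n)}
    (he : e ∈ charts M) (α : Contraction 0) (u : Fin 0 → Eucl n → ℝ) {y : Eucl n}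
    (hy : y ∈ e.target) {t : ℝ} (ht : 0 < t) :
    α.evalG (gram (homothety g t ht) e) u y = t⁻¹ ^ α.order * α.evalG (gram g e) u y := by
  obtain ⟨K, c, p, β, -, -, h⟩ := α.conformal_expansion (n := n) 1
  have key : ∀ t : ℝ, 0 < t → ∀ ht : 0 < t, α.evalG (gram (homothety g t ht) e) u y
      = t⁻¹ ^ α.order * ∑ s, c s * (β s).evalG (gram g e) (fun _ _ => 1) y := by
    intro t _ ht
    let D := localData g he (ContMDiffMap.const t) (fun _ => ht)
    have h1 : gram (homothety g t ht) e = D.conf 1 := by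
      funext z
      change t ^ 2 • gram g e z = (t ^ (2 * (1 : ℝ))) • gram g e z
      norm_num
    rw [h1, h D u y hy]
    congr 1
    · change t ^ (-(1 * (α.order : ℝ))) = _
      rw [one_mul, Real.rpow_neg ht.le, Real.rpow_natCast, inv_pow]
    · refine Finset.sum_congr rfl fun s _ => ?_
      have := D.evalG_const_mul (β s) t (fun _ => 1) hy
      simp only [mul_one] at this
      change c s * (t⁻¹ ^ p s * (β s).evalG D.G (fun _ _ => t) y) = _
      rw [this, ← mul_assoc (t⁻¹ ^ _), ← mul_pow, inv_mul_cancel₀ ht.ne', one_pow, one_mul]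
      rfl
  rw [key t ht ht]
  congr 1
  rw [← one_mul (∑ s, _)]
  have h1 := key 1 one_pos one_pos
  have h2 : gram (homothety g 1 one_pos) e = gram g e := by
    funext z
    change (1 : ℝ) ^ 2 • gram g e z = _
    simp
  rw [h2] at h1
  rw [h1]
  simp

/-- A homogeneous invariant is a combination of complete contractions of the same order. -/
lemma exists_homogeneous {I : PolyOp n 0} {k : ℕ} (hI : IsNatural I)
    (hh : HasHomogeneity I (-(2 * (k : ℝ)))) :
    ∃ (κ : Type) (_ : Fintype κ) (c : κ → ℝ) (α : κ → Contraction 0),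
      (∀ s, (α s).order = 2 * k) ∧ ∀ (M : SmoothManifold n) (g : Metric M),
        ∀ e ∈ charts M, ∀ x ∈ e.source,
          value I g x = ∑ s, c s * (α s).evalG (gram g e) (fun j => j.elim0) (e x) := by
  classical
  obtain ⟨K, c, α, h⟩ := hI
  refine ⟨{s : Fin K // (α s).order = 2 * k}, inferInstance, fun s => c s.1, fun s => α s.1,
    fun s => s.2, fun M g e he x hx => ?_⟩
  have hval : ∀ g : Metric M, value I g x
      = ∑ s, c s * (α s).evalG (gram g e) (fun j => j.elim0) (e x) := by
    intro g
    unfold value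
    rw [h M g _ e he x hx]
    refine Finset.sum_congr rfl fun s _ => ?_
    rw [Contraction.eval_eq_evalG]
    congr 2
    funext j
    exact j.elim0
  let E : Fin K → ℝ := fun s => (α s).evalG (gram g e) (fun j => j.elim0) (e x)
  -- For the metric `t^{-2} g`, a contraction of order `d` scales by `t^d` and `I` by `t^{2k}`; only
  -- the coefficient of `t^{2k}` survives.
  let p : Polynomial ℝ := ∑ s, Polynomial.C (c s * E s) * Polynomial.X ^ (α s).order
  let q : Polynomial ℝ := Polynomial.C (value I g x) * Polynomial.X ^ (2 * k)
  have hpq : p = q := by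
    refine Polynomial.eq_of_infinite_eval_eq p q ((Set.Ioi_infinite (0 : ℝ)).mono fun t ht => ?_)
    have ht : 0 < t := ht
    have h1 : value I (homothety g t⁻¹ (inv_pos.2 ht)) x = t ^ (2 * k) * value I g x := by
      have := congrArg (fun f => f (fun i => i.elim0) x) (hh M g t⁻¹ (inv_pos.2 ht))
      refine Eq.trans this ?_
      change (t⁻¹) ^ (-(2 * (k : ℝ))) * value I g x = _
      congr 1
      rw [Real.rpow_neg (inv_pos.2 ht).le, ← Real.inv_rpow (inv_pos.2 ht).le, inv_inv,
        ← Real.rpow_natCast]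
      push_cast
      rfl
    rw [hval] at h1
    simp only [evalG_homothety g he _ _ (e.map_source hx), inv_inv] at h1
    simp only [p, q, Set.mem_ofPred_eq, Polynomial.eval_finsetSum, Polynomial.eval_mul,
      Polynomial.eval_C, Polynomial.eval_pow, Polynomial.eval_X]
    rw [mul_comm (value I g x), ← h1]
    exact Finset.sum_congr rfl fun s _ => by ring
  have hc := congrArg (fun r => Polynomial.coeff r (2 * k)) hpq
  simp only [p, q, Polynomial.finsetSum_coeff, Polynomial.coeff_C_mul, Polynomial.coeff_X_pow,
    if_true, mul_one, mul_ite, mul_zero] at hc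
  rw [← hc, ← Finset.sum_filter]
  have := Finset.sum_subtype_eq_sum_filter (s := Finset.univ) (p := fun s => (α s).order = 2 * k)
    (f := fun s => c s * E s)
  simp only [eq_comm (a := 2 * k)]
  rw [← this]
  refine Finset.sum_congr ?_ fun _ _ => rfl
  ext s
  simp

/-- The logarithm of a positive smooth function. -/
def logSmooth {M : SmoothManifold n} (v : Smooth M) (hv : ∀ x, 0 < v x) : Smooth M :=
  ⟨fun x => Real.log (v x), fun x =>
    ((Real.contDiffAt_log.2 (hv x).ne').contMDiffAt (n := ∞)).comp x v.contMDiff.contMDiffAt⟩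

/-- The metric `v^{2μ} g`. -/
def powConf {M : SmoothManifold n} (g : Metric M) (μ : ℝ) (v : Smooth M) (hv : ∀ x, 0 < v x) :
    Metric M := conformal g (μ • logSmooth v hv)

lemma gram_powConf {M : SmoothManifold n} (g : Metric M) {e : OpenPartialHomeomorph M (Eucl n)}
    (he : e ∈ charts M) (μ : ℝ) (v : Smooth M) (hv : ∀ x, 0 < v x) :
    gram (powConf g μ v hv) e = (localData g he v hv).conf μ := by
  funext y
  change Real.exp (2 * (μ * Real.log (v (e.symm y)))) • gram g e y
    = (v (e.symm y) ^ (2 * μ)) • gram g e y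
  rw [Real.rpow_def_of_pos (hv _)]
  congr 2
  ring

/-- The expansion of a homogeneous invariant of the metric `v^{2μ} g`. -/
theorem exists_expansion {I : PolyOp n 0} {k : ℕ} (hI : IsNatural I)
    (hh : HasHomogeneity I (-(2 * (k : ℝ)))) (μ : ℝ) :
    ∃ (κ : Type) (_ : Fintype κ) (c : κ → ℝ) (p : κ → ℕ) (β : (s : κ) → Contraction (p s)),
      (∀ s j, 1 ≤ (β s).P j) ∧ (∀ s, (β s).order = 2 * k) ∧
      ∀ (M : SmoothManifold n) (g : Metric M) (v : Smooth M) (hv : ∀ x, 0 < v x),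
        ∀ e ∈ charts M, ∀ x ∈ e.source,
          value I (powConf g μ v hv) x = v x ^ (-(μ * (2 * k))) *
            ∑ s, c s * ((v x)⁻¹ ^ p s * (β s).evalG (gram g e) (fun _ z => v (e.symm z)) (e x)) := by
  obtain ⟨κ, _, c, α, hα, h⟩ := exists_homogeneous hI hh
  choose K c' p β hP ho hβ using fun s => (α s).conformal_expansion (n := n) μ
  refine ⟨Σ s, Fin (K s), inferInstance, fun t => c t.1 * c' t.1 t.2, fun t => p t.1 t.2,
    fun t => β t.1 t.2, fun t => hP t.1 t.2, fun t => by rw [ho, hα],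
    fun M g v hv e he x hx => ?_⟩
  rw [h M _ e he x hx, gram_powConf g he, Fintype.sum_sigma, Finset.mul_sum]
  refine Finset.sum_congr rfl fun s _ => ?_
  rw [hβ s (localData g he v hv) _ _ (e.map_source hx), hα]
  have hvx : (localData g he v hv).v (e x) = v x := congrArg v (e.left_inv hx)
  rw [hvx, mul_left_comm]
  push_cast
  congr 1
  rw [Finset.mul_sum]
  exact Finset.sum_congr rfl fun t _ => by
    rw [mul_assoc]
    rfl

/-- The square norm of the gradient, for the metric with components `G`. -/
def gradSq (G : Eucl n → Matrix (Fin n) (Fin n) ℝ) (v : Eucl n → ℝ) (y : Eucl n) : ℝ :=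
  ∑ i : Fin 2 → Fin n, (G y)⁻¹ (i 0) (i 1) * (partialD (i 0) v y * partialD (i 1) v y)

lemma iterCovDeriv_one (G : Eucl n → Matrix (Fin n) (Fin n) ℝ) (v : Eucl n → ℝ) (y : Eucl n)
    {P : ℕ} (hP : P = 1) (idx : Fin (0 + P) → Fin n) :
    iterCovDeriv G (r := 0) (fun _ => v) P idx y = partialD (idx ⟨0, by omega⟩) v y := by
  subst hP
  change covDeriv G (fun _ => v) idx y = _
  simp [covDeriv]

lemma pairSum_prod (H : Matrix (Fin n) (Fin n) ℝ) (m : ℕ) (F : Fin n → ℝ) :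
    (pairSum H fun κ : Fin m × Fin 2 → Fin n => ∏ q, F (κ q))
      = (∑ i : Fin 2 → Fin n, H (i 0) (i 1) * (F (i 0) * F (i 1))) ^ m := by
  rw [Fintype.sum_pow, pairSum_eq]
  refine Fintype.sum_equiv (Equiv.curry _ _ _) _ _ fun κ => ?_
  rw [pairWeight, Fintype.prod_prod_type, ← Finset.prod_mul_distrib]
  refine Finset.prod_congr rfl fun a _ => ?_
  rw [Fin.prod_univ_two]
  rfl

/-- Complete contractions with as many functions as derivatives. -/
lemma Contraction.evalG_top {p : ℕ} (β : Contraction p) (hP : ∀ j, 1 ≤ β.P j) {k : ℕ}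
    (hp : p = 2 * k) (ho : β.order = 2 * k) (G : Eucl n → Matrix (Fin n) (Fin n) ℝ)
    (v : Eucl n → ℝ) (y : Eucl n) : β.evalG G (fun _ => v) y = gradSq G v y ^ k := by
  -- The `2k` factors `v`, each differentiated at least once, use up the whole order: there is no
  -- curvature, and every factor is a first derivative.
  have hsum : p ≤ ∑ j, β.P j := by
    have := Finset.sum_le_sum (s := Finset.univ) fun j _ => hP j
    simpa using this
  have ho' := ho
  unfold order at ho'
  have hN : ∑ i, (β.N i + 2) = 0 := by omega
  have hq : β.q = 0 := by
    simp only [Finset.sum_add_distrib, Finset.sum_const, Finset.card_univ, Fintype.card_fin,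
      smul_eq_mul] at hN
    omega
  have hq' : IsEmpty (Fin β.q) := by rw [hq]; infer_instance
  have hP1 : ∀ j, β.P j = 1 := by
    have h1 : ∑ _j : Fin p, 1 = ∑ j, β.P j := by
      have : ∑ j : Fin p, 1 = p := by simp
      omega
    exact fun j => ((Finset.sum_eq_sum_iff_of_le fun j _ => hP j).1 h1 j (Finset.mem_univ j)).symm
  have hm : β.m = k := by
    have := β.two_mul_m
    omega
  rw [β.evalG_eq_contrSum]
  unfold contrSum gradSq
  rw [← hm, ← pairSum_prod _ _ fun i => partialD i v y]
  congr 1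
  funext κ
  rw [Fintype.prod_empty, one_mul]
  let φ : Fin p → Fin β.m × Fin 2 := fun j =>
    β.pairing.symm (Sum.inr ⟨j, ⟨0, by rw [hP1]; omega⟩⟩)
  have hφ : Function.Bijective φ := by
    refine (Fintype.bijective_iff_injective_and_card φ).2 ⟨fun i j hij => ?_, ?_⟩
    · have := β.pairing.symm.injective hij
      simp only [Sum.inr.injEq, Sigma.mk.injEq] at this
      exact this.1
    · simp only [Fintype.card_fin, Fintype.card_prod]
      omega
  refine Fintype.prod_bijective φ hφ _ _ fun j => ?_
  rw [iterCovDeriv_one G v y (hP1 j)]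

/-! ### Jets of natural operators -/

lemma eventuallyEq_chart {M : SmoothManifold n} {e : OpenPartialHomeomorph M (Eucl n)} {x : M}
    (hx : x ∈ e.source) {u u' : M → ℝ} (h : u =ᶠ[nhds x] u') :
    (fun z => u (e.symm z)) =ᶠ[nhds (e x)] fun z => u' (e.symm z) := by
  have ht : Filter.Tendsto e.symm (nhds (e x)) (nhds x) := by
    have := e.symm.continuousAt (x := e x) (e.map_source hx)
    rwa [ContinuousAt, e.left_inv hx] at this
  exact ht.eventually h

/-- A natural operator is determined by the coordinate expressions of its arguments. -/
lemma IsNatural.transplant {ℓ : ℕ} {D : PolyOp n ℓ} (hD : IsNatural D) {M M' : SmoothManifold n}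
    {g : Metric M} {g' : Metric M'} {u : Fin ℓ → Smooth M} {u' : Fin ℓ → Smooth M'}
    {e : OpenPartialHomeomorph M (Eucl n)} {e' : OpenPartialHomeomorph M' (Eucl n)}
    (he : e ∈ charts M) (he' : e' ∈ charts M') {x : M} {x' : M'} (hx : x ∈ e.source)
    (hx' : x' ∈ e'.source) (hxx : e x = e' x') (hg : gram g e =ᶠ[nhds (e x)] gram g' e')
    (hu : ∀ j, (fun z => u j (e.symm z)) =ᶠ[nhds (e x)] fun z => u' j (e'.symm z)) :
    D M g u x = D M' g' u' x' := by
  obtain ⟨K, c, α, h⟩ := hD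
  rw [h M g u e he x hx, h M' g' u' e' he' x' hx', ← hxx]
  exact Finset.sum_congr rfl fun s _ => by
    rw [Contraction.eval_eq_evalG, Contraction.eval_eq_evalG, (α s).evalG_congr hg hu]

/-- Natural operators are local. -/
lemma IsNatural.local {ℓ : ℕ} {D : PolyOp n ℓ} (hD : IsNatural D) {M : SmoothManifold n}
    (g : Metric M) {u u' : Fin ℓ → Smooth M} {x : M} (h : ∀ j, u j =ᶠ[nhds x] u' j) :
    D M g u x = D M g u' x :=
  hD.transplant (chartAt_mem_charts x) (chartAt_mem_charts x) (mem_chart_source _ x)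
    (mem_chart_source _ x) rfl Filter.EventuallyEq.rfl
    fun j => eventuallyEq_chart (mem_chart_source _ x) (h j)

/-- The evaluation at a point. -/
def evalL {M : SmoothManifold n} (x : M) : Smooth M →ₗ[ℝ] ℝ where
  toFun f := f x
  map_add' _ _ := rfl
  map_smul' _ _ := rfl

/-- The span of the functions divisible by the `N`-th power of a function vanishing at `x`. -/
def jetNull {M : SmoothManifold n} (N : ℕ) (x : M) : Submodule ℝ (Smooth M) :=
  Submodule.span ℝ {w | ∃ z f : Smooth M, z x = 0 ∧ w = z ^ N * f}

lemma jetNull_mul {M : SmoothManifold n} {N : ℕ} {x : M} {w : Smooth M} (hw : w ∈ jetNull N x)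
    (h : Smooth M) : w * h ∈ jetNull N x := by
  have : jetNull N x ≤ (jetNull N x).comap (LinearMap.mulRight ℝ h) := by
    refine Submodule.span_le.2 ?_
    rintro _ ⟨z, f, hz, rfl⟩
    exact Submodule.subset_span ⟨z, f * h, hz, mul_assoc _ _ _⟩
  exact this hw

/-- `N` exceeds all numbers of derivatives in a presentation of `D`, so an argument divisible by
`z^N` with `z x = 0` contributes nothing at `x`. This permits replacing exponentials by Taylor
polynomials, after which dependence on parameters is a finite-dimensional matter. The bound `2 ≤ N`
keeps the linear term. -/
lemma IsNatural.exists_jet_order {ℓ : ℕ} {D : PolyOp n ℓ} (hD : IsNatural D) :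
    ∃ N : ℕ, 2 ≤ N ∧ ∀ (M : SmoothManifold n) (g : Metric M) (x : M) (u u' : Fin ℓ → Smooth M),
      (∀ j, u j - u' j ∈ jetNull N x) → D M g u x = D M g u' x := by
  classical
  obtain ⟨K, c, α, h⟩ := hD
  let N : ℕ := 2 + ∑ s, ∑ j, (α s).P j
  have hN : ∀ s j, (α s).P j < N := fun s j => by
    have h1 := Finset.single_le_sum (fun j _ => Nat.zero_le ((α s).P j)) (Finset.mem_univ j)
    have h2 := Finset.single_le_sum (fun s _ => Nat.zero_le (∑ j, (α s).P j)) (Finset.mem_univ s)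
    simp only [N]
    omega
  have key : ∀ (M : SmoothManifold n) (g : Metric M) (x : M) (u : Fin ℓ → Smooth M) (i : Fin ℓ)
      (w : Smooth M), w ∈ jetNull N x → D M g (Function.update u i w) x = 0 := by
    intro M g x u i w hw
    have hle : jetNull N x ≤ LinearMap.ker ((evalL x).comp ((D M g).toLinearMap u i)) := by
      refine Submodule.span_le.2 ?_
      rintro _ ⟨z, f, hz, rfl⟩
      change D M g (Function.update u i (z ^ N * f)) x = 0
      have he := chartAt_mem_charts x
      have hx := mem_chart_source (Eucl n) x
      set e := chartAt (Eucl n) x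
      rw [h M g _ e he x hx]
      refine Finset.sum_eq_zero fun s _ => ?_
      refine mul_eq_zero_of_right _ (Finset.sum_eq_zero fun idx _ => mul_eq_zero_of_right _ ?_)
      refine Finset.prod_eq_zero (Finset.mem_univ i) ?_
      obtain ⟨r, hr⟩ := Nat.exists_eq_add_of_lt (hN s i)
      obtain ⟨F, -, hF⟩ := (localData g he 1 (fun _ => one_pos)).iter_pow_mul
        (fun y hy => contDiffAt_comp_chart_symm he z hy)
        (fun y hy => contDiffAt_comp_chart_symm he f hy) ((α s).P i) (r + 1)
      have h1 := hF (fun t => idx (Sum.inr ⟨i, t⟩)) (e x) (e.map_source hx)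
      have h2 : (fun y => (Function.update u i (z ^ N * f) i) (e.symm y))
          = fun y => z (e.symm y) ^ (r + 1 + (α s).P i) * f (e.symm y) := by
        funext y
        rw [Function.update_self, show r + 1 + (α s).P i = N by omega]
        rfl
      rw [h2]
      refine h1.trans ?_
      rw [e.left_inv hx, hz, zero_pow (by omega), zero_mul]
    exact hle hw
  refine ⟨N, by simp only [N]; omega, fun M g x u u' huu => ?_⟩
  have hS : ∀ S : Finset (Fin ℓ), D M g (S.piecewise u' u) x = D M g u x := by
    intro S
    induction S using Finset.induction_on with
    | empty => simp
    | insert i S hi ih =>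
      rw [Finset.piecewise_insert, ← ih]
      have h1 : S.piecewise u' u = Function.update (S.piecewise u' u) i (u' i + (u i - u' i)) := by
        rw [add_sub_cancel]
        nth_rw 1 [← Function.update_eq_self i (S.piecewise u' u)]
        rw [Finset.piecewise_eq_of_notMem _ _ _ hi]
      conv_rhs => rw [h1, (D M g).map_update_add]
      change _ = D M g _ x + D M g _ x
      rw [key M g x _ i _ (huu i), add_zero]
  rw [← hS Finset.univ, Finset.piecewise_univ]

/-! ### Jets of exponentials -/

lemma analytic_dslope {f : ℝ → ℝ} (hf : AnalyticOnNhd ℝ f Set.univ) :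
    AnalyticOnNhd ℝ (dslope f 0) Set.univ := by
  intro x _
  by_cases hx : x = 0
  · subst hx
    obtain ⟨p, hp⟩ := hf 0 trivial
    exact ⟨_, hp.has_fpower_series_dslope_fslope⟩
  · refine AnalyticAt.congr ?_ (dslope_eventuallyEq_slope_of_ne f hx).symm
    have : slope f 0 = fun y => (y - 0)⁻¹ * (f y - f 0) := by
      funext y
      simp [slope]
    rw [this]
    exact ((analyticAt_id.sub analyticAt_const).inv (by simpa using hx)).mul
      ((hf x trivial).sub analyticAt_const)

/-- The coefficients of the exponential series, as iterated slopes. -/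
def expRem (i : ℕ) : ℝ → ℝ := (fun f => dslope f 0)^[i] Real.exp

lemma analytic_expRem (i : ℕ) : AnalyticOnNhd ℝ (expRem i) Set.univ := by
  induction i with
  | zero => exact analyticOnNhd_rexp
  | succ i ih =>
    unfold expRem
    rw [Function.iterate_succ_apply']
    exact analytic_dslope ih

/-- Taylor's formula with analytic remainder, by iterating `f(r) = f(0) + r · dslope f 0 r`. -/
lemma exp_eq_sum (N : ℕ) (r : ℝ) :
    Real.exp r = ∑ i ∈ Finset.range N, expRem i 0 * r ^ i + r ^ N * expRem N r := by
  induction N with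
  | zero => simp [expRem]
  | succ N ih =>
    rw [ih, Finset.sum_range_succ]
    have h := sub_smul_dslope (expRem N) 0 r
    have h2 : dslope (expRem N) 0 = expRem (N + 1) := by
      unfold expRem
      rw [Function.iterate_succ_apply']
    rw [h2, smul_eq_mul, sub_zero] at h
    linear_combination r ^ N * (-h)

lemma expRem_zero : expRem 0 0 = 1 := by simp [expRem]

lemma expRem_one : expRem 1 0 = 1 := by
  simp [expRem]

/-- The coefficient of `ρ^a` in the expansion of `e^{sρ}` at `ρ = r`, up to the order `N`. -/
def expCoef (N a : ℕ) (s r : ℝ) : ℝ :=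
  Real.exp (s * r) * ∑ i ∈ Finset.range N, expRem i 0 * s ^ i * (i.choose a) * (-r) ^ (i - a)

lemma contDiff_expCoef (N a : ℕ) : ContDiff ℝ ∞ fun p : ℝ × ℝ => expCoef N a p.1 p.2 := by
  unfold expCoef
  refine (Real.contDiff_exp.comp (contDiff_fst.mul contDiff_snd)).mul ?_
  refine ContDiff.sum fun i _ => ?_
  exact ((contDiff_const.mul (contDiff_fst.pow _)).mul contDiff_const).mul (contDiff_snd.neg.pow _)

/-- The Taylor polynomial of `ρ ↦ e^{sρ}` about `r`, reordered by powers of `ρ`. In powers of `ρ`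
the parameters occur only in the coefficients, while the functions `φ^a` are fixed. -/
lemma sum_expCoef {A : Type*} [CommRing A] [Algebra ℝ A] (N : ℕ) (s r : ℝ) (ρ : A) :
    ∑ a : Fin N, expCoef N a s r • ρ ^ (a : ℕ)
      = Real.exp (s * r) • ∑ i ∈ Finset.range N, (expRem i 0 * s ^ i) •
        (ρ - algebraMap ℝ A r) ^ i := by
  rw [Fin.sum_univ_eq_sum_range (fun a => expCoef N a s r • ρ ^ a) N]
  simp only [expCoef, mul_smul, ← Finset.smul_sum, Finset.sum_smul]
  congr 1
  rw [Finset.sum_comm]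
  refine Finset.sum_congr rfl fun i hi => ?_
  rw [sub_eq_add_neg, add_pow]
  have hi := Finset.mem_range.1 hi
  rw [← Finset.sum_subset (Finset.range_mono (show i + 1 ≤ N by omega))]
  · simp only [Finset.smul_sum]
    refine Finset.sum_congr rfl fun a _ => ?_
    simp only [Algebra.smul_def, map_pow, map_neg, map_natCast]
    ring
  · intro a _ ha
    rw [Nat.choose_eq_zero_of_lt (by simpa using ha)]
    simp

/-- With `z = φ - φ(x)`, the remainder of `e^{sφ} = e^{sφ(x)} e^{sz}` is divisible by `z^N`. -/
lemma exp_mul_sub_mem_jetNull {M : SmoothManifold n} (N : ℕ) (s : ℝ) (φ h : Smooth M) (x : M) :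
    expSmooth s φ * h - ∑ a : Fin N, expCoef N a s (φ x) • (φ ^ (a : ℕ) * h) ∈ jetNull N x := by
  have h1 : ∑ a : Fin N, expCoef N a s (φ x) • (φ ^ (a : ℕ) * h)
      = (∑ a : Fin N, expCoef N a s (φ x) • φ ^ (a : ℕ)) * h := by
    rw [Finset.sum_mul]
    exact Finset.sum_congr rfl fun a _ => (smul_mul_assoc _ _ _).symm
  rw [h1, sum_expCoef, ← sub_mul]
  refine jetNull_mul ?_ h
  set z : Smooth M := φ - algebraMap ℝ (Smooth M) (φ x)
  have hzy : ∀ y, z y = φ y - φ x := fun y => rfl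
  have hsm : ContDiff ℝ ∞ (expRem N) := (analytic_expRem N).contDiff
  let R : Smooth M := ⟨fun y => expRem N (s * z y),
    hsm.contMDiff.comp (contMDiff_const.mul z.contMDiff)⟩
  have : expSmooth s φ - Real.exp (s * φ x) • ∑ i ∈ Finset.range N, (expRem i 0 * s ^ i) • z ^ i
      = (Real.exp (s * φ x) * s ^ N) • (z ^ N * R) := by
    ext y
    have hsum : (∑ i ∈ Finset.range N, (expRem i 0 * s ^ i) • z ^ i) y
        = ∑ i ∈ Finset.range N, expRem i 0 * (s * z y) ^ i := by
      refine (map_sum (ContMDiffMap.evalRingHom y) _ _).trans (Finset.sum_congr rfl fun i _ => ?_)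
      change (expRem i 0 * s ^ i) * z y ^ i = _
      ring
    change Real.exp (s * φ y) - Real.exp (s * φ x) * (∑ i ∈ Finset.range N, (expRem i 0 * s ^ i) • z ^ i : Smooth M) y
      = Real.exp (s * φ x) * s ^ N * (z y ^ N * expRem N (s * z y))
    rw [hsum, show s * φ y = s * φ x + s * z y by rw [hzy]; ring, Real.exp_add,
      exp_eq_sum N (s * z y)]
    ring
  rw [this]
  exact Submodule.smul_mem _ _ (Submodule.subset_span ⟨z, R, by rw [hzy, sub_self], rfl⟩)

/-! ### Differentiation along exponentials -/

lemma continuous_multilinear_pi {ℓ : ℕ} {K : Type} [Fintype K]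
    (f : MultilinearMap ℝ (fun _ : Fin ℓ => K → ℝ) ℝ) : Continuous f := by
  classical
  have h : ∀ a, f a = ∑ κ : Fin ℓ → K, (∏ j, a j (κ j)) * f fun j => Pi.single (κ j) 1 := by
    intro a
    have ha : a = fun j => ∑ k, a j k • (Pi.single k 1 : K → ℝ) := by
      funext j
      exact pi_eq_sum_univ' (a j)
    conv_lhs => rw [ha]
    rw [f.map_sum]
    exact Finset.sum_congr rfl fun κ _ => f.map_smul_univ _ _
  rw [show (f : (Fin ℓ → K → ℝ) → ℝ) = _ from funext h]
  fun_prop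

/-- The derivative of a multilinear map along curves with finitely many coefficients. -/
lemma hasDerivAt_multilinear_pi {ℓ : ℕ} {K : Type} [Fintype K]
    (f : MultilinearMap ℝ (fun _ : Fin ℓ => K → ℝ) ℝ) {a : Fin ℓ → ℝ → K → ℝ} {a' : Fin ℓ → K → ℝ}
    {t : ℝ} (ha : ∀ j, HasDerivAt (a j) (a' j) t) :
    HasDerivAt (fun s => f fun j => a j s)
      (∑ i, f (Function.update (fun j => a j t) i (a' i))) t := by
  let F : ContinuousMultilinearMap ℝ (fun _ : Fin ℓ => K → ℝ) ℝ :=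
    ⟨f, continuous_multilinear_pi f⟩
  have h := (HasFDerivAt.multilinear_comp (f := F) fun i => (ha i).hasFDerivAt).hasDerivAt
  refine HasDerivAt.congr_deriv (f := fun s => f fun j => a j s) h ?_
  rw [sum_apply]
  refine Finset.sum_congr rfl fun i _ => ?_
  change f (Function.update _ i ((1 : ℝ) • a' i)) = _
  rw [one_smul]

/-- The prefactor `e^{tr}` contributes `r` and the linear Taylor term contributes `ρ - r`. -/
lemma hasDerivAt_expCoef_sum {N : ℕ} (hN : 2 ≤ N) (r ρ : ℝ) :
    HasDerivAt (fun t => ∑ a : Fin N, expCoef N a t r * ρ ^ (a : ℕ)) ρ 0 := by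
  have h1 : (fun t => ∑ a : Fin N, expCoef N a t r * ρ ^ (a : ℕ))
      = fun t => Real.exp (t * r) * ∑ i ∈ Finset.range N, (expRem i 0 * t ^ i) * (ρ - r) ^ i := by
    funext t
    exact sum_expCoef N t r ρ
  rw [h1]
  obtain ⟨m, rfl⟩ := Nat.exists_eq_add_of_le' hN
  have h2 : HasDerivAt (fun t : ℝ => Real.exp (t * r)) r 0 := by
    have := ((hasDerivAt_id (0 : ℝ)).mul_const r).exp
    simpa using this
  have h3 : HasDerivAt (fun t : ℝ => ∑ i ∈ Finset.range (m + 2), (expRem i 0 * t ^ i) * (ρ - r) ^ i)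
      (∑ i ∈ Finset.range (m + 2), (expRem i 0 * (i * 0 ^ (i - 1))) * (ρ - r) ^ i) 0 :=
    HasDerivAt.fun_sum fun i _ => ((hasDerivAt_pow i (0 : ℝ)).const_mul _).mul_const _
  refine (h2.fun_mul h3).congr_deriv ?_
  rw [Finset.sum_range_succ', Finset.sum_range_succ', Finset.sum_range_succ', Finset.sum_range_succ',
    Finset.sum_eq_zero (fun i _ => by simp), Finset.sum_eq_zero (fun i _ => by simp)]
  simp [expRem_zero, expRem_one]

lemma differentiable_expCoef (N a : ℕ) (r : ℝ) : Differentiable ℝ fun t => expCoef N a t r := by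
  have := (contDiff_expCoef N a).comp (contDiff_id.prodMk (contDiff_const (c := r)))
  exact this.differentiable (by simp)

/-- Derivatives of natural operators along exponentials. -/
theorem IsNatural.hasDerivAt_exp {ℓ : ℕ} {D : PolyOp n ℓ} (hD : IsNatural D) {M : SmoothManifold n}
    (g : Metric M) (φ h : Fin ℓ → Smooth M) (x : M) :
    HasDerivAt (fun t => D M g (fun j => expSmooth t (φ j) * h j) x)
      (∑ i, D M g (Function.update h i (φ i * h i)) x) 0 := by
  obtain ⟨N, hN, hjet⟩ := hD.exists_jet_order
  -- Modulo `jetNull N x`, the curve in the argument `j` stays in the span of the functions `φ_j^a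
  -- h_j`, and only its coefficients move.
  let L : Fin ℓ → (Fin N → ℝ) →ₗ[ℝ] Smooth M := fun j =>
    Fintype.linearCombination ℝ fun a => φ j ^ (a : ℕ) * h j
  let f : MultilinearMap ℝ (fun _ : Fin ℓ => Fin N → ℝ) ℝ :=
    ((evalL x).compMultilinearMap (D M g)).compLinearMap L
  have hLy : ∀ j c y, L j c y = (∑ a, c a * φ j y ^ (a : ℕ)) * h j y := by
    intro j c y
    simp only [L, Fintype.linearCombination_apply]
    refine (map_sum (ContMDiffMap.evalRingHom y) _ _).trans ?_
    rw [Finset.sum_mul]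
    exact Finset.sum_congr rfl fun a _ => (mul_assoc _ _ _).symm
  let a : Fin ℓ → ℝ → Fin N → ℝ := fun j t k => expCoef N k t (φ j x)
  let a' : Fin ℓ → Fin N → ℝ := fun j k => deriv (fun t => expCoef N k t (φ j x)) 0
  have ha : ∀ j, HasDerivAt (a j) (a' j) 0 := fun j => hasDerivAt_pi.2 fun k =>
    (differentiable_expCoef N k (φ j x)).differentiableAt.hasDerivAt
  have h0 : ∀ j, L j (a j 0) = h j := by
    intro j
    ext y
    rw [hLy]
    have := sum_expCoef N 0 (φ j x) (φ j y)
    simp only [smul_eq_mul] at this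
    rw [this]
    obtain ⟨m, rfl⟩ := Nat.exists_eq_add_of_le' hN
    rw [Finset.sum_range_succ', Finset.sum_eq_zero (fun i _ => by simp)]
    simp [expRem_zero]
  have h1 : ∀ j, L j (a' j) = φ j * h j := by
    intro j
    ext y
    rw [hLy]
    change _ = φ j y * h j y
    congr 1
    have h2 : HasDerivAt (fun t => ∑ k : Fin N, expCoef N k t (φ j x) * φ j y ^ (k : ℕ))
        (∑ k, a' j k * φ j y ^ (k : ℕ)) 0 :=
      HasDerivAt.fun_sum fun k _ => (hasDerivAt_pi.1 (ha j) k).mul_const _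
    exact h2.unique (hasDerivAt_expCoef_sum hN _ _)
  have hf := hasDerivAt_multilinear_pi f ha
  have hleft : (fun t => D M g (fun j => expSmooth t (φ j) * h j) x)
      = fun t => f fun j => a j t := by
    funext t
    exact hjet M g x _ _ fun j => exp_mul_sub_mem_jetNull N t (φ j) (h j) x
  rw [hleft]
  convert hf using 1
  refine Finset.sum_congr rfl fun i _ => ?_
  change _ = D M g _ x
  congr 2
  funext j
  by_cases hji : j = i
  · subst hji
    rw [Function.update_self, Function.update_self, h1]
  · rw [Function.update_of_ne hji, Function.update_of_ne hji, h0]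

/-- A natural operator along a two-parameter family of exponentials. -/
theorem IsNatural.exists_exp_repr {ℓ : ℕ} {D : PolyOp n ℓ} (hD : IsNatural D)
    {M : SmoothManifold n} (g : Metric M) (φ ψ h : Smooth M) :
    ∃ (K : Type) (_ : Fintype K) (Ψ : K → (ℝ × ℝ) × (ℝ × ℝ) → ℝ) (C : K → Smooth M),
      (∀ k, ContDiff ℝ ∞ (Ψ k)) ∧ ∀ s t x,
        D M g (fun _ => expSmooth s φ * (expSmooth t ψ * h)) x
          = ∑ k, Ψ k ((s, t), (φ x, ψ x)) * C k x := by
  obtain ⟨N, hN, hjet⟩ := hD.exists_jet_order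
  let q : Fin N × Fin N → (ℝ × ℝ) × (ℝ × ℝ) → ℝ := fun p z =>
    expCoef N p.1 z.1.1 z.2.1 * expCoef N p.2 z.1.2 z.2.2
  let b : Fin N × Fin N → Smooth M := fun p => ψ ^ (p.2 : ℕ) * (φ ^ (p.1 : ℕ) * h)
  refine ⟨Fin ℓ → Fin N × Fin N, inferInstance, fun κ z => ∏ j, q (κ j) z,
    fun κ => D M g fun j => b (κ j), fun κ => ?_, fun s t x => ?_⟩
  · refine contDiff_prod fun j _ => ?_
    exact ((contDiff_expCoef N _).comp ((contDiff_fst.fst).prodMk (contDiff_snd.fst))).mul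
      ((contDiff_expCoef N _).comp ((contDiff_fst.snd).prodMk (contDiff_snd.snd)))
  · have hmem : expSmooth s φ * (expSmooth t ψ * h) - ∑ p, q p ((s, t), (φ x, ψ x)) • b p
        ∈ jetNull N x := by
      have h1 := exp_mul_sub_mem_jetNull N s φ (expSmooth t ψ * h) x
      have h2 := Submodule.sum_mem (jetNull N x) (t := Finset.univ) fun (a : Fin N) _ =>
        Submodule.smul_mem _ (expCoef N a s (φ x))
          (exp_mul_sub_mem_jetNull N t ψ (φ ^ (a : ℕ) * h) x)
      convert Submodule.add_mem _ h1 h2 using 1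
      simp only [smul_sub, Finset.sum_sub_distrib, Finset.smul_sum, smul_smul, Fintype.sum_prod_type,
        q, b, mul_left_comm (expSmooth t ψ)]
      abel
    rw [hjet M g x _ _ fun _ => hmem, (D M g).map_sum]
    refine (map_sum (ContMDiffMap.evalRingHom x) _ _).trans (Finset.sum_congr rfl fun κ _ => ?_)
    rw [(D M g).map_smul_univ]
    rfl

/-- Differentiation under the integral sign on a compact space. -/
lemma hasFDerivAt_integral_compact {X P : Type*} [TopologicalSpace X] [CompactSpace X]
    [SecondCountableTopology X] [MeasurableSpace X] [BorelSpace X] (μ : Measure X)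
    [IsFiniteMeasure μ] [NormedAddCommGroup P] [NormedSpace ℝ P] [FiniteDimensional ℝ P]
    {Θ : P → X → ℝ} {Θ' : P → X → P →L[ℝ] ℝ} (hΘ : ∀ p, Continuous (Θ p))
    (hΘ' : Continuous fun q : P × X => Θ' q.1 q.2)
    (h : ∀ p x, HasFDerivAt (fun p => Θ p x) (Θ' p x) p) (p : P) :
    HasFDerivAt (fun p => ∫ x, Θ p x ∂μ) (∫ x, Θ' p x ∂μ) p := by
  have : ProperSpace P := FiniteDimensional.proper ℝ P
  obtain ⟨C, hC⟩ := ((isCompact_closedBall p 1).prod (isCompact_univ (X := X))).exists_bound_of_continuousOn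
    hΘ'.continuousOn
  have hint : ∀ q, Integrable (Θ q) μ := fun q =>
    (hΘ q).integrable_of_hasCompactSupport (HasCompactSupport.of_compactSpace _)
  exact hasFDerivAt_integral_of_dominated_of_fderiv_le (bound := fun _ => C)
    (Metric.closedBall_mem_nhds p one_pos)
    (Filter.Eventually.of_forall fun q => (hint q).aestronglyMeasurable) (hint p)
    (by
      have : Continuous (Θ' p) := hΘ'.comp (Continuous.prodMk_right p)
      exact this.aestronglyMeasurable)
    (Filter.Eventually.of_forall fun x q hq => hC (q, x) ⟨hq, trivial⟩)
    (integrable_const _) (Filter.Eventually.of_forall fun x q _ => h q x)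

/-! ### Closedness -/

lemma metric_ext {M : SmoothManifold n} {g g' : Metric M}
    (h : ∀ x (v w : TangentSpace (𝓡 n) x), g.inner x v w = g'.inner x v w) : g = g' := by
  have : g.inner = g'.inner := by
    funext x
    ext v w
    exact h x v w
  cases g
  cases g'
  congr

/-- Multiplying `v` by `e^φ` is the conformal change of `v^{2μ} g` by `μφ`. Hence the variational
formula for `F` applies at every metric of a family `e^{sφ + tψ} v`. -/
lemma conformal_powConf {M : SmoothManifold n} (g : Metric M) (μ : ℝ) {v w : Smooth M}
    (hv : ∀ x, 0 < v x) (hw : ∀ x, 0 < w x) (φ : Smooth M)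
    (h : ∀ x, w x = Real.exp (φ x) * v x) :
    conformal (powConf g μ v hv) (μ • φ) = powConf g μ w hw := by
  refine metric_ext fun x a b => ?_
  change Real.exp (2 * (μ * φ x)) * (Real.exp (2 * (μ * Real.log (v x))) * g.inner x a b)
    = Real.exp (2 * (μ * Real.log (w x))) * g.inner x a b
  rw [h, Real.log_mul (Real.exp_pos _).ne' (hv x).ne', Real.log_exp, ← mul_assoc, ← Real.exp_add]
  congr 2
  ring

/-- Symmetry of the second derivative, for a function of two real variables. -/
lemma mixed_partials {f : ℝ → ℝ → ℝ} {A B : ℝ × ℝ → ℝ} {A' B' : ℝ × ℝ → ℝ × ℝ →L[ℝ] ℝ}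
    (hA : ∀ p, HasFDerivAt A (A' p) p) (hB : ∀ p, HasFDerivAt B (B' p) p)
    (h1 : ∀ s t, HasDerivAt (fun s => f s t) (A (s, t)) s)
    (h2 : ∀ s t, HasDerivAt (fun t => f s t) (B (s, t)) t) :
    A' 0 (0, 1) = B' 0 (1, 0) := by
  let f₁ : ℝ → ℝ → ℝ →L[ℝ] ℝ := fun s t => ContinuousLinearMap.toSpanSingleton ℝ (A (s, t))
  let f₂ : ℝ → ℝ → ℝ →L[ℝ] ℝ := fun s t => ContinuousLinearMap.toSpanSingleton ℝ (B (s, t))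
  have hcA : Continuous A := continuous_iff_continuousAt.2 fun p => (hA p).continuousAt
  have hcB : Continuous B := continuous_iff_continuousAt.2 fun p => (hB p).continuousAt
  let S : ℝ × ℝ → ℝ × ℝ →L[ℝ] ℝ := fun p =>
    A p • ContinuousLinearMap.fst ℝ ℝ ℝ + B p • ContinuousLinearMap.snd ℝ ℝ ℝ
  -- Continuity of the two partial derivatives makes `f` differentiable; the symmetry of its second
  -- derivative then applies at the origin.
  have hf : ∀ p : ℝ × ℝ, HasFDerivAt (fun p : ℝ × ℝ => f p.1 p.2) (S p) p := by
    intro p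
    have h := HasStrictFDerivAt.hasFDerivAt (hasStrictFDerivAt_uncurry_coprod (u := p) (f := f)
      (f₁ := f₁) (f₂ := f₂) (Filter.Eventually.of_forall fun v => (h1 v.1 v.2).hasFDerivAt)
      (Filter.Eventually.of_forall fun v => (h2 v.1 v.2).hasFDerivAt)
      ((ContinuousLinearMap.toSpanSingletonCLE.continuous.comp hcA).continuousAt)
      ((ContinuousLinearMap.toSpanSingletonCLE.continuous.comp hcB).continuousAt))
    refine HasFDerivAt.congr_fderiv h ?_
    ext <;> simp [S, f₁, f₂, Function.HasUncurry.uncurry]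
  have hS : HasFDerivAt S ((A' 0).smulRight (ContinuousLinearMap.fst ℝ ℝ ℝ)
      + (B' 0).smulRight (ContinuousLinearMap.snd ℝ ℝ ℝ)) 0 :=
    HasFDerivAt.fun_add ((hA 0).smul_const (ContinuousLinearMap.fst ℝ ℝ ℝ))
      ((hB 0).smul_const (ContinuousLinearMap.snd ℝ ℝ ℝ))
  have := second_derivative_symmetric_of_eventually (Filter.Eventually.of_forall hf) hS (0, 1) (1, 0)
  simpa using this

/-- Differentiation of the integrals of a natural operator along exponentials. -/
lemma IsNatural.exists_hasFDerivAt {ℓ : ℕ} {E : PolyOp n ℓ} (hE : IsNatural E)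
    {M : SmoothManifold n} [CompactSpace M] (g : Metric M) (χ φ ψ v : Smooth M) :
    ∃ A' : ℝ × ℝ → ℝ × ℝ →L[ℝ] ℝ,
      (∀ p : ℝ × ℝ, HasFDerivAt (fun p : ℝ × ℝ => ∫ x, χ x *
        E M g (fun _ => expSmooth p.1 φ * (expSmooth p.2 ψ * v)) x ∂(vol g)) (A' p) p) ∧
      A' 0 (1, 0) = ∫ x, χ x * ∑ i, E M g (Function.update (fun _ => v) i (φ * v)) x ∂(vol g) ∧
      A' 0 (0, 1) = ∫ x, χ x * ∑ i, E M g (Function.update (fun _ => v) i (ψ * v)) x ∂(vol g) := by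
  obtain ⟨K, _, Ψ, C, hΨ, hrep⟩ := hE.exists_exp_repr g φ ψ v
  let Θ : ℝ × ℝ → M → ℝ := fun p x => ∑ k, Ψ k (p, (φ x, ψ x)) * (χ x * C k x)
  let Θ' : ℝ × ℝ → M → ℝ × ℝ →L[ℝ] ℝ := fun p x =>
    ∑ k, (χ x * C k x) • (fderiv ℝ (Ψ k) (p, (φ x, ψ x))).comp (ContinuousLinearMap.inl ℝ _ _)
  have hc : ∀ u : Smooth M, Continuous u := fun u => u.contMDiff.continuous
  have hΘ : ∀ p, Continuous (Θ p) := fun p => continuous_finsetSum _ fun k _ =>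
    ((hΨ k).continuous.comp (continuous_const.prodMk ((hc φ).prodMk (hc ψ)))).mul
      ((hc χ).mul (hc (C k)))
  have hΘ' : Continuous fun q : (ℝ × ℝ) × M => Θ' q.1 q.2 := by
    refine continuous_finsetSum _ fun k _ => ?_
    refine (((hc χ).comp continuous_snd).mul ((hc (C k)).comp continuous_snd)).smul ?_
    refine Continuous.clm_comp ?_ continuous_const
    exact ((hΨ k).continuous_fderiv (by simp)).comp (continuous_fst.prodMk
      (((hc φ).comp continuous_snd).prodMk ((hc ψ).comp continuous_snd)))
  have hd : ∀ p x, HasFDerivAt (fun p => Θ p x) (Θ' p x) p := by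
    intro p x
    refine HasFDerivAt.fun_sum fun k _ => ?_
    refine HasFDerivAt.mul_const ?_ _
    have h1 : HasFDerivAt (Ψ k) (fderiv ℝ (Ψ k) (p, (φ x, ψ x))) (p, (φ x, ψ x)) :=
      ((hΨ k).differentiable (by simp)).differentiableAt.hasFDerivAt
    exact h1.comp p (hasFDerivAt_prodMk_left p (φ x, ψ x))
  have hrep' : ∀ p : ℝ × ℝ, ∀ x, χ x * E M g (fun _ => expSmooth p.1 φ * (expSmooth p.2 ψ * v)) x
      = Θ p x := by
    intro p x
    rw [hrep, Finset.mul_sum]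
    exact Finset.sum_congr rfl fun k _ => by ring
  have hE0 : ∀ w : Smooth M, expSmooth 0 w = 1 := fun w => by
    ext x
    change Real.exp (0 * w x) = 1
    simp
  have hint : Integrable (Θ' 0) (vol g) :=
    (hΘ'.comp (Continuous.prodMk_right (0 : ℝ × ℝ))).integrable_of_hasCompactSupport
      (HasCompactSupport.of_compactSpace _)
  refine ⟨fun p => ∫ x, Θ' p x ∂(vol g), fun p => ?_, ?_, ?_⟩
  · simp only [hrep']
    exact hasFDerivAt_integral_compact (vol g) hΘ hΘ' hd p
  · rw [ContinuousLinearMap.integral_apply hint]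
    refine integral_congr_ae (Filter.Eventually.of_forall fun x => ?_)
    have h1 := (hE.hasDerivAt_exp g (fun _ => φ) (fun _ => v) x).const_mul (χ x)
    have h2 : HasDerivAt (fun s : ℝ => Θ (s, 0) x) (Θ' 0 x (1, 0)) 0 :=
      HasFDerivAt.comp_hasDerivAt (f := fun s : ℝ => (s, (0 : ℝ))) (0 : ℝ) (hd 0 x)
        ((hasDerivAt_id (0 : ℝ)).prodMk (hasDerivAt_const (0 : ℝ) (0 : ℝ)))
    refine h2.unique (HasDerivAt.congr_of_eventuallyEq h1 (Filter.Eventually.of_forall fun s => ?_))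
    simp only [← hrep', hE0, one_mul]
  · rw [ContinuousLinearMap.integral_apply hint]
    refine integral_congr_ae (Filter.Eventually.of_forall fun x => ?_)
    have h1 := (hE.hasDerivAt_exp g (fun _ => ψ) (fun _ => v) x).const_mul (χ x)
    have h2 : HasDerivAt (fun t : ℝ => Θ (0, t) x) (Θ' 0 x (0, 1)) 0 :=
      HasFDerivAt.comp_hasDerivAt (f := fun t : ℝ => ((0 : ℝ), t)) (0 : ℝ) (hd 0 x)
        ((hasDerivAt_const (0 : ℝ) (0 : ℝ)).prodMk (hasDerivAt_id (0 : ℝ)))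
    refine h2.unique (HasDerivAt.congr_of_eventuallyEq h1 (Filter.Eventually.of_forall fun s => ?_))
    simp only [← hrep', hE0, one_mul]

/-- Conformal variations of the metric in the class of `g` give symmetric forms. -/
theorem IsCVI.symmetric {I : PolyOp n 0} {k : ℕ} (hI : IsCVI I k) {μ : ℝ}
    (hμ : ((n : ℝ) - 2 * k) * μ = 2 * k) (hμ0 : μ ≠ 0) {ℓ : ℕ} {E : PolyOp n ℓ} (hE : IsNatural E)
    (hEI : ∀ (M : SmoothManifold n) (g : Metric M) (v : Smooth M) (hv : ∀ x, 0 < v x) (x : M),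
      value I (powConf g μ v hv) x
        = v x ^ (-(μ * (2 * k))) * ((v x)⁻¹ ^ (2 * k) * E M g (fun _ => v) x))
    {M : SmoothManifold n} [hM : CompactSpace M] (g : Metric M) (φ ψ v : Smooth M)
    (hv : ∀ x, 0 < v x) :
    ∫ x, φ x * ∑ i, E M g (Function.update (fun _ => v) i (ψ * v)) x ∂(vol g)
      = ∫ x, ψ x * ∑ i, E M g (Function.update (fun _ => v) i (φ * v)) x ∂(vol g) := by
  obtain ⟨-, -, F, -, hF⟩ := hI
  -- The functional is studied on the surface of metrics `(e^{sφ + tψ} v)^{2μ} g`.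
  let u : ℝ → ℝ → Smooth M := fun s t => expSmooth s φ * (expSmooth t ψ * v)
  have hu : ∀ s t x, 0 < u s t x := fun s t x =>
    mul_pos (Real.exp_pos _) (mul_pos (Real.exp_pos _) (hv x))
  let f : ℝ → ℝ → ℝ := fun s t => F M (powConf g μ (u s t) (hu s t))
  -- The first variation becomes an integral for the fixed volume of `g`: the density `w^{nμ}`
  -- cancels `w^{-2kμ-2k}`, which is the reason for the choice of `μ`.
  have hint : ∀ (w χ : Smooth M) (hw : ∀ x, 0 < w x),
      ∫ x, (μ • χ) x * value I (powConf g μ w hw) x ∂(vol (powConf g μ w hw))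
        = μ * ∫ x, χ x * E M g (fun _ => w) x ∂(vol g) := by
    intro w χ hw
    rw [powConf, integral_vol_conformal, ← integral_const_mul]
    refine integral_congr_ae (Filter.Eventually.of_forall fun x => ?_)
    change Real.exp (n * (μ * Real.log (w x))) * ((μ * χ x) * value I (powConf g μ w hw) x) = _
    have hx := hw x
    have h1 : Real.exp (n * (μ * Real.log (w x))) * w x ^ (-(μ * (2 * k))) * (w x)⁻¹ ^ (2 * k) = 1 := by
      rw [Real.rpow_def_of_pos hx, inv_pow, ← Real.rpow_natCast (w x) (2 * k), Real.rpow_def_of_pos hx,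
        ← Real.exp_neg, ← Real.exp_add, ← Real.exp_add, Real.exp_eq_one_iff]
      push_cast
      linear_combination (Real.log (w x)) * hμ
    rw [hEI]
    linear_combination (μ * χ x * E M g (fun _ => w) x) * h1
  obtain ⟨A', hA, -, hA2⟩ := hE.exists_hasFDerivAt g φ φ ψ v
  obtain ⟨B', hB, hB1, -⟩ := hE.exists_hasFDerivAt g ψ φ ψ v
  have key := mixed_partials (f := f) (fun p => (hA p).const_mul μ) (fun p => (hB p).const_mul μ)
    (fun s t => ?_) (fun s t => ?_)
  · simp only [smul_apply, smul_eq_mul, hA2, hB1] at key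
    exact mul_left_cancel₀ hμ0 key
  -- The hypothesis gives a derivative at parameter zero; it is applied at the metric with
  -- parameters `(s, t)` and translated by `s`.
  · have h := hF M hM (powConf g μ (u s t) (hu s t)) (μ • φ)
    rw [hint, ← sub_self s] at h
    have h2 := h.comp_sub_const s s
    refine h2.congr_of_eventuallyEq (Filter.Eventually.of_forall fun s' => ?_)
    change F M _ = F M (conformal _ _)
    congr 1
    rw [smul_comm]
    refine (conformal_powConf g μ _ _ _ fun x => ?_).symm
    change Real.exp (s' * φ x) * _ = Real.exp ((s' - s) * φ x) * (Real.exp (s * φ x) * _)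
    rw [← mul_assoc, ← Real.exp_add]
    ring_nf
  · have h := hF M hM (powConf g μ (u s t) (hu s t)) (μ • ψ)
    rw [hint, ← sub_self t] at h
    have h2 := h.comp_sub_const t t
    refine h2.congr_of_eventuallyEq (Filter.Eventually.of_forall fun t' => ?_)
    change F M _ = F M (conformal _ _)
    congr 1
    rw [smul_comm]
    refine (conformal_powConf g μ _ _ _ fun x => ?_).symm
    change Real.exp (s * φ x) * (Real.exp (t' * ψ x) * v x)
      = Real.exp ((t' - t) * ψ x) * (Real.exp (s * φ x) * (Real.exp (t * ψ x) * v x))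
    have : Real.exp (t' * ψ x) = Real.exp ((t' - t) * ψ x) * Real.exp (t * ψ x) := by
      rw [← Real.exp_add]
      ring_nf
    rw [this]
    ring

/-! ### Metrics with prescribed components -/

/-- The bilinear form `B(e_* v, e_* w)` on the tangent space at `x`. -/
def pullForm {M : SmoothManifold n} (e : OpenPartialHomeomorph M (Eucl n))
    (B : Eucl n → Eucl n →L[ℝ] Eucl n →L[ℝ] ℝ) (x : M) :
    TangentSpace (𝓡 n) x →L[ℝ] TangentSpace (𝓡 n) x →L[ℝ] ℝ :=
  let A : Eucl n →L[ℝ] Eucl n := mfderiv (𝓡 n) (𝓡 n) e x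
  let S : Eucl n →L[ℝ] Eucl n →L[ℝ] ℝ :=
    ((ContinuousLinearMap.compL ℝ (Eucl n) (Eucl n) ℝ).flip A).comp ((B (e x)).comp A)
  S

set_option synthInstance.maxHeartbeats 400000 in
lemma contMDiffAt_pullForm {M : SmoothManifold n} {e : OpenPartialHomeomorph M (Eucl n)}
    (he : e ∈ charts M) {x₀ : M} (hx : x₀ ∈ e.source)
    {B : Eucl n → Eucl n →L[ℝ] Eucl n →L[ℝ] ℝ} (hB : ContDiffAt ℝ ∞ B (e x₀)) :
    ContMDiffAt (𝓡 n) ((𝓡 n).prod 𝓘(ℝ, Eucl n →L[ℝ] Eucl n →L[ℝ] ℝ)) ∞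
      (fun x => Bundle.TotalSpace.mk' (Eucl n →L[ℝ] Eucl n →L[ℝ] ℝ)
        (E := fun x : M => TangentSpace (𝓡 n) x →L[ℝ] TangentSpace (𝓡 n) x →L[ℝ] ℝ)
        x (pullForm e B x)) x₀ := by
  have h1 := (contMDiffAt_chart he hx).mfderiv_const (m := ∞) (by simp)
  set T : M → Eucl n →L[ℝ] Eucl n := inTangentCoordinates (𝓡 n) (𝓡 n) id e
    (mfderiv (𝓡 n) (𝓡 n) e) x₀ with hT
  have h2 : ContMDiffAt (𝓡 n) 𝓘(ℝ, Eucl n →L[ℝ] Eucl n →L[ℝ] ℝ) ∞ (fun x => B (e x)) x₀ :=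
    hB.contMDiffAt.comp x₀ (contMDiffAt_chart he hx)
  have h3 : ContMDiffAt (𝓡 n) 𝓘(ℝ, Eucl n →L[ℝ] Eucl n →L[ℝ] ℝ) ∞
      (fun x => ((ContinuousLinearMap.compL ℝ (Eucl n) (Eucl n) ℝ).flip (T x)).comp
        ((B (e x)).comp (T x))) x₀ := by
    refine ContMDiffAt.clm_comp ?_ (h2.clm_comp h1)
    have hc : ContDiff ℝ ∞ fun A : Eucl n →L[ℝ] Eucl n =>
        (ContinuousLinearMap.compL ℝ (Eucl n) (Eucl n) ℝ).flip A :=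
      contDiff_const.clm_apply contDiff_id
    exact hc.contMDiff.contMDiffAt.comp x₀ h1
  rw [Bundle.contMDiffAt_section]
  refine h3.congr_of_eventuallyEq ?_
  filter_upwards [(chartAt (Eucl n) x₀).open_source.mem_nhds (mem_chart_source _ x₀)] with x hxs
  ext v w
  simp [hom_trivializationAt_apply, ContinuousLinearMap.inCoordinates, pullForm, hT,
    inTangentCoordinates]
  rw [Bundle.Trivialization.coe_linearMapAt_of_mem]
  · simp [hom_trivializationAt_apply, ContinuousLinearMap.inCoordinates]
    rfl
  · exact ⟨hxs, trivial⟩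

/-- By compactness of the unit sphere, `S v v ≥ c ‖v‖²` for some `c > 0`. -/
lemma isVonNBounded_of_pos (S : Eucl n →L[ℝ] Eucl n →L[ℝ] ℝ) (hS : ∀ v, v ≠ 0 → 0 < S v v) :
    Bornology.IsVonNBounded ℝ {v : Eucl n | S v v < 1} := by
  have hc : Continuous fun v : Eucl n => S v v := S.continuous.clm_apply continuous_id
  obtain ⟨c, hc0, hcS⟩ : ∃ c > 0, ∀ v : Eucl n, c * ‖v‖ ^ 2 ≤ S v v := by
    by_cases hne : (Metric.sphere (0 : Eucl n) 1).Nonempty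
    · obtain ⟨v₀, hv₀, hmin⟩ := (isCompact_sphere (0 : Eucl n) 1).exists_isMinOn hne hc.continuousOn
      refine ⟨S v₀ v₀, hS _ (ne_zero_of_mem_unit_sphere ⟨v₀, hv₀⟩), fun v => ?_⟩
      rcases eq_or_ne v 0 with rfl | hv
      · simp
      have hn : 0 < ‖v‖ := norm_pos_iff.2 hv
      have := hmin (show ‖v‖⁻¹ • v ∈ Metric.sphere (0 : Eucl n) 1 by
        simp [norm_smul, inv_mul_cancel₀ hn.ne'])
      have this : S v₀ v₀ ≤ S (‖v‖⁻¹ • v) (‖v‖⁻¹ • v) := this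
      simp only [map_smul, smul_apply, smul_eq_mul] at this
      have h2 : S v v = ‖v‖ ^ 2 * (‖v‖⁻¹ * (‖v‖⁻¹ * S v v)) := by field_simp
      rw [h2, mul_comm]
      gcongr
    · refine ⟨1, one_pos, fun v => ?_⟩
      rcases eq_or_ne v 0 with rfl | hv
      · simp
      exact (hne ⟨‖v‖⁻¹ • v, by simp [norm_smul, inv_mul_cancel₀ (norm_pos_iff.2 hv).ne']⟩).elim
  refine (NormedSpace.isVonNBounded_ball ℝ (Eucl n) (Real.sqrt c⁻¹)).subset fun v hv => ?_
  have h1 : c * ‖v‖ ^ 2 < 1 := (hcS v).trans_lt hv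
  rw [mem_ball_zero_iff]
  refine Real.lt_sqrt_of_sq_lt ?_
  rw [← one_div, lt_div_iff₀ hc0]
  linarith

instance sigmaCompactSpace_carrier (M : SmoothManifold n) : SigmaCompactSpace M :=
  haveI : LocallyCompactSpace M := ChartedSpace.locallyCompactSpace (Eucl n) M
  inferInstance

/-- Symmetric positive definite forms, which are the pullback of `B` over `K`. -/
def formSet {M : SmoothManifold n} (e : OpenPartialHomeomorph M (Eucl n))
    (B : Eucl n → Eucl n →L[ℝ] Eucl n →L[ℝ] ℝ) (K : Set (Eucl n)) (x : M) :
    Set (TangentSpace (𝓡 n) x →L[ℝ] TangentSpace (𝓡 n) x →L[ℝ] ℝ) :=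
  {S | (∀ v w, S v w = S w v) ∧ (∀ v, v ≠ 0 → 0 < S v v) ∧
    (x ∈ e.symm '' K → ∀ v w, S v w = pullForm e B x v w)}

lemma convex_formSet {M : SmoothManifold n} (e : OpenPartialHomeomorph M (Eucl n))
    (B : Eucl n → Eucl n →L[ℝ] Eucl n →L[ℝ] ℝ) (K : Set (Eucl n)) (x : M) :
    Convex ℝ (formSet e B K x) := by
  rintro S ⟨h1, h2, h3⟩ S' ⟨h1', h2', h3'⟩ a b ha hb hab
  refine ⟨fun v w => ?_, fun v hv => ?_, fun hx v w => ?_⟩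
  · change a * S v w + b * S' v w = a * S w v + b * S' w v
    rw [h1, h1']
  · change 0 < a * S v v + b * S' v v
    have := h2 v hv
    have := h2' v hv
    rcases ha.eq_or_lt with rfl | ha
    · have : b = 1 := by linarith
      subst this
      linarith
    · positivity
  · change a * S v w + b * S' v w = _
    rw [h3 hx, h3' hx, ← add_mul, hab, one_mul]

lemma mfderiv_chart_ne_zero {M : SmoothManifold n} {e : OpenPartialHomeomorph M (Eucl n)}
    (he : e ∈ charts M) {x : M} (hx : x ∈ e.source) {v : TangentSpace (𝓡 n) x} (hv : v ≠ 0) :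
    mfderiv (𝓡 n) (𝓡 n) e x v ≠ 0 := fun h0 =>
  hv ((mdifferentiable_chart' he).mfderiv_injective hx (h0.trans (map_zero _).symm))

/-- At a point of the image of `K`, the pullback of `B` serves. Elsewhere there is a neighbourhood
missing that compact image, where the Euclidean form of any chart is admissible. -/
lemma exists_local_form (M : SmoothManifold n) {e : OpenPartialHomeomorph M (Eucl n)}
    (he : e ∈ charts M) {B : Eucl n → Eucl n →L[ℝ] Eucl n →L[ℝ] ℝ} {W K : Set (Eucl n)}
    (hW : IsOpen W) (hWe : W ⊆ e.target) (hK : IsCompact K) (hKW : K ⊆ W)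
    (hB : ContDiffOn ℝ ∞ B W) (hsymm : ∀ y ∈ W, ∀ a b, B y a b = B y b a)
    (hpos : ∀ y ∈ W, ∀ a, a ≠ 0 → 0 < B y a a) (x₀ : M) :
    ∃ U ∈ nhds x₀, ∃ s : (x : M) → TangentSpace (𝓡 n) x →L[ℝ] TangentSpace (𝓡 n) x →L[ℝ] ℝ,
      ContMDiffOn (𝓡 n) ((𝓡 n).prod 𝓘(ℝ, Eucl n →L[ℝ] Eucl n →L[ℝ] ℝ)) ∞
        (fun x => Bundle.TotalSpace.mk' (Eucl n →L[ℝ] Eucl n →L[ℝ] ℝ)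
        (E := fun x : M => TangentSpace (𝓡 n) x →L[ℝ] TangentSpace (𝓡 n) x →L[ℝ] ℝ)
        x (s x)) U ∧ ∀ y ∈ U, s y ∈ formSet e B K y := by
  by_cases hx₀ : x₀ ∈ e.symm '' K
  · obtain ⟨y₀, hy₀, rfl⟩ := hx₀
    refine ⟨e.source ∩ e ⁻¹' W, (e.isOpen_inter_preimage hW).mem_nhds
      ⟨e.map_target (hWe (hKW hy₀)), ?_⟩, pullForm e B, fun x hx => ?_, fun x hx => ⟨?_, ?_, ?_⟩⟩
    · rw [Set.mem_preimage, e.right_inv (hWe (hKW hy₀))]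
      exact hKW hy₀
    · exact (contMDiffAt_pullForm he hx.1 (hB.contDiffAt (hW.mem_nhds hx.2))).contMDiffWithinAt
    · exact fun v w => hsymm _ hx.2 _ _
    · exact fun v hv => hpos _ hx.2 _ (mfderiv_chart_ne_zero he hx.1 hv)
    · exact fun _ _ _ => rfl
  · have hcl : IsClosed (e.symm '' K) :=
      (hK.image_of_continuousOn (e.continuousOn_symm.mono (hKW.trans hWe))).isClosed
    refine ⟨(e.symm '' K)ᶜ ∩ (chartAt (Eucl n) x₀).source, Filter.inter_mem
      (hcl.isOpen_compl.mem_nhds hx₀)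
      ((chartAt (Eucl n) x₀).open_source.mem_nhds (mem_chart_source _ x₀)),
      pullForm (chartAt (Eucl n) x₀) fun _ => innerSL ℝ, fun x hx => ?_,
      fun x hx => ⟨?_, ?_, ?_⟩⟩
    · exact (contMDiffAt_pullForm (chartAt_mem_charts x₀) hx.2
        contDiffAt_const).contMDiffWithinAt
    · exact fun v w => real_inner_comm (F := Eucl n) _ _
    · exact fun v hv =>
        real_inner_self_pos (F := Eucl n).2 (mfderiv_chart_ne_zero (chartAt_mem_charts x₀) hx.2 hv)
    · exact fun h => (hx.1 h).elim

-- The admissible forms are convex at each point, so the local choices are glued into a section by a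
-- partition of unity. This extends a metric given near `K` to the whole manifold.
set_option maxHeartbeats 2000000 in
set_option synthInstance.maxHeartbeats 400000 in
theorem exists_metric (M : SmoothManifold n) {e : OpenPartialHomeomorph M (Eucl n)}
    (he : e ∈ charts M) {B : Eucl n → Eucl n →L[ℝ] Eucl n →L[ℝ] ℝ} {W K : Set (Eucl n)}
    (hW : IsOpen W) (hWe : W ⊆ e.target) (hK : IsCompact K) (hKW : K ⊆ W)
    (hB : ContDiffOn ℝ ∞ B W) (hsymm : ∀ y ∈ W, ∀ a b, B y a b = B y b a)
    (hpos : ∀ y ∈ W, ∀ a, a ≠ 0 → 0 < B y a a) :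
    ∃ g : Metric M, ∀ y ∈ K, ∀ a b : Eucl n,
      g.inner (e.symm y) (mfderiv (𝓡 n) (𝓡 n) e.symm y a) (mfderiv (𝓡 n) (𝓡 n) e.symm y b)
        = B y a b := by
  have : ∀ x : M, ContinuousAdd (TangentSpace (𝓡 n) x →L[ℝ] ℝ) := fun x =>
    inferInstanceAs (ContinuousAdd (Eucl n →L[ℝ] ℝ))
  have : ∀ x : M, IsTopologicalAddGroup (TangentSpace (𝓡 n) x →L[ℝ] ℝ) := fun x =>
    inferInstanceAs (IsTopologicalAddGroup (Eucl n →L[ℝ] ℝ))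
  have : ∀ x : M, ContinuousSMul ℝ (TangentSpace (𝓡 n) x →L[ℝ] ℝ) := fun x =>
    inferInstanceAs (ContinuousSMul ℝ (Eucl n →L[ℝ] ℝ))
  obtain ⟨s, hs⟩ := exists_contMDiffSection_forall_mem_convex_of_local (n := (⊤ : ℕ∞)) (𝓡 n)
    (F_fiber := Eucl n →L[ℝ] Eucl n →L[ℝ] ℝ)
    (fun x : M => TangentSpace (𝓡 n) x →L[ℝ] TangentSpace (𝓡 n) x →L[ℝ] ℝ) (formSet e B K)
    (convex_formSet e B K) (exists_local_form M he hW hWe hK hKW hB hsymm hpos)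
  refine ⟨⟨s, fun x => (hs x).1, fun x => (hs x).2.1, fun x => isVonNBounded_of_pos _ (hs x).2.1,
    s.contMDiff⟩, fun y hy a b => ?_⟩
  have hyt := hWe (hKW hy)
  refine ((hs (e.symm y)).2.2 ⟨y, hy, rfl⟩ _ _).trans ?_
  let A : Eucl n →L[ℝ] Eucl n := mfderiv (𝓡 n) (𝓡 n) e (e.symm y)
  let A' : Eucl n →L[ℝ] Eucl n := mfderiv (𝓡 n) (𝓡 n) e.symm y
  have hid : ∀ a : Eucl n, A (A' a) = a :=
    fun a => DFunLike.congr_fun ((mdifferentiable_chart' he).comp_symm_deriv hyt) a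
  change B (e (e.symm y)) (A (A' a)) (A (A' b)) = _
  rw [hid, hid, e.right_inv hyt]

/-! ### The sphere as a compact model for metrics in a chart -/

instance fact_finrank (n : ℕ) : Fact (Module.finrank ℝ (EuclideanSpace ℝ (Fin (n + 1))) = n + 1) :=
  ⟨finrank_euclideanSpace_fin⟩

/-- The sphere. -/
def sphereManifold (n : ℕ) : SmoothManifold n :=
  haveI : IsManifold (𝓡 n) ∞ (Metric.sphere (0 : EuclideanSpace ℝ (Fin (n + 1))) 1) :=
    IsManifold.of_le (n := ω) le_top
  { carrier := Metric.sphere (0 : EuclideanSpace ℝ (Fin (n + 1))) 1 }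

instance : CompactSpace (sphereManifold n) :=
  inferInstanceAs (CompactSpace (Metric.sphere (0 : EuclideanSpace ℝ (Fin (n + 1))) 1))

instance : Nonempty (sphereManifold n) :=
  (NormedSpace.sphere_nonempty.2 zero_le_one :
    (Metric.sphere (0 : EuclideanSpace ℝ (Fin (n + 1))) 1).Nonempty).to_subtype

/-- Stereographic projection. Because its image is the whole of `ℝⁿ`, data from a chart of any
manifold can be copied without rescaling. -/
lemma exists_chart_target_univ (n : ℕ) : ∃ e ∈ charts (sphereManifold n), e.target = Set.univ := by
  obtain ⟨p⟩ : Nonempty (sphereManifold n) := inferInstance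
  exact ⟨_, chartAt_mem_charts (M := sphereManifold n) p, stereographic'_target _⟩

/-- Metrics in a chart of `M` are modelled on the sphere. -/
theorem exists_sphere_model {M : SmoothManifold n} (g : Metric M)
    {e : OpenPartialHomeomorph M (Eucl n)} (he : e ∈ charts M) {K : Set (Eucl n)}
    (hK : IsCompact K) (hKe : K ⊆ e.target) :
    ∃ e' ∈ charts (sphereManifold n), e'.target = Set.univ ∧
      ∃ g' : Metric (sphereManifold n), ∃ V, IsOpen V ∧ K ⊆ V ∧ ∀ y ∈ V, gram g e y = gram g' e' y := by
  obtain ⟨e', he', ht⟩ := exists_chart_target_univ n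
  -- Prescribing the metric on a larger compact set makes it agree on an open neighbourhood of `K`,
  -- so that derivatives agree on `K`.
  obtain ⟨L, hL, hKL, hLe⟩ := exists_compact_between hK e.open_target hKe
  let B : Eucl n → Eucl n →L[ℝ] Eucl n →L[ℝ] ℝ := fun y => ∑ i, ∑ j, gram g e y i j •
    (EuclideanSpace.proj i : Eucl n →L[ℝ] ℝ).smulRight (EuclideanSpace.proj j : Eucl n →L[ℝ] ℝ)
  have hBa : ∀ y a b, B y a b = ∑ i, ∑ j, a i * b j * gram g e y i j := by
    intro y a b
    simp only [B, sum_apply, smul_apply, ContinuousLinearMap.smulRight_apply, smul_eq_mul]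
    exact Finset.sum_congr rfl fun i _ => Finset.sum_congr rfl fun j _ => by
      change gram g e y i j * (a i * b j) = _
      ring
  have hB : ∀ y a b, B y a b = g.inner (e.symm y) (mfderiv (𝓡 n) (𝓡 n) e.symm y a)
      (mfderiv (𝓡 n) (𝓡 n) e.symm y b) := fun y a b => by rw [hBa, gram_apply]
  have h1 : ContDiffOn ℝ ∞ B e.target := by
    refine fun y hy => ContDiffAt.contDiffWithinAt ?_
    refine ContDiffAt.sum fun i _ => ContDiffAt.sum fun j _ => ?_
    have hL : ContDiff ℝ ∞ fun c : ℝ => c •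
        (EuclideanSpace.proj i : Eucl n →L[ℝ] ℝ).smulRight (EuclideanSpace.proj j : Eucl n →L[ℝ] ℝ) :=
      (ContinuousLinearMap.toSpanSingleton ℝ _).contDiff
    exact hL.contDiffAt.comp y (contDiffAt_gram g he hy i j)
  have h2 : ∀ y ∈ e.target, ∀ a b, B y a b = B y b a := by
    intro y _ a b
    rw [hB, hB, g.symm]
  have h3 : ∀ y ∈ e.target, ∀ a, a ≠ 0 → 0 < B y a a := by
    intro y hy a ha
    rw [hB]
    refine g.pos _ _ fun h0 => ha ?_
    exact (mdifferentiable_chart' he).symm.mfderiv_injective hy (h0.trans (map_zero _).symm)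
  obtain ⟨g', hg'⟩ := exists_metric (sphereManifold n) he' (B := B) e.open_target
    (ht ▸ Set.subset_univ _) hL hLe h1 h2 h3
  refine ⟨e', he', ht, g', interior L, isOpen_interior, hKL, fun y hy => ?_⟩
  ext i j
  exact ((hg' y (interior_subset hy) _ _).trans (hB _ _ _)).symm

lemma exists_sphere_metric (n : ℕ) : Nonempty (Metric (sphereManifold n)) := by
  obtain ⟨e', he', ht⟩ := exists_chart_target_univ n
  obtain ⟨g, -⟩ := exists_metric (sphereManifold n) he' (B := fun _ => innerSL ℝ) (W := ∅) (K := ∅)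
    isOpen_empty (Set.empty_subset _) isCompact_empty (Set.empty_subset _)
    (contDiffOn_const) (by simp) (by simp)
  exact ⟨g⟩

/-! ### The polarized conformal transformation law -/

lemma Contraction.card_le_order {p : ℕ} (β : Contraction p) (hP : ∀ j, 1 ≤ β.P j) : p ≤ β.order := by
  have := Finset.sum_le_sum (s := Finset.univ) fun j _ => hP j
  simp only [Finset.sum_const, Finset.card_univ, Fintype.card_fin, smul_eq_mul, mul_one] at this
  exact this.trans (Nat.le_add_left _ _)

lemma iterCovDeriv_const_add (G : Eucl n → Matrix (Fin n) (Fin n) ℝ) (c : ℝ) (f : Eucl n → ℝ)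
    (P : ℕ) : iterCovDeriv G (r := 0) (fun _ z => c + f z) (P + 1)
      = iterCovDeriv G (r := 0) (fun _ => f) (P + 1) := by
  induction P with
  | zero =>
    funext idx y
    change covDeriv G (r := 0) (fun _ z => c + f z) idx y = covDeriv G (r := 0) (fun _ => f) idx y
    simp [covDeriv, partialD]
  | succ P ih =>
    change covDeriv G (iterCovDeriv G _ (P + 1)) = covDeriv G (iterCovDeriv G _ (P + 1))
    rw [ih]

/-- When `v = s + χ`, only the explicit powers of `v` depend on `s`; the contractions do not. -/
lemma Contraction.evalG_const_add {p : ℕ} (β : Contraction p) (hP : ∀ j, 1 ≤ β.P j)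
    (G : Eucl n → Matrix (Fin n) (Fin n) ℝ) (c : ℝ) (f : Eucl n → ℝ) (y : Eucl n) :
    β.evalG G (fun _ z => c + f z) y = β.evalG G (fun _ => f) y := by
  have h : ∀ (P : ℕ), 1 ≤ P → ∀ idx : Fin (0 + P) → Fin n,
      iterCovDeriv G (r := 0) (fun _ z => c + f z) P idx y
        = iterCovDeriv G (r := 0) (fun _ => f) P idx y := by
    intro P hP idx
    obtain ⟨P, rfl⟩ := Nat.exists_eq_add_of_le' hP
    rw [iterCovDeriv_const_add]
  unfold Contraction.evalG
  refine Finset.sum_congr rfl fun idx _ => ?_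
  congr 1
  exact Finset.prod_congr rfl fun j _ => h _ (hP j) _

/-- The multilinear operator of degree `2k` whose diagonal is `v^{2k (1 + μ)} I`, for the metric
`v^{2μ} g`. -/
theorem IsNatural.exists_polarization {I : PolyOp n 0} {k : ℕ} (hI : IsNatural I)
    (hh : HasHomogeneity I (-(2 * (k : ℝ)))) (μ : ℝ) :
    ∃ (κ : Type) (_ : Fintype κ) (c : κ → ℝ) (p : κ → ℕ) (β : (s : κ) → Contraction (p s)),
      (∀ s j, 1 ≤ (β s).P j) ∧ (∀ s, (β s).order = 2 * k) ∧ ∃ E : PolyOp n (2 * k), IsNatural E ∧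
      (∀ (M : SmoothManifold n) (g : Metric M) (v : Smooth M) (hv : ∀ x, 0 < v x) (x : M),
        value I (powConf g μ v hv) x
          = v x ^ (-(μ * (2 * k))) * ((v x)⁻¹ ^ (2 * k) * E M g (fun _ => v) x)) ∧
      ∀ (M : SmoothManifold n) (g : Metric M) (v : Smooth M), (∀ x, 0 < v x) →
        ∀ e ∈ charts M, ∀ x ∈ e.source, E M g (fun _ => v) x
          = ∑ s, c s * (v x ^ (2 * k - p s)
            * (β s).evalG (gram g e) (fun _ z => v (e.symm z)) (e x)) := by
  obtain ⟨κ, _, c, p, β, hP, ho, hβ⟩ := exists_expansion hI hh μ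
  have hp : ∀ s, p s ≤ 2 * k := fun s => ho s ▸ (β s).card_le_order (hP s)
  -- Undifferentiated factors `v` bring every term to the common degree `2k`.
  choose α hα using fun s => (β s).exists_pad (n := n) (hp s)
  let H : ∀ M : SmoothManifold n, Metric M → ∀ v : Smooth M, (∀ x, 0 < v x) → Smooth M :=
    fun M g v hv => expSmooth (2 * k + μ * (2 * k)) (logSmooth v hv) * value I (powConf g μ v hv)
  have hexp : ∀ {M : SmoothManifold n} (v : Smooth M) (hv : ∀ x, 0 < v x) (x : M),
      expSmooth (2 * k + μ * (2 * k)) (logSmooth v hv) x * v x ^ (-(μ * (2 * k))) = v x ^ (2 * k) := by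
    intro M v hv x
    change Real.exp ((2 * k + μ * (2 * k)) * Real.log (v x)) * _ = _
    rw [Real.rpow_def_of_pos (hv x), ← Real.exp_add, ← Real.rpow_natCast,
      Real.rpow_def_of_pos (hv x)]
    push_cast
    ring_nf
  have hchart : ∀ (M : SmoothManifold n) (g : Metric M) (v : Smooth M) (hv : ∀ x, 0 < v x),
      ∀ e ∈ charts M, ∀ x ∈ e.source, H M g v hv x = ∑ s, c s * (v x ^ (2 * k - p s)
            * (β s).evalG (gram g e) (fun _ z => v (e.symm z)) (e x)) := by
    intro M g v hv e he x hx
    change expSmooth _ (logSmooth v hv) x * value I _ x = _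
    rw [hβ M g v hv e he x hx, ← mul_assoc, hexp, Finset.mul_sum]
    refine Finset.sum_congr rfl fun s _ => ?_
    rw [inv_pow, pow_sub₀ _ (hv x).ne' (hp s)]
    ring
  obtain ⟨E, hE, hEd, -⟩ := exists_polyOp c α H fun M g v hv e he x hx => by
    rw [hchart M g v hv e he x hx]
    refine Finset.sum_congr rfl fun s _ => ?_
    rw [hα, e.left_inv hx]
  refine ⟨κ, inferInstance, c, p, β, hP, ho, E, hE, fun M g v hv x => ?_, fun M g v hv e he x hx => ?_⟩
  · rw [hEd M g v hv]
    change _ = _ * (_ * (expSmooth _ (logSmooth v hv) x * value I _ x))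
    have h1 := hexp v hv x
    have h2 : (v x)⁻¹ ^ (2 * k) * v x ^ (2 * k) = 1 := by
      rw [← mul_pow, inv_mul_cancel₀ (hv x).ne', one_pow]
    rw [← h1] at h2
    linear_combination (- value I (powConf g μ v hv) x) * h2
  · rw [hEd M g v hv, hchart M g v hv e he x hx]

/-! ### Polynomial dependence -/

lemma multilinear_smul_add {V W : Type*} [AddCommGroup V] [Module ℝ V] [AddCommGroup W] [Module ℝ W]
    {ℓ : ℕ} (E : MultilinearMap ℝ (fun _ : Fin ℓ => V) W) (a b : Fin ℓ → V) (s : ℝ) :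
    E (fun j => s • a j + b j) = ∑ T : Finset (Fin ℓ), s ^ T.card • E (T.piecewise a b) := by
  have := E.map_add_univ (fun j => s • a j) b
  refine Eq.trans ?_ (this.trans (Finset.sum_congr rfl fun T _ => ?_))
  · rfl
  · have h := E.map_piecewise_smul (fun _ => s) (T.piecewise a b) T
    rw [Finset.prod_const] at h
    rw [← h]
    congr 1
    funext j
    by_cases hj : j ∈ T <;> simp [hj]

lemma polynomial_eq_zero_of_tendsto {p : Polynomial ℝ}
    (h : Filter.Tendsto (fun s => p.eval s) Filter.atTop (nhds 0)) : p = 0 := by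
  obtain ⟨h1, -⟩ := (p.tendsto_nhds_iff).1 h
  exact Polynomial.leadingCoeff_eq_zero.1 h1

/-- If the integral of `τ / (s + χ)` agrees with a polynomial in `s`, then it vanishes. -/
lemma integral_div_eq_zero_of_polynomial {X : Type*} [TopologicalSpace X] [CompactSpace X]
    [MeasurableSpace X] [BorelSpace X] (ν : Measure X) [IsFiniteMeasure ν] {τ χ : X → ℝ}
    (hτ : Continuous τ) (hχ : ∀ x, 0 < χ x) (p : Polynomial ℝ)
    (h : ∀ s : ℝ, 0 < s → ∫ x, τ x / (s + χ x) ∂ν = p.eval s) {s : ℝ} (hs : 0 < s) :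
    ∫ x, τ x / (s + χ x) ∂ν = 0 := by
  obtain ⟨B, hB⟩ := isCompact_univ.exists_bound_of_continuousOn (f := τ) hτ.continuousOn
  -- The integral is `O(1/s)`, and a polynomial tending to zero at infinity is zero.
  have hle : ∀ s : ℝ, 0 < s → ‖p.eval s‖ ≤ (|B| * ν.real Set.univ) / s := by
    intro s hs
    rw [← h s hs]
    have := norm_integral_le_of_norm_le_const (μ := ν) (f := fun x => τ x / (s + χ x)) (C := |B| / s)
      (Filter.Eventually.of_forall fun x => ?_)
    · refine this.trans (le_of_eq ?_)
      ring
    · rw [norm_div]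
      have h1 : ‖s + χ x‖ = s + χ x := Real.norm_of_nonneg (by have := hχ x; linarith)
      rw [h1]
      exact div_le_div₀ (abs_nonneg _) ((hB x trivial).trans (le_abs_self _)) hs
        (by have := hχ x; linarith)
  have ht : Filter.Tendsto (fun s => p.eval s) Filter.atTop (nhds 0) := by
    refine squeeze_zero_norm' ?_ (tendsto_const_nhds.div_atTop Filter.tendsto_id
      (a := |B| * ν.real Set.univ))
    filter_upwards [Filter.eventually_gt_atTop 0] with s hs using hle s hs
  rw [h s hs, polynomial_eq_zero_of_tendsto ht, Polynomial.eval_zero]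

/-! ### Functions supported in a chart -/

/-- The function `f ∘ e`, extended by zero. -/
def chartFun {M : SmoothManifold n} {e : OpenPartialHomeomorph M (Eucl n)} (he : e ∈ charts M)
    (f : Eucl n → ℝ) (hf : ContDiff ℝ ∞ f) (hc : HasCompactSupport f) (hs : tsupport f ⊆ e.target) :
    Smooth M :=
  ⟨e.source.indicator fun x => f (e x), fun x => by
    by_cases hx : x ∈ e.source
    · refine (hf.contMDiff.contMDiffAt.comp x (contMDiffAt_chart he hx)).congr_of_eventuallyEq ?_
      filter_upwards [e.open_source.mem_nhds hx] with z hz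
      exact Set.indicator_of_mem hz _
    · have hcl : IsClosed (e.symm '' tsupport f) :=
        (hc.image_of_continuousOn (e.continuousOn_symm.mono hs)).isClosed
      have hx' : x ∉ e.symm '' tsupport f := by
        rintro ⟨y, hy, rfl⟩
        exact hx (e.map_target (hs hy))
      refine (contMDiffAt_const (c := (0 : ℝ))).congr_of_eventuallyEq ?_
      filter_upwards [hcl.isOpen_compl.mem_nhds hx'] with z hz
      refine Set.indicator_apply_eq_zero.2 fun hzs => ?_
      by_contra h0
      exact hz ⟨e z, subset_tsupport _ h0, e.left_inv hzs⟩⟩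

lemma chartFun_apply {M : SmoothManifold n} {e : OpenPartialHomeomorph M (Eucl n)}
    (he : e ∈ charts M) {f : Eucl n → ℝ} (hf : ContDiff ℝ ∞ f) (hc : HasCompactSupport f)
    (hs : tsupport f ⊆ e.target) {x : M} (hx : x ∈ e.source) :
    chartFun he f hf hc hs x = f (e x) := Set.indicator_of_mem hx fun x => f (e x)

lemma chartFun_of_notMem {M : SmoothManifold n} {e : OpenPartialHomeomorph M (Eucl n)}
    (he : e ∈ charts M) {f : Eucl n → ℝ} (hf : ContDiff ℝ ∞ f) (hc : HasCompactSupport f)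
    (hs : tsupport f ⊆ e.target) {x : M} (hx : x ∉ e.source) :
    chartFun he f hf hc hs x = 0 := Set.indicator_of_notMem hx fun x => f (e x)

/-- The inverse of a positive function. -/
def invSmooth {M : SmoothManifold n} (v : Smooth M) (hv : ∀ x, 0 < v x) : Smooth M :=
  ⟨fun x => (v x)⁻¹, fun x =>
    ((contDiffAt_inv ℝ (hv x).ne').contMDiffAt (n := ∞)).comp x v.contMDiff.contMDiffAt⟩

lemma invSmooth_mul {M : SmoothManifold n} (v : Smooth M) (hv : ∀ x, 0 < v x) :
    invSmooth v hv * v = 1 := by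
  ext x
  exact inv_mul_cancel₀ (hv x).ne'

lemma smooth_sum_apply {M : SmoothManifold n} {ι : Type*} (S : Finset ι) (f : ι → Smooth M) (x : M) :
    (∑ i ∈ S, f i : Smooth M) x = ∑ i ∈ S, f i x :=
  map_sum (ContMDiffMap.evalRingHom x) f S

lemma Smooth.integrable {M : SmoothManifold n} [CompactSpace M] (f : Smooth M) (g : Metric M) :
    Integrable f (vol g) :=
  f.contMDiff.continuous.integrable_of_hasCompactSupport (HasCompactSupport.of_compactSpace _)

lemma exists_pos_lower_bound {M : SmoothManifold n} [CompactSpace M] (f : Smooth M) :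
    ∃ c : ℝ, ∀ x, 0 < c + f x := by
  obtain ⟨B, hB⟩ := isCompact_univ.exists_bound_of_continuousOn f.contMDiff.continuous.continuousOn
  refine ⟨B + 1, fun x => ?_⟩
  have := (abs_le.1 (hB x trivial)).1
  linarith

lemma gradSq_nonneg {G : Eucl n → Matrix (Fin n) (Fin n) ℝ} {y : Eucl n} (hG : (G y).PosDef)
    (v : Eucl n → ℝ) : 0 ≤ gradSq G v y := by
  have h := hG.inv.posSemidef.dotProduct_mulVec_nonneg fun i => partialD i v y
  unfold gradSq
  rw [← (finTwoArrowEquiv (Fin n)).symm.sum_comp, Fintype.sum_prod_type]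
  refine h.trans (le_of_eq ?_)
  simp only [dotProduct, Matrix.mulVec, Finset.mul_sum]
  refine Finset.sum_congr rfl fun i _ => Finset.sum_congr rfl fun j _ => ?_
  simp
  ring

lemma gradSq_pos_of_coord {G : Eucl n → Matrix (Fin n) (Fin n) ℝ} {y : Eucl n} (hG : (G y).PosDef)
    {v : Eucl n → ℝ} (a : Fin n) (c : ℝ) (hv : v =ᶠ[nhds y] fun z => c + z a) :
    0 < gradSq G v y := by
  have hd : ∀ i, partialD i v y = if i = a then 1 else 0 := by
    intro i
    have h1 : fderiv ℝ v y = EuclideanSpace.proj a := by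
      rw [hv.fderiv_eq, fderiv_const_add]
      exact (EuclideanSpace.proj a : Eucl n →L[ℝ] ℝ).fderiv
    unfold partialD
    rw [h1]
    simp [eq_comm]
  unfold gradSq
  rw [← (finTwoArrowEquiv (Fin n)).symm.sum_comp, Fintype.sum_prod_type]
  simp only [finTwoArrowEquiv_symm_apply, Matrix.cons_val_zero, Matrix.cons_val_one, hd]
  simp
  exact hG.inv.diag_pos

/-- A positive function on the sphere which is not locally constant. -/
lemma exists_coordinate_function (a : Fin n) {e : OpenPartialHomeomorph (sphereManifold n) (Eucl n)}
    (he : e ∈ charts (sphereManifold n)) (ht : e.target = Set.univ) :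
    ∃ χ : Smooth (sphereManifold n), (∀ x, 0 < χ x) ∧
      ∃ c : ℝ, (fun z => χ (e.symm z)) =ᶠ[nhds 0] fun z => c + z a := by
  let b : ContDiffBump (0 : Eucl n) := ⟨1, 2, one_pos, one_lt_two⟩
  have hf : ContDiff ℝ ∞ fun z : Eucl n => b z * z a := by
    have h2 : ContDiff ℝ ∞ fun z : Eucl n => z a :=
      (EuclideanSpace.proj a : Eucl n →L[ℝ] ℝ).contDiff
    exact b.contDiff.mul h2
  have hc : HasCompactSupport fun z : Eucl n => b z * z a := b.hasCompactSupport.mul_right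
  let f := chartFun he _ hf hc (ht ▸ Set.subset_univ _)
  obtain ⟨c, hc'⟩ := exists_pos_lower_bound f
  refine ⟨ContMDiffMap.const c + f, hc', c, ?_⟩
  filter_upwards [b.eventuallyEq_one] with z hz
  have hz' : z ∈ e.target := ht ▸ Set.mem_univ z
  change c + f (e.symm z) = _
  rw [chartFun_apply he hf hc _ (e.map_target hz'), e.right_inv hz', hz]
  simp

/-! ### The top coefficient -/

lemma pow_sub_pow_eq (s t : ℝ) (m : ℕ) :
    s ^ m - (-t) ^ m = (s + t) * ∑ i ∈ Finset.range m, s ^ i * (-t) ^ (m - 1 - i) := by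
  rw [mul_comm, ← sub_neg_eq_add, geom_sum₂_mul]

/-- The value at `s = -χ` of the polynomial `E(s + χ)`, as a continuous function. -/
lemma IsCVI.integral_remainder {I : PolyOp n 0} {k : ℕ} (hI : IsCVI I k) (hk : 1 ≤ k) {μ : ℝ}
    (hμ : ((n : ℝ) - 2 * k) * μ = 2 * k) (hμ0 : μ ≠ 0) {E : PolyOp n (2 * k)} (hE : IsNatural E)
    (hEI : ∀ (M : SmoothManifold n) (g : Metric M) (v : Smooth M) (hv : ∀ x, 0 < v x) (x : M),
      value I (powConf g μ v hv) x
        = v x ^ (-(μ * (2 * k))) * ((v x)⁻¹ ^ (2 * k) * E M g (fun _ => v) x))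
    {M : SmoothManifold n} [CompactSpace M] (g : Metric M) (χ : Smooth M) (hχ : ∀ x, 0 < χ x) :
    ∃ τ : Smooth M, (∀ x, τ x = ∑ T : Finset (Fin (2 * k)), (-χ x) ^ T.card
        * E M g (T.piecewise (fun _ => 1) (fun _ => χ)) x) ∧
      ∫ x, τ x / (1 + χ x) ∂(vol g) = 0 := by
  let q : Finset (Fin (2 * k)) → Smooth M := fun T =>
    E M g (T.piecewise (fun _ => 1) (fun _ => χ))
  -- `E(s + χ) = ∑_T s^{|T|} q_T` is a polynomial in `s` at each point; `τ` is its value at `s =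
  -- -χ`, the remainder of division by `s + χ`, and the `d T i` below give the quotient.
  let τ : Smooth M := ∑ T, (-χ) ^ T.card * q T
  have hτ : ∀ x, τ x = ∑ T, (-χ x) ^ T.card * q T x := fun x => by
    rw [smooth_sum_apply]
    refine Finset.sum_congr rfl fun T _ => ?_
    change ContMDiffMap.evalRingHom x ((-χ) ^ T.card * q T) = _
    rw [map_mul, map_pow, map_neg]
    rfl
  refine ⟨τ, hτ, ?_⟩
  let d : (T : Finset (Fin (2 * k))) → ℕ → Smooth M := fun T i => (-χ) ^ (T.card - 1 - i) * q T
  have hd : ∀ T i x, d T i x = (-χ x) ^ (T.card - 1 - i) * q T x := fun T i x => by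
    change ContMDiffMap.evalRingHom x ((-χ) ^ (T.card - 1 - i) * q T) = _
    rw [map_mul, map_pow, map_neg]
    rfl
  let r : Fin (2 * k) → Finset (Fin (2 * k)) → Smooth M := fun i T =>
    E M g (T.piecewise (Function.update (fun _ => 1) i 0) (Function.update (fun _ => χ) i 1))
  -- `p₁` is the integral of `∑_i E(v, …, 1, …, v)` with `1` in position `i`, and `p₂` the integral
  -- of the quotient of `E(v)` by `v`, where `v = s + χ`.
  let p₁ : Polynomial ℝ := ∑ i, ∑ T, Polynomial.C (∫ x, r i T x ∂(vol g)) * Polynomial.X ^ T.card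
  let p₂ : Polynomial ℝ := ∑ T, ∑ i ∈ Finset.range T.card,
    Polynomial.C (∫ x, d T i x ∂(vol g)) * Polynomial.X ^ i
  have hk' : (2 * k : ℝ) ≠ 0 := by positivity
  refine integral_div_eq_zero_of_polynomial (vol g) (τ := τ) τ.contMDiff.continuous hχ
    (Polynomial.C (2 * k : ℝ)⁻¹ * p₁ - p₂) (fun s hs => ?_) one_pos
  let v : Smooth M := s • 1 + χ
  have hvx : ∀ x, v x = s + χ x := fun x => by
    change s * 1 + χ x = _
    rw [mul_one]
  have hv : ∀ x, 0 < v x := fun x => by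
    rw [hvx]
    have := hχ x
    linarith
  -- With `φ = 1` and `ψ = 1/v`, one side is `p₁(s)`, and the other is `2k ∫ v⁻¹ E(v)`, since each
  -- of the `2k` derivatives of `E` in the direction `v` gives `E(v)` back.
  have hsym := hI.symmetric hμ hμ0 hE hEI g 1 (invSmooth v hv) v hv
  have h1 : ∫ x, (1 : Smooth M) x * ∑ i, E M g (Function.update (fun _ => v) i (invSmooth v hv * v)) x
      ∂(vol g) = p₁.eval s := by
    have hx : ∀ x, (1 : Smooth M) x
        * ∑ i, E M g (Function.update (fun _ => v) i (invSmooth v hv * v)) x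
        = ∑ i, ∑ T, r i T x * s ^ T.card := by
      intro x
      change 1 * _ = _
      rw [one_mul]
      refine Finset.sum_congr rfl fun i _ => ?_
      have : Function.update (fun _ => v) i (invSmooth v hv * v) = fun j =>
          s • Function.update (fun _ => (1 : Smooth M)) i 0 j + Function.update (fun _ => χ) i 1 j := by
        funext j
        rw [invSmooth_mul]
        by_cases hj : j = i
        · subst hj
          simp
        · simp [hj, v]
      rw [this, multilinear_smul_add, smooth_sum_apply]
      exact Finset.sum_congr rfl fun T _ => mul_comm _ _
    simp only [hx]
    rw [integral_finsetSum _ fun i _ => integrable_finsetSum _ fun T _ =>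
      ((r i T).integrable g).mul_const _, Polynomial.eval_finsetSum]
    refine Finset.sum_congr rfl fun i _ => ?_
    rw [integral_finsetSum _ fun T _ => ((r i T).integrable g).mul_const _, Polynomial.eval_finsetSum]
    refine Finset.sum_congr rfl fun T _ => ?_
    rw [integral_mul_const]
    simp
  have hEv : ∀ x, E M g (fun _ => v) x = ∑ T, s ^ T.card * q T x := by
    intro x
    have := multilinear_smul_add (E M g) (fun _ => 1) (fun _ => χ) s
    change E M g (fun _ => s • 1 + χ) x = _
    rw [this, smooth_sum_apply]
    rfl
  have hdiv : ∀ x, (v x)⁻¹ * E M g (fun _ => v) x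
      = ∑ T, ∑ i ∈ Finset.range T.card, d T i x * s ^ i + τ x / (s + χ x) := by
    intro x
    have hne : s + χ x ≠ 0 := by
      rw [← hvx]
      exact (hv x).ne'
    have h2 : E M g (fun _ => v) x = (s + χ x) * ∑ T, ∑ i ∈ Finset.range T.card, d T i x * s ^ i
        + τ x := by
      rw [hEv, hτ, Finset.mul_sum, ← Finset.sum_add_distrib]
      refine Finset.sum_congr rfl fun T _ => ?_
      have h3 := pow_sub_pow_eq s (χ x) T.card
      have h4 : ∑ i ∈ Finset.range T.card, d T i x * s ^ i
          = (∑ i ∈ Finset.range T.card, s ^ i * (-χ x) ^ (T.card - 1 - i)) * q T x := by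
        rw [Finset.sum_mul]
        exact Finset.sum_congr rfl fun i _ => by rw [hd]; ring
      rw [h4]
      linear_combination (q T x) * h3
    rw [h2, hvx]
    field_simp
  have hτi : Integrable (fun x => τ x / (s + χ x)) (vol g) := by
    have : Integrable (invSmooth v hv * τ : Smooth M) (vol g) := Smooth.integrable _ g
    refine this.congr (Filter.Eventually.of_forall fun x => ?_)
    change (v x)⁻¹ * τ x = _
    rw [hvx]
    ring
  have h2 : ∫ x, invSmooth v hv x * ∑ i, E M g (Function.update (fun _ => v) i (1 * v)) x ∂(vol g)
      = 2 * k * (p₂.eval s + ∫ x, τ x / (s + χ x) ∂(vol g)) := by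
    have hx : ∀ x, invSmooth v hv x * ∑ i, E M g (Function.update (fun _ => v) i (1 * v)) x
        = 2 * k * (∑ T, ∑ i ∈ Finset.range T.card, d T i x * s ^ i + τ x / (s + χ x)) := by
      intro x
      rw [← hdiv]
      simp only [one_mul, Function.update_eq_self, Finset.sum_const, Finset.card_univ,
        Fintype.card_fin, nsmul_eq_mul]
      change (v x)⁻¹ * _ = _
      push_cast
      ring
    simp only [hx]
    have hdi : ∀ T i, Integrable (fun x => d T i x * s ^ i) (vol g) := fun T i =>
      ((d T i).integrable g).mul_const _
    rw [integral_const_mul, integral_add (integrable_finsetSum _ fun T _ =>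
      integrable_finsetSum _ fun i _ => hdi T i) hτi,
      integral_finsetSum _ fun T _ => integrable_finsetSum _ fun i _ => hdi T i,
      Polynomial.eval_finsetSum]
    congr 2
    refine Finset.sum_congr rfl fun T _ => ?_
    rw [integral_finsetSum _ fun i _ => hdi T i, Polynomial.eval_finsetSum]
    refine Finset.sum_congr rfl fun i _ => ?_
    rw [integral_mul_const]
    simp
  rw [h1, h2] at hsym
  rw [Polynomial.eval_sub, Polynomial.eval_mul, Polynomial.eval_C, hsym]
  field_simp
  ring

/-- The top coefficient of the transformation law of a conformally variational invariant is
zero. -/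
theorem IsCVI.top_coefficient {I : PolyOp n 0} {k : ℕ} (hI : IsCVI I k) (hk : 1 ≤ k) (hn : 0 < n)
    {μ : ℝ} (hμ : ((n : ℝ) - 2 * k) * μ = 2 * k) (hμ0 : μ ≠ 0) {κ : Type} [Fintype κ] {c : κ → ℝ}
    {p : κ → ℕ} {β : (s : κ) → Contraction (p s)} (hP : ∀ s j, 1 ≤ (β s).P j)
    (ho : ∀ s, (β s).order = 2 * k) {E : PolyOp n (2 * k)} (hE : IsNatural E)
    (hEI : ∀ (M : SmoothManifold n) (g : Metric M) (v : Smooth M) (hv : ∀ x, 0 < v x) (x : M),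
      value I (powConf g μ v hv) x
        = v x ^ (-(μ * (2 * k))) * ((v x)⁻¹ ^ (2 * k) * E M g (fun _ => v) x))
    (hEc : ∀ (M : SmoothManifold n) (g : Metric M) (v : Smooth M), (∀ x, 0 < v x) →
        ∀ e ∈ charts M, ∀ x ∈ e.source, E M g (fun _ => v) x
          = ∑ s, c s * (v x ^ (2 * k - p s)
            * (β s).evalG (gram g e) (fun _ z => v (e.symm z)) (e x))) :
    ∑ s, c s * 0 ^ (2 * k - p s) = 0 := by
  -- Since `0^0 = 1`, this sums exactly the coefficients of the terms with `p = 2k`.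
  set C : ℝ := ∑ s, c s * 0 ^ (2 * k - p s) with hC
  obtain ⟨g⟩ := exists_sphere_metric n
  obtain ⟨e₀, he₀, ht⟩ := exists_chart_target_univ n
  obtain ⟨χ, hχ, b, hb⟩ := exists_coordinate_function ⟨0, hn⟩ he₀ ht
  obtain ⟨τ, hτ, hint⟩ := hI.integral_remainder hk hμ hμ0 hE hEI g χ hχ
  -- At a fixed point `E(s + χ)` is a polynomial in `s`, read off once from multilinearity and once
  -- from the chart formula. At `s = -χ(x)` every term with `p < 2k` contains a positive power of
  -- zero.
  have key : ∀ e ∈ charts (sphereManifold n), ∀ x ∈ e.source,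
      τ x = C * gradSq (gram g e) (fun z => χ (e.symm z)) (e x) ^ k := by
    intro e he x hx
    let A : Polynomial ℝ := ∑ T : Finset (Fin (2 * k)), Polynomial.C
      (E _ g (T.piecewise (fun _ => 1) (fun _ => χ)) x) * Polynomial.X ^ T.card
    let B : Polynomial ℝ := ∑ s, Polynomial.C
      (c s * (β s).evalG (gram g e) (fun _ z => χ (e.symm z)) (e x))
        * (Polynomial.X + Polynomial.C (χ x)) ^ (2 * k - p s)
    have hAB : A = B := by
      refine Polynomial.eq_of_infinite_eval_eq A B ((Set.Ioi_infinite (0 : ℝ)).mono fun s hs => ?_)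
      have hs : 0 < s := hs
      have hvx : ∀ x, (s • 1 + χ : Smooth (sphereManifold n)) x = s + χ x := fun x => by
        change s * 1 + χ x = _
        rw [mul_one]
      have h1 := hEc _ g (s • 1 + χ) (fun x => by
        rw [hvx]
        have := hχ x
        linarith) e he x hx
      rw [multilinear_smul_add, smooth_sum_apply] at h1
      change A.eval s = B.eval s
      rw [Polynomial.eval_finsetSum, Polynomial.eval_finsetSum]
      refine Eq.trans ?_ (h1.trans ?_)
      · refine Finset.sum_congr rfl fun T _ => ?_
        simp only [Polynomial.eval_mul, Polynomial.eval_C, Polynomial.eval_pow, Polynomial.eval_X]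
        exact mul_comm _ _
      · refine Finset.sum_congr rfl fun t _ => ?_
        simp only [hvx, (β t).evalG_const_add (hP t)]
        simp only [Polynomial.eval_mul, Polynomial.eval_C, Polynomial.eval_pow, Polynomial.eval_X,
          Polynomial.eval_add]
        ring
    have h2 : τ x = A.eval (-χ x) := by
      rw [hτ, Polynomial.eval_finsetSum]
      refine Finset.sum_congr rfl fun T _ => ?_
      simp only [Polynomial.eval_mul, Polynomial.eval_C, Polynomial.eval_pow, Polynomial.eval_X]
      exact mul_comm _ _
    rw [h2, hAB, Polynomial.eval_finsetSum, hC, Finset.sum_mul]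
    refine Finset.sum_congr rfl fun t _ => ?_
    simp only [Polynomial.eval_mul, Polynomial.eval_C, Polynomial.eval_pow, Polynomial.eval_X,
      Polynomial.eval_add, neg_add_cancel]
    by_cases hp : p t = 2 * k
    · rw [(β t).evalG_top (hP t) hp (ho t)]
      ring
    · have : 2 * k - p t ≠ 0 := by
        have := (ho t) ▸ (β t).card_le_order (hP t)
        omega
      rw [zero_pow this]
      ring
  have hcont : Continuous fun x => C * (τ x / (1 + χ x)) :=
    continuous_const.mul (τ.contMDiff.continuous.div₀ (continuous_const.add χ.contMDiff.continuous)
      fun x => by have := hχ x; linarith)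
  -- Multiplication by `C` makes the integrand `C² |∇χ|^{2k} / (1 + χ)`, nonnegative whatever the
  -- sign of `C`.
  have hnn : ∀ x, 0 ≤ C * (τ x / (1 + χ x)) := by
    intro x
    have hx := mem_chart_source (Eucl n) x
    have h1 := gradSq_nonneg (gram_posDef g (chartAt_mem_charts x) ((chartAt (Eucl n) x).map_source hx))
      (fun z => χ ((chartAt (Eucl n) x).symm z))
    rw [key _ (chartAt_mem_charts x) x hx]
    have h2 : 0 < 1 + χ x := by have := hχ x; linarith
    have h3 : 0 ≤ C * C := mul_self_nonneg C
    rw [← mul_div_assoc, ← mul_assoc]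
    positivity
  have hzero : (fun x => C * (τ x / (1 + χ x))) = 0 := by
    have h1 : ∫ x, C * (τ x / (1 + χ x)) ∂(vol g) = 0 := by rw [integral_const_mul, hint, mul_zero]
    rw [integral_eq_zero_iff_of_nonneg hnn
      (hcont.integrable_of_hasCompactSupport (HasCompactSupport.of_compactSpace _))] at h1
    exact (Continuous.ae_eq_iff_eq (vol g) hcont continuous_const).1 h1
  have h0t : (0 : Eucl n) ∈ e₀.target := ht ▸ Set.mem_univ _
  have h0 := congrFun hzero (e₀.symm 0)
  have hs := e₀.map_target h0t
  have h5 := gradSq_pos_of_coord (gram_posDef g he₀ h0t) _ b hb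
  have h6 := hχ (e₀.symm 0)
  change C * (τ (e₀.symm 0) / (1 + χ (e₀.symm 0))) = 0 at h0
  rw [key e₀ he₀ _ hs, e₀.right_inv h0t] at h0
  by_contra hC0
  have h7 : 1 + χ (e₀.symm 0) ≠ 0 := by linarith
  have h8 := (pow_pos h5 k).ne'
  rw [mul_eq_zero, div_eq_zero_iff, mul_eq_zero] at h0
  tauto

/-! ### The associated operator -/

/-- In dimension zero the argument with a coordinate function is unavailable, but the top term
vanishes for any coefficient. -/
lemma gradSq_eq_zero_of_dim_zero (hn : n = 0) (G : Eucl n → Matrix (Fin n) (Fin n) ℝ) (v : Eucl n → ℝ)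
    (y : Eucl n) : gradSq G v y = 0 := by
  subst hn
  exact Fintype.sum_empty _

/-- Removal of the top coefficient. -/
theorem IsCVI.exists_lower {I : PolyOp n 0} {k ℓ : ℕ} (hI : IsCVI I k) (hk : 2 * k = ℓ + 1)
    {μ : ℝ} (hμ : ((n : ℝ) - 2 * k) * μ = 2 * k) (hμ0 : μ ≠ 0) (b : ℝ) :
    ∃ E : PolyOp n (2 * k), IsNatural E ∧
      (∀ (M : SmoothManifold n) (g : Metric M) (v : Smooth M) (hv : ∀ x, 0 < v x) (x : M),
        value I (powConf g μ v hv) x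
          = v x ^ (-(μ * (2 * k))) * ((v x)⁻¹ ^ (2 * k) * E M g (fun _ => v) x)) ∧
      ∃ D : PolyOp n ℓ, IsNatural D ∧
        (∀ (M : SmoothManifold n) (g : Metric M) (v : Smooth M), (∀ x, 0 < v x) → ∀ x,
          v x * D M g (fun _ => v) x = b * E M g (fun _ => v) x) ∧
        ∀ M g u (σ : Equiv.Perm (Fin ℓ)), D M g (fun i => u (σ i)) = D M g u := by
  have hk1 : 1 ≤ k := by omega
  obtain ⟨κ, _, c, p, β, hP, ho, E, hE, hEI, hEc⟩ := hI.1.exists_polarization hI.2.1 μ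
  refine ⟨E, hE, hEI, ?_⟩
  have hp : ∀ s, p s ≤ 2 * k := fun s => ho s ▸ (β s).card_le_order (hP s)
  have hchart : ∀ (M : SmoothManifold n) (g : Metric M) (v : Smooth M), (∀ x, 0 < v x) →
      ∀ e ∈ charts M, ∀ x ∈ e.source, E M g (fun _ => v) x
        = v x * ∑ s : {s // p s ≤ ℓ}, c s * (v x ^ (ℓ - p s)
          * (β s).evalG (gram g e) (fun _ z => v (e.symm z)) (e x)) := by
    intro M g v hv e he x hx
    -- The terms of degree `2k` in derivatives of `v` add up to zero; the others have `2k - p ≥ 1`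
    -- undifferentiated factors, one of which is split off.
    have htop : ∑ s, c s * 0 ^ (2 * k - p s) * gradSq (gram g e) (fun z => v (e.symm z)) (e x) ^ k
        = 0 := by
      rw [← Finset.sum_mul]
      rcases Nat.eq_zero_or_pos n with hn | hn
      · rw [gradSq_eq_zero_of_dim_zero hn, zero_pow (by omega), mul_zero]
      · rw [hI.top_coefficient hk1 hn hμ hμ0 hP ho hE hEI hEc, zero_mul]
    rw [hEc M g v hv e he x hx, ← sub_zero (∑ s, _), ← htop, ← Finset.sum_sub_distrib, Finset.mul_sum,
      ← Finset.sum_subtype (Finset.univ.filter fun s => p s ≤ ℓ) (by simp) fun s =>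
        v x * (c s * (v x ^ (ℓ - p s) * (β s).evalG (gram g e) (fun _ z => v (e.symm z)) (e x))),
      Finset.sum_filter]
    refine Finset.sum_congr rfl fun s _ => ?_
    split_ifs with h
    · rw [show 2 * k - p s = ℓ - p s + 1 by omega]
      ring
    · have hs : p s = 2 * k := le_antisymm (hp s) (by omega)
      rw [(β s).evalG_top (hP s) hs (ho s), hs]
      simp
  choose α hα using fun s : {s // p s ≤ ℓ} => (β s).exists_pad (n := n) s.2
  let H : ∀ M : SmoothManifold n, Metric M → ∀ v : Smooth M, (∀ x, 0 < v x) → Smooth M :=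
    fun M g v hv => b • (invSmooth v hv * E M g (fun _ => v))
  obtain ⟨D, hD, hDd, hDs⟩ := exists_polyOp (fun s : {s // p s ≤ ℓ} => b * c s) α H
    fun M g v hv e he x hx => by
      change b * ((v x)⁻¹ * _) = _
      rw [hchart M g v hv e he x hx, inv_mul_cancel_left₀ (hv x).ne', Finset.mul_sum]
      refine Finset.sum_congr rfl fun s _ => ?_
      rw [hα, e.left_inv hx]
      ring
  refine ⟨D, hD, fun M g v hv x => ?_, hDs⟩
  rw [hDd M g v hv]
  change v x * (b * ((v x)⁻¹ * _)) = _
  field_simp [(hv x).ne']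

/-- Self-adjointness on compact manifolds, for equal positive remaining arguments. -/
lemma IsCVI.symmetric_lower {I : PolyOp n 0} {k m : ℕ} (hI : IsCVI I k)
    {μ : ℝ} (hμ : ((n : ℝ) - 2 * k) * μ = 2 * k) (hμ0 : μ ≠ 0) {b : ℝ}
    {E : PolyOp n (2 * k)} (hE : IsNatural E)
    (hEI : ∀ (M : SmoothManifold n) (g : Metric M) (v : Smooth M) (hv : ∀ x, 0 < v x) (x : M),
        value I (powConf g μ v hv) x
          = v x ^ (-(μ * (2 * k))) * ((v x)⁻¹ ^ (2 * k) * E M g (fun _ => v) x))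
    {D : PolyOp n (m + 1)} (hD : IsNatural D)
    (hDE : ∀ (M : SmoothManifold n) (g : Metric M) (v : Smooth M), (∀ x, 0 < v x) → ∀ x,
          v x * D M g (fun _ => v) x = b * E M g (fun _ => v) x)
    (hDs : ∀ M g u (σ : Equiv.Perm (Fin (m + 1))), D M g (fun i => u (σ i)) = D M g u)
    {M : SmoothManifold n} [hM : CompactSpace M] (g : Metric M) (φ ψ v : Smooth M)
    (hv : ∀ x, 0 < v x) :
    ∫ x, φ x * D M g (Fin.cons ψ fun _ => v) x ∂(vol g)
      = ∫ x, ψ x * D M g (Fin.cons φ fun _ => v) x ∂(vol g) := by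
  -- Differentiate `v D(v) = b E(v)` along `e^{tψ} v`; by symmetry of `D` its `m + 1` arguments
  -- contribute equally.
  have hder : ∀ (ψ : Smooth M) x, b * ∑ i, E M g (Function.update (fun _ => v) i (ψ * v)) x
      = ψ x * v x * D M g (fun _ => v) x
        + v x * ((m + 1) * D M g (Fin.cons (ψ * v) fun _ => v) x) := by
    intro ψ x
    have h1 := (hE.hasDerivAt_exp g (fun _ => ψ) (fun _ => v) x).const_mul b
    have h2 := hD.hasDerivAt_exp g (fun _ => ψ) (fun _ => v) x
    have h3 : HasDerivAt (fun t => Real.exp (t * ψ x) * v x) (ψ x * v x) 0 := by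
      have := (((hasDerivAt_id (0 : ℝ)).mul_const (ψ x)).exp).mul_const (v x)
      simpa using this
    have h4 := h3.fun_mul h2
    have h5 : (fun t => b * E M g (fun _ => expSmooth t ψ * v) x) = fun t =>
        Real.exp (t * ψ x) * v x * D M g (fun _ => expSmooth t ψ * v) x := by
      funext t
      exact (hDE M g (expSmooth t ψ * v) (fun x => mul_pos (Real.exp_pos _) (hv x)) x).symm
    rw [h5] at h1
    rw [h1.unique h4]
    have h6 : (fun _ : Fin (m + 1) => expSmooth 0 ψ * v) = fun _ => v := by
      funext _
      ext z
      change Real.exp (0 * ψ z) * v z = _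
      simp
    have h7 : ∀ i, D M g (Function.update (fun _ => v) i (ψ * v)) = D M g (Fin.cons (ψ * v) fun _ => v) := by
      intro i
      rw [← hDs M g _ (Equiv.swap 0 i)]
      congr 1
      funext j
      refine Fin.cases ?_ (fun j => ?_) j
      · simp
      · rw [Fin.cons_succ, Function.update_of_ne]
        intro h
        rw [← Equiv.swap_apply_left 0 i] at h
        exact Fin.succ_ne_zero j ((Equiv.swap 0 i).injective h)
    rw [h6]
    simp only [h7, zero_mul, Real.exp_zero, one_mul, Finset.sum_const, Finset.card_univ,
      Fintype.card_fin, nsmul_eq_mul]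
    push_cast
    ring
  -- Dividing `φ` and `ψ` by `v` undoes the multiplicative form of the variation. The term `v⁻¹ φψ
  -- D(v)` is symmetric and drops out, leaving `(m + 1) ∫ φ D(ψ, v, …, v)`.
  let ψ' := invSmooth v hv * ψ
  let φ' := invSmooth v hv * φ
  have hinv : ∀ f : Smooth M, invSmooth v hv * f * v = f := fun f => by
    rw [mul_right_comm, invSmooth_mul, one_mul]
  have hs := congrArg (b * ·) (hI.symmetric hμ hμ0 hE hEI g φ' ψ' v hv)
  simp only [← integral_const_mul] at hs
  have hx : ∀ (f h : Smooth M) x, b * ((invSmooth v hv * f) x * ∑ i, E M g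
      (Function.update (fun _ => v) i (invSmooth v hv * h * v)) x)
      = (invSmooth v hv * f * h * D M g (fun _ => v)) x + (m + 1) * (f x * D M g (Fin.cons h fun _ => v) x) := by
    intro f h x
    have h1 := hder (invSmooth v hv * h) x
    have h2 : (invSmooth v hv * h) x * v x = h x := DFunLike.congr_fun (hinv h) x
    have h3 : (invSmooth v hv * f) x * v x = f x := DFunLike.congr_fun (hinv f) x
    rw [h2] at h1
    rw [mul_left_comm, h1, hinv]
    change _ = (invSmooth v hv * f) x * h x * D M g (fun _ => v) x + _
    linear_combination (m + 1) * D M g (Fin.cons h fun _ => v) x * h3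
  simp only [φ', ψ', hx] at hs
  have hi : ∀ f h : Smooth M, Integrable (fun x => (m + 1) * (f x * D M g (Fin.cons h fun _ => v) x)) (vol g) :=
    fun f h => ((f * D M g (Fin.cons h fun _ => v)).integrable g).const_mul _
  rw [integral_add (Smooth.integrable _ g) (hi _ _), integral_add (Smooth.integrable _ g) (hi _ _),
    integral_const_mul, integral_const_mul, mul_right_comm (invSmooth v hv) ψ φ] at hs
  have hm : (m + 1 : ℝ) ≠ 0 := by positivity
  exact mul_left_cancel₀ hm (add_left_cancel hs)

/-- Polarization for positive functions. -/
lemma polarization_pos {ℓ : ℕ} {M : SmoothManifold n}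
    (f : MultilinearMap ℝ (fun _ : Fin ℓ => Smooth M) (Smooth M))
    (hf : ∀ u (σ : Equiv.Perm (Fin ℓ)), f (fun i => u (σ i)) = f u) (u : Fin ℓ → Smooth M) (x : M) :
    f u x = (ℓ.factorial : ℝ)⁻¹ * ∑ T : Finset (Fin ℓ), (-1 : ℝ) ^ T.card *
      f (fun _ => majorant u + ∑ i ∈ Tᶜ, u i) x := by
  have h : ∑ T : Finset (Fin ℓ), (-1 : ℝ) ^ T.card * f (fun _ => majorant u + ∑ i ∈ Tᶜ, u i) x
      = ∑ σ : Equiv.Perm (Fin ℓ), f (fun i => u (σ i)) x :=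
    multilinear_polarization ((evalL x).compMultilinearMap f) (majorant u) u
  simp only [hf, Finset.sum_const, Finset.card_univ, Fintype.card_perm, Fintype.card_fin,
    nsmul_eq_mul] at h
  rw [h, inv_mul_cancel_left₀ (by positivity)]

/-- Self-adjointness on compact manifolds, in the first two arguments. -/
lemma symmetric_of_diagonal {m : ℕ} {D : PolyOp n (m + 1)}
    (hDs : ∀ M g u (σ : Equiv.Perm (Fin (m + 1))), D M g (fun i => u (σ i)) = D M g u)
    {M : SmoothManifold n} [CompactSpace M] (g : Metric M) (φ ψ : Smooth M)
    (h : ∀ v : Smooth M, (∀ x, 0 < v x) → ∫ x, φ x * D M g (Fin.cons ψ fun _ => v) x ∂(vol g)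
      = ∫ x, ψ x * D M g (Fin.cons φ fun _ => v) x ∂(vol g)) (u : Fin m → Smooth M) :
    ∫ x, φ x * D M g (Fin.cons ψ u) x ∂(vol g) = ∫ x, ψ x * D M g (Fin.cons φ u) x ∂(vol g) := by
  have hsym : ∀ (a : Smooth M) u (σ : Equiv.Perm (Fin m)),
      (D M g).curryLeft a (fun i => u (σ i)) = (D M g).curryLeft a u := by
    intro a u σ
    change D M g (Fin.cons a fun i => u (σ i)) = D M g (Fin.cons a u)
    rw [← hDs M g (Fin.cons a u) (Equiv.Perm.decomposeFin.symm (0, σ))]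
    congr 1
    funext j
    refine Fin.cases ?_ (fun j => ?_) j <;> simp
  -- Both sides are symmetric and multilinear in the remaining `m` arguments, hence determined by
  -- positive `v` on the diagonal.
  have hpol : ∀ a b : Smooth M, ∫ x, a x * D M g (Fin.cons b u) x ∂(vol g)
      = ∑ T : Finset (Fin m), ((m.factorial : ℝ)⁻¹ * (-1 : ℝ) ^ T.card)
        * ∫ x, a x * D M g (Fin.cons b fun _ => majorant u + ∑ i ∈ Tᶜ, u i) x ∂(vol g) := by
    intro a b
    have hx : ∀ x, a x * D M g (Fin.cons b u) x = ∑ T : Finset (Fin m),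
        ((m.factorial : ℝ)⁻¹ * (-1 : ℝ) ^ T.card)
          * (a x * D M g (Fin.cons b fun _ => majorant u + ∑ i ∈ Tᶜ, u i) x) := by
      intro x
      have h1 := polarization_pos ((D M g).curryLeft b) (hsym b) u x
      change D M g (Fin.cons b u) x = _ * ∑ T : Finset (Fin m), _ *
        D M g (Fin.cons b fun _ => majorant u + ∑ i ∈ Tᶜ, u i) x at h1
      rw [h1, Finset.mul_sum, Finset.mul_sum]
      exact Finset.sum_congr rfl fun T _ => by ring
    simp only [hx]
    rw [integral_finsetSum]
    · exact Finset.sum_congr rfl fun T _ => integral_const_mul _ _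
    · exact fun T _ => ((a * D M g (Fin.cons b fun _ => majorant u + ∑ i ∈ Tᶜ, u i)).integrable
        g).const_mul _
  rw [hpol φ ψ, hpol ψ φ]
  exact Finset.sum_congr rfl fun T _ => by rw [h _ (majorant_add_pos u _)]

/-! ### Localization -/

lemma exists_cutoff {K W : Set (Eucl n)} (hK : IsCompact K) (hW : IsOpen W) (hKW : K ⊆ W) :
    ∃ η : Eucl n → ℝ, ContDiff ℝ ∞ η ∧ HasCompactSupport η ∧ tsupport η ⊆ W ∧
      ∀ y ∈ K, η =ᶠ[nhds y] 1 := by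
  obtain ⟨L, hL, hKL, hLW⟩ := exists_compact_between hK hW hKW
  obtain ⟨L', hL', hLL', hLW'⟩ := exists_compact_between hL hW hLW
  obtain ⟨f, h0, h1, -⟩ := exists_contMDiffMap_zero_one_of_isClosed (n := (⊤ : ℕ∞)) (𝓡 n)
    isOpen_interior.isClosed_compl hL.isClosed (Set.disjoint_compl_left_iff_subset.2 hLL')
  have hs : tsupport f ⊆ L' := by
    refine closure_minimal (fun y hy => ?_) hL'.isClosed
    by_contra hyL
    exact hy (h0 fun h => hyL (interior_subset h))
  refine ⟨f, f.contMDiff.contDiff, hL'.of_isClosed_subset (isClosed_tsupport _) hs,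
    hs.trans hLW', fun y hy => ?_⟩
  filter_upwards [isOpen_interior.mem_nhds (hKL hy)] with z hz using h1 (interior_subset hz)

lemma contDiff_cutoff_mul {M : SmoothManifold n} {e : OpenPartialHomeomorph M (Eucl n)}
    (he : e ∈ charts M) {η : Eucl n → ℝ} (hη : ContDiff ℝ ∞ η) (hs : tsupport η ⊆ e.target)
    (u : Smooth M) : ContDiff ℝ ∞ fun y => η y * u (e.symm y) := by
  refine contDiff_iff_contDiffAt.2 fun y => ?_
  by_cases hy : y ∈ tsupport η
  · exact hη.contDiffAt.mul (contDiffAt_comp_chart_symm he u (hs hy))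
  · refine (contDiffAt_const (c := (0 : ℝ))).congr_of_eventuallyEq ?_
    filter_upwards [(isClosed_tsupport η).isOpen_compl.mem_nhds hy] with z hz
    rw [image_eq_zero_of_notMem_tsupport hz, zero_mul]

lemma IsNatural.eq_zero_of_eventuallyEq {ℓ : ℕ} {D : PolyOp n ℓ} (hD : IsNatural D)
    {M : SmoothManifold n} (g : Metric M) {u : Fin ℓ → Smooth M} {x : M} (j : Fin ℓ)
    (h : u j =ᶠ[nhds x] 0) : D M g u x = 0 := by
  rw [hD.local g (u' := Function.update u j 0) fun i => ?_]
  · rw [(D M g).map_update_zero]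
    rfl
  · by_cases hi : i = j
    · subst hi
      rw [Function.update_self]
      exact h
    · rw [Function.update_of_ne hi]

/-- The extension to a second manifold, by a cutoff, of a function in a chart. -/
def transplantFun {M N : SmoothManifold n} {e : OpenPartialHomeomorph M (Eucl n)} (he : e ∈ charts M)
    {e' : OpenPartialHomeomorph N (Eucl n)} (he' : e' ∈ charts N) {η : Eucl n → ℝ}
    (hη : ContDiff ℝ ∞ η) (hc : HasCompactSupport η) (hs : tsupport η ⊆ e.target)
    (ht : e'.target = Set.univ) (u : Smooth M) : Smooth N :=
  chartFun he' (fun y => η y * u (e.symm y)) (contDiff_cutoff_mul he hη hs u) hc.mul_right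
    (ht ▸ Set.subset_univ _)

/-! ### Transplantation of integrals from one manifold to another -/

section

variable {M N : SmoothManifold n} {e : OpenPartialHomeomorph M (Eucl n)} (he : e ∈ charts M)
    {e' : OpenPartialHomeomorph N (Eucl n)} (he' : e' ∈ charts N) {η : Eucl n → ℝ}
    (hη : ContDiff ℝ ∞ η) (hc : HasCompactSupport η) (hs : tsupport η ⊆ e.target)
    (ht : e'.target = Set.univ)

lemma transplantFun_of_mem (u : Smooth M) {x : N} (hx : x ∈ e'.source) :
    transplantFun he he' hη hc hs ht u x = η (e' x) * u (e.symm (e' x)) :=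
  chartFun_apply he' _ _ _ hx

lemma transplantFun_symm (u : Smooth M) (y : Eucl n) :
    transplantFun he he' hη hc hs ht u (e'.symm y) = η y * u (e.symm y) := by
  have hy : y ∈ e'.target := ht ▸ Set.mem_univ y
  rw [transplantFun_of_mem he he' hη hc hs ht u (e'.map_target hy), e'.right_inv hy]

lemma transplantFun_eventually_zero (u : Smooth M) {y : Eucl n} (hy : y ∈ e.target)
    (hu : u =ᶠ[nhds (e.symm y)] 0) :
    transplantFun he he' hη hc hs ht u =ᶠ[nhds (e'.symm y)] 0 := by
  have hy' : y ∈ e'.target := ht ▸ Set.mem_univ y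
  have h1 : Filter.Tendsto e' (nhds (e'.symm y)) (nhds y) := by
    have := e'.continuousAt (e'.map_target hy')
    rwa [ContinuousAt, e'.right_inv hy'] at this
  have h2 : Filter.Tendsto e.symm (nhds y) (nhds (e.symm y)) := e.symm.continuousAt hy
  filter_upwards [(h2.comp h1).eventually hu, e'.open_source.mem_nhds (e'.map_target hy')] with z hz hzs
  rw [transplantFun_of_mem he he' hη hc hs ht u hzs]
  change η _ * u (e.symm (e' z)) = 0
  rw [show u (e.symm (e' z)) = 0 from hz, mul_zero]

/-- Near each point of `K` both integrands have the same coordinate expression, and off `K` both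
vanish. It suffices that one of `A` and `B` vanishes near the point, so the lemma serves for either
order of the two functions, and the `u j` need no support condition. -/
lemma IsNatural.integral_transplant {m : ℕ} {D : PolyOp n (m + 1)} (hD : IsNatural D)
    {g : Metric M} {g' : Metric N} {V K : Set (Eucl n)} (hV : IsOpen V) (hKV : K ⊆ V)
    (hg : ∀ y ∈ V, gram g e y = gram g' e' y) (hKe : K ⊆ e.target) (hη1 : ∀ y ∈ K, η =ᶠ[nhds y] 1)
    (A B : Smooth M) (u : Fin m → Smooth M)
    (hAB : ∀ x ∉ e.symm '' K, A =ᶠ[nhds x] 0 ∨ B =ᶠ[nhds x] 0) :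
    ∫ x, A x * D M g (Fin.cons B u) x ∂(vol g)
      = ∫ x, transplantFun he he' hη hc hs ht A x
        * D N g' (Fin.cons (transplantFun he he' hη hc hs ht B)
          fun j => transplantFun he he' hη hc hs ht (u j)) x ∂(vol g') := by
  have hcont : ∀ {M : SmoothManifold n} (f h : Smooth M), Continuous fun x => f x * h x :=
    fun f h => f.contMDiff.continuous.mul h.contMDiff.continuous
  have hzero : ∀ {M : SmoothManifold n} {g : Metric M} {A B : Smooth M} {u : Fin m → Smooth M} {x : M},
      (A =ᶠ[nhds x] 0 ∨ B =ᶠ[nhds x] 0) → A x * D M g (Fin.cons B u) x = 0 := by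
    rintro M g A B u x (h | h)
    · rw [show A x = 0 from h.self_of_nhds, zero_mul]
    · rw [hD.eq_zero_of_eventuallyEq g 0 h, mul_zero]
  have hKs : ∀ y ∈ e.target, y ∉ K → e.symm y ∉ e.symm '' K := by
    rintro y hy hyK ⟨z, hz, hzy⟩
    rw [← e.right_inv hy, ← hzy, e.right_inv (hKe hz)] at hyK
    exact hyK hz
  have h1 : ∀ x ∉ e.source, A x * D M g (Fin.cons B u) x = 0 := by
    refine fun x hx => hzero (hAB x ?_)
    rintro ⟨y, hy, rfl⟩
    exact hx (e.map_target (hKe hy))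
  have h2 : ∀ x ∉ e'.source, transplantFun he he' hη hc hs ht A x
        * D N g' (Fin.cons (transplantFun he he' hη hc hs ht B)
          fun j => transplantFun he he' hη hc hs ht (u j)) x = 0 := fun x hx => by
    rw [show transplantFun he he' hη hc hs ht A x = 0 from chartFun_of_notMem he' _ _ _ hx, zero_mul]
  have h3 : ∀ y ∉ e.target, volDensity g' e' y * (transplantFun he he' hη hc hs ht A (e'.symm y)
        * D N g' (Fin.cons (transplantFun he he' hη hc hs ht B)
          fun j => transplantFun he he' hη hc hs ht (u j)) (e'.symm y)) = 0 := fun y hy => by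
    rw [transplantFun_symm, image_eq_zero_of_notMem_tsupport fun h => hy (hs h), zero_mul, zero_mul,
      mul_zero]
  rw [integral_vol_chart g he (hcont _ _) h1, integral_vol_chart g' he' (hcont _ _) h2, ht,
    Measure.restrict_univ, ← setIntegral_eq_integral_of_forall_compl_eq_zero h3]
  refine setIntegral_congr_fun e.open_target.measurableSet fun y hy => ?_
  have hy' : y ∈ e'.target := ht ▸ Set.mem_univ y
  by_cases hyK : y ∈ K
  · have hvol : volDensity g e y = volDensity g' e' y := by
      unfold volDensity
      rw [hg y (hKV hyK)]
    have hu : ∀ u : Smooth M, (fun z => u (e.symm z)) =ᶠ[nhds y]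
        fun z => transplantFun he he' hη hc hs ht u (e'.symm z) := by
      intro u
      filter_upwards [hη1 y hyK] with z hz
      rw [transplantFun_symm, hz]
      exact (one_mul _).symm
    have hDe : D M g (Fin.cons B u) (e.symm y) = D N g' (Fin.cons (transplantFun he he' hη hc hs ht B)
        fun j => transplantFun he he' hη hc hs ht (u j)) (e'.symm y) := by
      refine hD.transplant he he' (e.map_target hy) (e'.map_target hy') ?_ ?_ fun j => ?_
      · rw [e.right_inv hy, e'.right_inv hy']
      · rw [e.right_inv hy]
        filter_upwards [hV.mem_nhds (hKV hyK)] with z hz using hg z hz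
      · rw [e.right_inv hy]
        refine Fin.cases ?_ (fun j => ?_) j
        · exact hu B
        · exact hu (u j)
    rw [hvol, hDe, show A (e.symm y) = _ from (hu A).self_of_nhds]
  · rw [hzero (hAB _ (hKs y hy hyK)), hzero ((hAB _ (hKs y hy hyK)).imp
      (transplantFun_eventually_zero he he' hη hc hs ht A hy)
      (transplantFun_eventually_zero he he' hη hc hs ht B hy)), mul_zero, mul_zero]

end

/-- Self-adjointness of a natural operator is a local property. -/
lemma IsNatural.symmetric_of_supported {m : ℕ} {D : PolyOp n (m + 1)} (hD : IsNatural D)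
    (h : ∀ (g : Metric (sphereManifold n)) (φ ψ : Smooth (sphereManifold n)) u,
      ∫ x, φ x * D _ g (Fin.cons ψ u) x ∂(vol g) = ∫ x, ψ x * D _ g (Fin.cons φ u) x ∂(vol g))
    {M : SmoothManifold n} (g : Metric M) {e : OpenPartialHomeomorph M (Eucl n)} (he : e ∈ charts M)
    (φ ψ : Smooth M) (u : Fin m → Smooth M) (hφ : HasCompactSupport φ) (hφe : tsupport φ ⊆ e.source) :
    ∫ x, φ x * D M g (Fin.cons ψ u) x ∂(vol g) = ∫ x, ψ x * D M g (Fin.cons φ u) x ∂(vol g) := by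
  have hK : IsCompact (e '' tsupport φ) := hφ.image_of_continuousOn (e.continuousOn.mono hφe)
  have hKe : e '' tsupport φ ⊆ e.target := by
    rintro _ ⟨x, hx, rfl⟩
    exact e.map_source (hφe hx)
  obtain ⟨e', he', ht, g', V, hV, hKV, hg⟩ := exists_sphere_model g he hK hKe
  obtain ⟨η, hη, hc, hs, hη1⟩ := exists_cutoff hK (hV.inter e.open_target) (Set.subset_inter hKV hKe)
  have hs' := hs.trans Set.inter_subset_right
  have h0 : ∀ x ∉ e.symm '' (e '' tsupport φ), φ =ᶠ[nhds x] 0 := by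
    intro x hx
    refine notMem_tsupport_iff_eventuallyEq.1 fun hxs => hx ⟨e x, ⟨x, hxs, rfl⟩, e.left_inv (hφe hxs)⟩
  -- The support of `φ` controls both integrals: it is the outer factor in the first and an argument
  -- of `D` in the second.
  rw [hD.integral_transplant he he' hη hc hs' ht hV hKV hg hKe hη1 φ ψ u fun x hx => Or.inl (h0 x hx),
    hD.integral_transplant he he' hη hc hs' ht hV hKV hg hKe hη1 ψ φ u fun x hx => Or.inr (h0 x hx), h]

/-- A compactly supported function is a sum of functions supported in charts. -/
lemma exists_chart_decomposition {M : SmoothManifold n} (φ : Smooth M) (hφ : HasCompactSupport φ) :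
    ∃ (ι : Type) (_ : Fintype ι) (f : ι → Smooth M), φ = ∑ i, f i ∧ ∀ i, HasCompactSupport (f i) ∧
      ∃ e ∈ charts M, tsupport (f i) ⊆ e.source := by
  obtain ⟨t, ht⟩ := hφ.elim_finite_subcover (fun x : M => (chartAt (Eucl n) x).source)
    (fun x => (chartAt (Eucl n) x).open_source)
    (fun x _ => Set.mem_iUnion_of_mem x (mem_chart_source _ x))
  obtain ⟨ρ, hρ⟩ := SmoothPartitionOfUnity.exists_isSubordinate (𝓡 n) (isClosed_tsupport φ)
    (fun x : t => (chartAt (Eucl n) (x : M)).source) (fun x => (chartAt (Eucl n) (x : M)).open_source)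
    (fun x hx => by
      obtain ⟨i, hi, hxi⟩ := Set.mem_iUnion₂.1 (ht hx)
      exact Set.mem_iUnion_of_mem ⟨i, hi⟩ hxi)
  let f : t → Smooth M := fun i => (ρ i : Smooth M) * φ
  refine ⟨t, inferInstance, f, ?_, fun i => ⟨?_, ?_⟩⟩
  · ext x
    rw [smooth_sum_apply]
    change φ x = ∑ i, ρ i x * φ x
    rw [← Finset.sum_mul]
    by_cases hx : x ∈ tsupport φ
    · have := ρ.sum_eq_one hx
      rw [finsum_eq_sum_of_fintype] at this
      rw [this, one_mul]
    · rw [image_eq_zero_of_notMem_tsupport hx, mul_zero]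
  · exact hφ.mul_left
  · refine ⟨_, chartAt_mem_charts (i : M), (closure_mono ?_).trans (hρ i)⟩
    exact Function.support_mul_subset_left _ _

lemma integrable_mul_of_hasCompactSupport {M : SmoothManifold n} (g : Metric M) (f h : Smooth M)
    (hf : HasCompactSupport f) : Integrable (fun x => f x * h x) (vol g) :=
  (f.contMDiff.continuous.mul h.contMDiff.continuous).integrable_of_hasCompactSupport hf.mul_right

lemma IsNatural.hasCompactSupport {ℓ : ℕ} {D : PolyOp n ℓ} (hD : IsNatural D) {M : SmoothManifold n}
    (g : Metric M) {u : Fin ℓ → Smooth M} (j : Fin ℓ) (hu : HasCompactSupport (u j)) :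
    HasCompactSupport (D M g u) := by
  refine hu.of_isClosed_subset (isClosed_tsupport _) (closure_minimal (fun x hx => ?_)
    (isClosed_tsupport _))
  by_contra h
  exact hx (hD.eq_zero_of_eventuallyEq g j (notMem_tsupport_iff_eventuallyEq.1 h))

/-- Both sides are linear in `φ`, which a partition of unity splits into pieces supported in charts;
each piece is treated on the sphere. -/
lemma IsNatural.symmetric_of_sphere {m : ℕ} {D : PolyOp n (m + 1)} (hD : IsNatural D)
    (h : ∀ (g : Metric (sphereManifold n)) (φ ψ : Smooth (sphereManifold n)) u,
      ∫ x, φ x * D _ g (Fin.cons ψ u) x ∂(vol g) = ∫ x, ψ x * D _ g (Fin.cons φ u) x ∂(vol g))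
    {M : SmoothManifold n} (g : Metric M)
    (φ ψ : Smooth M) (u : Fin m → Smooth M) (hφ : HasCompactSupport φ) :
    ∫ x, φ x * D M g (Fin.cons ψ u) x ∂(vol g) = ∫ x, ψ x * D M g (Fin.cons φ u) x ∂(vol g) := by
  obtain ⟨ι, _, f, hf, hfc⟩ := exists_chart_decomposition φ hφ
  have h1 : ∀ x, φ x * D M g (Fin.cons ψ u) x = ∑ i, f i x * D M g (Fin.cons ψ u) x := by
    intro x
    rw [← Finset.sum_mul, ← smooth_sum_apply, ← hf]
  have h2 : ∀ x, ψ x * D M g (Fin.cons φ u) x = ∑ i, ψ x * D M g (Fin.cons (f i) u) x := by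
    intro x
    rw [← Finset.mul_sum, ← smooth_sum_apply]
    have : D M g (Fin.cons φ u) = ∑ i, D M g (Fin.cons (f i) u) := by
      have := map_sum (D M g).curryLeft f Finset.univ
      rw [← hf] at this
      have h3 := congrArg (fun F => F u) this
      simp only [sum_apply] at h3
      exact h3
    rw [this]
  simp only [h1, h2]
  rw [integral_finsetSum _ fun i _ => integrable_mul_of_hasCompactSupport g _ _ (hfc i).1,
    integral_finsetSum _ fun i _ => ?_]
  · refine Finset.sum_congr rfl fun i _ => ?_
    obtain ⟨hc, e, he, hs⟩ := hfc i
    exact hD.symmetric_of_supported h g he _ _ _ hc hs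
  · have := integrable_mul_of_hasCompactSupport g (D M g (Fin.cons (f i) u)) ψ
      (hD.hasCompactSupport g 0 (hfc i).1)
    exact this.congr (Filter.Eventually.of_forall fun x => mul_comm _ _)

/-! ### Existence in rank `2k` -/

lemma cons_tail_swap {V : Type*} {m : ℕ} (u : Fin (m + 2) → V) (j : Fin (m + 1)) :
    (fun i => u ((Equiv.swap 0 j i).succ))
      = (Fin.cons (u j.succ) fun i : Fin m => u (Equiv.swap 0 j i.succ).succ : Fin (m + 1) → V) := by
  funext i
  refine Fin.cases ?_ (fun i => ?_) i <;> simp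

/-- Transpositions generate the permutations. One that fixes the slot `0` is a symmetry of `D`; for
one that moves it, the symmetry of `D` first brings the other slot to the front of the arguments of
`D`. -/
lemma isFormallySelfAdjoint_of_swap {m : ℕ} {D : PolyOp n (m + 1)}
    (hDs : ∀ M g u (σ : Equiv.Perm (Fin (m + 1))), D M g (fun i => u (σ i)) = D M g u)
    (h : ∀ (M : SmoothManifold n) (g : Metric M) (φ ψ : Smooth M) u, HasCompactSupport φ →
      ∫ x, φ x * D M g (Fin.cons ψ u) x ∂(vol g) = ∫ x, ψ x * D M g (Fin.cons φ u) x ∂(vol g)) :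
    IsFormallySelfAdjoint D := by
  intro M g u hu σ
  have h0 : ∀ (u : Fin (m + 2) → Smooth M), (∀ i, HasCompactSupport (u i)) → ∀ j : Fin (m + 1),
      dirichlet D g (fun i => u (Equiv.swap 0 j.succ i)) = dirichlet D g u := by
    intro u hu j
    unfold dirichlet
    dsimp only
    rw [← hDs M g (fun i => u i.succ) (Equiv.swap 0 j),
      ← hDs M g (fun i => u (Equiv.swap 0 j.succ i.succ)) (Equiv.swap 0 j), cons_tail_swap u j,
      cons_tail_swap (fun i => u (Equiv.swap 0 j.succ i)) j, Equiv.swap_apply_left,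
      Equiv.swap_apply_right, h M g _ _ _ (hu _)]
    refine congrArg (fun w => ∫ x, u 0 x * D M g (Fin.cons (u j.succ) w) x ∂(vol g)) ?_
    funext i
    refine congrArg u (Equiv.swap_apply_of_ne_of_ne (Fin.succ_ne_zero _) fun hij => ?_)
    have := Fin.succ_injective _ hij
    rw [← Equiv.swap_apply_left 0 j] at this
    exact Fin.succ_ne_zero i ((Equiv.swap 0 j).injective this)
  have hswap : ∀ (u : Fin (m + 2) → Smooth M), (∀ i, HasCompactSupport (u i)) → ∀ x y : Fin (m + 2),
      dirichlet D g (fun i => u (Equiv.swap x y i)) = dirichlet D g u := by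
    intro u hu x y
    rcases Fin.eq_zero_or_eq_succ x with rfl | ⟨i, rfl⟩
    · rcases Fin.eq_zero_or_eq_succ y with rfl | ⟨j, rfl⟩
      · simp
      · exact h0 u hu j
    · rcases Fin.eq_zero_or_eq_succ y with rfl | ⟨j, rfl⟩
      · rw [Equiv.swap_comm]
        exact h0 u hu i
      · unfold dirichlet
        dsimp only
        rw [Equiv.swap_apply_of_ne_of_ne (Fin.succ_ne_zero i).symm (Fin.succ_ne_zero j).symm]
        have : (fun l : Fin (m + 1) => u (Equiv.swap i.succ j.succ l.succ))
            = fun l => u (Equiv.swap i j l).succ := by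
          funext l
          rw [(Fin.succ_injective _).swap_apply]
        rw [this, hDs M g (fun l => u l.succ) (Equiv.swap i j)]
  induction σ using Equiv.Perm.swap_induction_on generalizing u with
  | one => rfl
  | swap_mul f x y hxy ih =>
    exact (ih (fun i => u (Equiv.swap x y i)) fun i => hu _).trans (hswap u hu x y)

/-- `D` is given on the diagonal by `I`, for conformally related metrics. -/
def HasDiagonal (I : PolyOp n 0) {ℓ : ℕ} (D : PolyOp n ℓ) (b μ : ℝ) : Prop :=
  ∀ (M : SmoothManifold n) (g : Metric M) (v : Smooth M) (hv : ∀ x, 0 < v x) (x : M),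
    D M g (fun _ => v) x = b * v x ^ (n * μ - 1) * value I (powConf g μ v hv) x

lemma powConf_one {M : SmoothManifold n} (g : Metric M) (μ : ℝ) (h : ∀ x, 0 < (1 : Smooth M) x) :
    powConf g μ 1 h = g := by
  refine metric_ext fun x v w => ?_
  change Real.exp (2 * (μ * Real.log 1)) * g.inner x v w = _
  simp

lemma HasDiagonal.apply_one {I : PolyOp n 0} {ℓ : ℕ} {D : PolyOp n ℓ} {b μ : ℝ}
    (hD : HasDiagonal I D b μ) {M : SmoothManifold n} (g : Metric M) :
    D M g (fun _ => 1) = b • value I g := by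
  have h1 : ∀ x, 0 < (1 : Smooth M) x := fun _ => one_pos
  ext x
  rw [hD M g 1 h1, powConf_one]
  change b * 1 ^ (n * μ - 1) * _ = b * _
  rw [Real.one_rpow, mul_one]

/-- Since `(e^{-Υ/μ} v)^{2μ} e^{2Υ} g = v^{2μ} g`, the metric at which `I` is evaluated does not
change, and `Υ` enters only through the power `nμ - 1`. Polarization passes from the diagonal to all
arguments. -/
lemma HasDiagonal.covariant {I : PolyOp n 0} {ℓ : ℕ} {D : PolyOp n ℓ} {b μ : ℝ}
    (hD : HasDiagonal I D b μ) (hμ : μ ≠ 0)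
    (hDs : ∀ M g u (σ : Equiv.Perm (Fin ℓ)), D M g (fun i => u (σ i)) = D M g u)
    {M : SmoothManifold n} (g : Metric M) (Υ : Smooth M) (u : Fin ℓ → Smooth M) (x : M) :
    D M (conformal g Υ) (fun j => expSmooth (-μ⁻¹) Υ * u j) x
      = Real.exp (-(-μ⁻¹ + n) * Υ x) * D M g u x := by
  let f := (D M (conformal g Υ)).compLinearMap fun _ => LinearMap.mulLeft ℝ (expSmooth (-μ⁻¹) Υ)
  change f u x = _
  rw [polarization_pos f (fun u σ => hDs M (conformal g Υ) (fun j => expSmooth (-μ⁻¹) Υ * u j) σ),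
    polarization_pos (D M g) (hDs M g), Finset.mul_sum, Finset.mul_sum, Finset.mul_sum]
  refine Finset.sum_congr rfl fun T _ => ?_
  set v := majorant u + ∑ i ∈ Tᶜ, u i with hvdef
  have hv : ∀ x, 0 < v x := majorant_add_pos u _
  have hv' : ∀ x, 0 < (expSmooth (-μ⁻¹) Υ * v : Smooth M) x := fun x =>
    mul_pos (Real.exp_pos _) (hv x)
  have h1 : f (fun _ => v) x = Real.exp (-(-μ⁻¹ + n) * Υ x) * D M g (fun _ => v) x := by
    change D M (conformal g Υ) (fun _ => expSmooth (-μ⁻¹) Υ * v) x = _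
    rw [hD M _ _ hv', hD M g v hv]
    have h2 : powConf (conformal g Υ) μ (expSmooth (-μ⁻¹) Υ * v) hv' = powConf g μ v hv := by
      refine metric_ext fun z a c => ?_
      change Real.exp (2 * (μ * Real.log (Real.exp (-μ⁻¹ * Υ z) * v z))) *
        (Real.exp (2 * Υ z) * g.inner z a c) = Real.exp (2 * (μ * Real.log (v z))) * g.inner z a c
      rw [Real.log_mul (Real.exp_pos _).ne' (hv z).ne', Real.log_exp, ← mul_assoc, ← Real.exp_add]
      congr 2
      field_simp
      ring
    rw [h2]
    change b * (Real.exp (-μ⁻¹ * Υ x) * v x) ^ (n * μ - 1) * _ = _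
    rw [Real.mul_rpow (Real.exp_pos _).le (hv x).le, ← Real.exp_mul,
      show -μ⁻¹ * Υ x * (n * μ - 1) = -(-μ⁻¹ + n) * Υ x by field_simp; ring]
    ring
  rw [h1]
  ring

lemma HasDiagonal.isConformallyCovariant {I : PolyOp n 0} {ℓ : ℕ} {D : PolyOp n ℓ} {b μ : ℝ}
    (hD : HasDiagonal I D b μ) (hμ : μ ≠ 0)
    (hDs : ∀ M g u (σ : Equiv.Perm (Fin ℓ)), D M g (fun i => u (σ i)) = D M g u) :
    IsConformallyCovariant D := by
  refine ⟨-μ⁻¹, fun M g Υ u _ => ?_⟩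
  unfold dirichlet
  rw [integral_vol_conformal]
  refine integral_congr_ae (Filter.Eventually.of_forall fun x => ?_)
  change Real.exp (n * Υ x) * (Real.exp (-μ⁻¹ * Υ x) * u 0 x * _) = _
  rw [hD.covariant hμ hDs]
  have : Real.exp (n * Υ x) * Real.exp (-μ⁻¹ * Υ x) * Real.exp (-(-μ⁻¹ + n) * Υ x) = 1 := by
    rw [← Real.exp_add, ← Real.exp_add, Real.exp_eq_one_iff]
    ring
  linear_combination (u 0 x * D M g (fun j => u j.succ) x) * this

/-- Existence in rank `2k = m + 2`, the source of the bound on the least rank. -/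
theorem IsCVI.exists_isAssociated {I : PolyOp n 0} {k m : ℕ} (hI : IsCVI I k) (hk : 2 * k = m + 2)
    (hnk : n ≠ 2 * k) : ∃ D : PolyOp n (m + 1), IsAssociated I k D := by
  have hnk' : (n : ℝ) - 2 * k ≠ 0 := by
    rw [sub_ne_zero]
    exact_mod_cast hnk
  have hkm : (2 * k : ℝ) = m + 2 := by exact_mod_cast hk
  have hk0 : (2 * k : ℝ) ≠ 0 := by
    rw [hkm]
    positivity
  -- The value for which `nμ = 2kμ + 2k`; the resulting weight `-1/μ` is `-(n-2k)/(2k)`.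
  let μ : ℝ := 2 * k / (n - 2 * k)
  have hμ : ((n : ℝ) - 2 * k) * μ = 2 * k := mul_div_cancel₀ _ hnk'
  have hμ0 : μ ≠ 0 := div_ne_zero hk0 hnk'
  obtain ⟨E, hE, hEI, D, hD, hDE, hDs⟩ := hI.exists_lower hk hμ hμ0
    ((((n : ℝ) - 2 * k) / ((m + 1 : ℕ) + 1 : ℝ)) ^ (m + 1))
  -- Divide `v D(v) = b E(v) = b v^{2kμ + 2k} I^{v^{2μ}g}` by `v`. The constant `b` is dictated by
  -- the normalization at `v = 1`.
  have hdiag : HasDiagonal I D ((((n : ℝ) - 2 * k) / ((m + 1 : ℕ) + 1 : ℝ)) ^ (m + 1)) μ := by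
    intro M g v hv x
    have h1 := hDE M g v hv x
    have hx := hv x
    refine mul_left_cancel₀ hx.ne' (h1.trans ?_)
    rw [hEI M g v hv, Real.rpow_sub hx, Real.rpow_one, Real.rpow_neg hx.le,
      show (n : ℝ) * μ = μ * (2 * k) + (2 * k : ℕ) by push_cast; linarith, Real.rpow_add hx,
      Real.rpow_natCast]
    have := (Real.rpow_pos_of_pos hx (μ * (2 * k))).ne'
    field_simp
    rw [mul_assoc, ← mul_pow, mul_one_div_cancel hx.ne', one_pow, mul_one]
  refine ⟨D, hD, ?_, hdiag.isConformallyCovariant hμ0 hDs, fun M g => hdiag.apply_one g⟩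
  refine isFormallySelfAdjoint_of_swap hDs fun M g φ ψ u hφ =>
    hD.symmetric_of_sphere (fun g φ ψ u => symmetric_of_diagonal hDs g φ ψ (fun v hv => ?_) u)
      g φ ψ u hφ
  exact hI.symmetric_lower hμ hμ0 hE hEI hD hDE hDs g φ ψ v hv

/-! ### Pointwise consequences of the integral identities -/

lemma exists_bump {M : SmoothManifold n} (x : M) : ∃ χ : Smooth M, HasCompactSupport χ ∧
    (∀ z, 0 ≤ χ z) ∧ χ =ᶠ[nhds x] 1 := by
  obtain ⟨b⟩ : Nonempty (SmoothBumpFunction (𝓡 n) x) := inferInstance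
  exact ⟨⟨b, b.contMDiff⟩, b.hasCompactSupport, fun z => b.nonneg, b.eventuallyEq_one⟩

/-- Test against `χF`, where `χ` is a nonnegative bump function equal to `1` near `x`. -/
lemma eq_zero_of_integral_eq_zero {M : SmoothManifold n} (g : Metric M) (F : Smooth M)
    (h : ∀ ρ : Smooth M, HasCompactSupport ρ → ∫ x, ρ x * F x ∂(vol g) = 0) (x : M) : F x = 0 := by
  obtain ⟨χ, hc, h0, h1⟩ := exists_bump x
  have hc' : HasCompactSupport (χ * F : Smooth M) := hc.mul_right
  have hcont : Continuous fun z => (χ * F : Smooth M) z * F z :=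
    (χ * F).contMDiff.continuous.mul F.contMDiff.continuous
  have hnn : ∀ z, 0 ≤ (χ * F : Smooth M) z * F z := fun z => by
    change 0 ≤ χ z * F z * F z
    rw [mul_assoc]
    exact mul_nonneg (h0 z) (mul_self_nonneg _)
  have h2 := h (χ * F) hc'
  rw [integral_eq_zero_iff_of_nonneg hnn (integrable_mul_of_hasCompactSupport g _ _ hc')] at h2
  have h3 := congrFun ((Continuous.ae_eq_iff_eq (vol g) hcont continuous_const).1 h2) x
  change χ x * F x * F x = 0 at h3
  rw [show χ x = 1 from h1.self_of_nhds, one_mul] at h3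
  exact mul_self_eq_zero.1 h3

/-- Equality of natural expressions may be tested on compactly supported functions. -/
lemma eq_of_hasCompactSupport {ℓ : ℕ} {M : SmoothManifold n} {A B : (Fin ℓ → Smooth M) → M → ℝ}
    (hA : ∀ u u' x, (∀ j, u j =ᶠ[nhds x] u' j) → A u x = A u' x)
    (hB : ∀ u u' x, (∀ j, u j =ᶠ[nhds x] u' j) → B u x = B u' x)
    (h : ∀ u, (∀ j, HasCompactSupport (u j)) → ∀ x, A u x = B u x) (u : Fin ℓ → Smooth M) (x : M) :
    A u x = B u x := by
  obtain ⟨χ, hc, -, h1⟩ := exists_bump x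
  have he : ∀ j, u j =ᶠ[nhds x] (χ * u j : Smooth M) := fun j => by
    filter_upwards [h1] with z hz
    change u j z = χ z * u j z
    rw [hz]
    exact (one_mul _).symm
  rw [hA _ _ x he, hB _ _ x he, h _ fun j => ?_]
  exact HasCompactSupport.mul_right hc

/-- The first argument of the Dirichlet form is an arbitrary test function, so the integral identity
holds pointwise; the factor `e^{(w+n)Υ}` combines the weight of that argument with the change of
volume. Locality removes the condition on the supports. -/
lemma IsNatural.covariant_apply {ℓ : ℕ} {D : PolyOp n ℓ} (hD : IsNatural D) {w : ℝ}
    (hw : ∀ (M : SmoothManifold n) (g : Metric M) (Υ : Smooth M) (u : Fin (ℓ + 1) → Smooth M),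
      (∀ i, HasCompactSupport (u i)) →
        dirichlet D (conformal g Υ) (fun i => expSmooth w Υ * u i) = dirichlet D g u)
    {M : SmoothManifold n} (g : Metric M) (Υ : Smooth M) (u : Fin ℓ → Smooth M) (x : M) :
    Real.exp ((w + n) * Υ x) * D M (conformal g Υ) (fun j => expSmooth w Υ * u j) x
      = D M g u x := by
  refine eq_of_hasCompactSupport
    (A := fun u x => Real.exp ((w + n) * Υ x) * D M (conformal g Υ) (fun j => expSmooth w Υ * u j) x)
    (B := fun u x => D M g u x) (fun u u' x hu => ?_) (fun u u' x hu => hD.local g hu)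
    (fun u hu x => ?_) u x
  · congr 1
    refine hD.local _ fun j => ?_
    filter_upwards [hu j] with z hz
    change _ * u j z = _ * u' j z
    rw [hz]
  · rw [← sub_eq_zero]
    let F : Smooth M := expSmooth (w + n) Υ * D M (conformal g Υ) (fun j => expSmooth w Υ * u j)
    change (F - D M g u) x = 0
    refine eq_zero_of_integral_eq_zero g _ (fun ρ hρ => ?_) x
    have h1 := hw M g Υ (Fin.cons ρ u) (Fin.cases hρ hu)
    unfold dirichlet at h1
    rw [integral_vol_conformal] at h1
    change ∫ x, Real.exp (n * Υ x) * (Real.exp (w * Υ x) * ρ x *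
      D M (conformal g Υ) (fun j => expSmooth w Υ * u j) x) ∂(vol g) = ∫ x, ρ x * D M g u x ∂(vol g) at h1
    have h2 : ∀ x, ρ x * (F - D M g u) x = ρ x * F x - ρ x * D M g u x := fun x => mul_sub _ _ _
    simp only [h2]
    rw [integral_sub (integrable_mul_of_hasCompactSupport g _ _ hρ)
      (integrable_mul_of_hasCompactSupport g _ _ hρ), ← h1, sub_eq_zero]
    refine integral_congr_ae (Filter.Eventually.of_forall fun x => ?_)
    change ρ x * (Real.exp ((w + n) * Υ x) * _) = Real.exp (n * Υ x) * (Real.exp (w * Υ x) * ρ x * _)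
    rw [add_mul, Real.exp_add]
    ring

/-- Apply self-adjointness to the permutations that fix the slot `0`, occupied by an arbitrary test
function. -/
lemma IsNatural.perm_apply {ℓ : ℕ} {D : PolyOp n ℓ} (hD : IsNatural D) (hs : IsFormallySelfAdjoint D)
    (M : SmoothManifold n) (g : Metric M) (u : Fin ℓ → Smooth M) (σ : Equiv.Perm (Fin ℓ)) :
    D M g (fun i => u (σ i)) = D M g u := by
  ext x
  refine eq_of_hasCompactSupport (A := fun u x => D M g (fun i => u (σ i)) x)
    (B := fun u x => D M g u x) (fun u u' x hu => hD.local g fun j => hu _)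
    (fun u u' x hu => hD.local g hu) (fun u hu x => ?_) u x
  rw [← sub_eq_zero]
  change (D M g (fun i => u (σ i)) - D M g u) x = 0
  refine eq_zero_of_integral_eq_zero g _ (fun ρ hρ => ?_) x
  have h1 := hs M g (Fin.cons ρ u) (Fin.cases hρ hu) (Equiv.Perm.decomposeFin.symm (0, σ))
  unfold dirichlet at h1
  simp only [Equiv.Perm.decomposeFin_symm_apply_zero, Fin.cons_zero,
    Equiv.Perm.decomposeFin_symm_apply_succ, Equiv.swap_self, Equiv.refl_apply, Fin.cons_succ] at h1
  have h2 : ∀ x, ρ x * (D M g (fun i => u (σ i)) - D M g u) x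
      = ρ x * D M g (fun i => u (σ i)) x - ρ x * D M g u x := fun x => mul_sub _ _ _
  simp only [h2]
  rw [integral_sub (integrable_mul_of_hasCompactSupport g _ _ hρ)
    (integrable_mul_of_hasCompactSupport g _ _ hρ), h1, sub_self]

lemma conformal_const {M : SmoothManifold n} (g : Metric M) (c : ℝ) :
    conformal g (ContMDiffMap.const c) = homothety g (Real.exp c) (Real.exp_pos c) := by
  refine metric_ext fun x v w => ?_
  change Real.exp (2 * c) * _ = Real.exp c ^ 2 * _
  rw [← Real.exp_nat_mul]
  norm_num

/-- The weight of an associated operator. -/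
lemma IsAssociated.weight_eq {I : PolyOp n 0} {k ℓ : ℕ} (hh : HasHomogeneity I (-(2 * (k : ℝ))))
    {D : PolyOp n ℓ} (hD : IsAssociated I k D) (hnk : n ≠ 2 * k) {w : ℝ}
    (hw : ∀ (M : SmoothManifold n) (g : Metric M) (Υ : Smooth M) (u : Fin (ℓ + 1) → Smooth M),
      (∀ i, HasCompactSupport (u i)) →
        dirichlet D (conformal g Υ) (fun i => expSmooth w Υ * u i) = dirichlet D g u)
    {M : SmoothManifold n} (g : Metric M) {x : M} (hx : value I g x ≠ 0) :
    w = -(((n : ℝ) - 2 * k) / (ℓ + 1)) := by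
  have hnk' : (n : ℝ) - 2 * k ≠ 0 := by
    rw [sub_ne_zero]
    exact_mod_cast hnk
  have hl : (ℓ + 1 : ℝ) ≠ 0 := by positivity
  -- A constant conformal factor turns covariance into homogeneity. Where `I` does not vanish, the
  -- exponents give `w + n + ℓw - 2k = 0`.
  have h1 := hD.natural.covariant_apply hw g (ContMDiffMap.const 1) (fun _ => 1) x
  have h2 : (fun _ : Fin ℓ => expSmooth w (ContMDiffMap.const 1 : Smooth M) * 1)
      = fun _ => Real.exp w • 1 := by
    funext _
    ext z
    change Real.exp (w * 1) * 1 = Real.exp w * 1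
    rw [mul_one w]
  have h3 : value I (homothety g (Real.exp 1) (Real.exp_pos 1)) = Real.exp (-(2 * k)) • value I g := by
    unfold value
    rw [hh M g, smul_apply, ← Real.exp_mul, one_mul]
  rw [h2, (D M _).map_smul_univ, hD.apply_one, hD.apply_one, conformal_const, h3] at h1
  set a := (((n : ℝ) - 2 * k) / (ℓ + 1)) with ha
  have ha0 : a ≠ 0 := div_ne_zero hnk' hl
  change Real.exp ((w + n) * 1) * ((∏ _ : Fin ℓ, Real.exp w) * (a ^ ℓ * (Real.exp (-(2 * k)) * value I g x)))
    = a ^ ℓ * value I g x at h1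
  rw [Finset.prod_const, Finset.card_univ, Fintype.card_fin, ← Real.exp_nat_mul] at h1
  have h4 : Real.exp ((w + n) * 1 + ℓ * w + -(2 * k)) = 1 := by
    rw [Real.exp_add, Real.exp_add]
    have hne : a ^ ℓ * value I g x ≠ 0 := mul_ne_zero (pow_ne_zero _ ha0) hx
    refine mul_right_cancel₀ hne ?_
    linear_combination h1
  rw [Real.exp_eq_one_iff] at h4
  rw [ha, ← neg_div, eq_div_iff hl]
  linarith

/-- Covariance with `Υ = a⁻¹ log v`, where `a = (n-2k)/(ℓ+1)`, turns every argument `v` into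
`e^{-aΥ} v = 1`, where `D` is known. -/
lemma IsAssociated.hasDiagonal {I : PolyOp n 0} {k ℓ : ℕ} {D : PolyOp n ℓ} (hD : IsAssociated I k D)
    (hnk : n ≠ 2 * k)
    (hcov : ∀ (M : SmoothManifold n) (g : Metric M) (Υ : Smooth M) (u : Fin ℓ → Smooth M) (x : M),
      Real.exp ((-(((n : ℝ) - 2 * k) / (ℓ + 1)) + n) * Υ x) * D M (conformal g Υ)
        (fun j => expSmooth (-(((n : ℝ) - 2 * k) / (ℓ + 1))) Υ * u j) x = D M g u x) :
    HasDiagonal I D ((((n : ℝ) - 2 * k) / (ℓ + 1)) ^ ℓ) (((n : ℝ) - 2 * k) / (ℓ + 1))⁻¹ := by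
  have hnk' : (n : ℝ) - 2 * k ≠ 0 := by
    rw [sub_ne_zero]
    exact_mod_cast hnk
  have hl : (ℓ + 1 : ℝ) ≠ 0 := by positivity
  set a := (((n : ℝ) - 2 * k) / (ℓ + 1)) with ha
  have ha0 : a ≠ 0 := div_ne_zero hnk' hl
  intro M g v hv x
  have h1 := hcov M g (a⁻¹ • logSmooth v hv) (fun _ => v) x
  have h2 : (fun _ : Fin ℓ => expSmooth (-a) (a⁻¹ • logSmooth v hv) * v) = fun _ => 1 := by
    funext _
    ext z
    change Real.exp (-a * (a⁻¹ * Real.log (v z))) * v z = 1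
    rw [show -a * (a⁻¹ * Real.log (v z)) = -Real.log (v z) by field_simp, Real.exp_neg,
      Real.exp_log (hv z), inv_mul_cancel₀ (hv z).ne']
  rw [h2, hD.apply_one] at h1
  rw [← h1]
  change Real.exp ((-a + n) * (a⁻¹ * Real.log (v x))) * (a ^ ℓ * _) = _
  rw [Real.rpow_def_of_pos (hv x),
    show (-a + n) * (a⁻¹ * Real.log (v x)) = Real.log (v x) * (n * a⁻¹ - 1) by field_simp; ring]
  change _ = a ^ ℓ * _ * value I (conformal g _) x
  ring

/-- By polarization, a symmetric operator is determined by its diagonal on positive functions, and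
there it is prescribed by `I`. -/
lemma HasDiagonal.unique {I : PolyOp n 0} {ℓ : ℕ} {D D' : PolyOp n ℓ} {b μ : ℝ}
    (hD : HasDiagonal I D b μ) (hD' : HasDiagonal I D' b μ)
    (hDs : ∀ M g u (σ : Equiv.Perm (Fin ℓ)), D M g (fun i => u (σ i)) = D M g u)
    (hDs' : ∀ M g u (σ : Equiv.Perm (Fin ℓ)), D' M g (fun i => u (σ i)) = D' M g u) : D' = D := by
  funext M g
  ext u x
  rw [polarization_pos _ (hDs M g), polarization_pos _ (hDs' M g)]
  congr 1
  refine Finset.sum_congr rfl fun T _ => ?_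
  rw [hD M g _ (majorant_add_pos u _), hD' M g _ (majorant_add_pos u _)]

/-! ### Iterated linearization -/

/-- The first `j` of `ℓ` arguments are `v`, and the others are `1`. -/
def firstArgs {M : SmoothManifold n} (ℓ j : ℕ) (v : Smooth M) (i : Fin ℓ) : Smooth M :=
  if (i : ℕ) < j then v else 1

lemma update_firstArgs {M : SmoothManifold n} {ℓ j : ℕ} (hj : j < ℓ) (v : Smooth M) {i : Fin ℓ}
    (hi : j ≤ i) : Function.update (firstArgs ℓ j v) i v
      = fun l => firstArgs ℓ (j + 1) v (Equiv.swap i ⟨j, hj⟩ l) := by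
  funext l
  unfold firstArgs
  by_cases hl : l = i
  · subst hl
    simp
  rw [Function.update_of_ne hl]
  by_cases hlj : l = ⟨j, hj⟩
  · subst hlj
    have hne : (i : ℕ) ≠ j := fun h => hl (Fin.ext h.symm)
    rw [Equiv.swap_apply_right, if_neg (by simp), if_neg (by omega)]
  · rw [Equiv.swap_apply_of_ne_of_ne hl hlj]
    have hne : (l : ℕ) ≠ j := fun h => hlj (Fin.ext h)
    congr 1
    exact propext (by omega)

/-- By induction, the `j`-th linearization is a multiple of `D(v, …, v, 1, …, 1)` with `j` arguments
`v`: each step replaces one of the `ℓ - j` remaining arguments `1` by `a v`, where `a =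
(n-2k)/(ℓ+1)`. This accounts for the descending factorial and for the powers of `a`. -/
lemma IsAssociated.iterLinearization_eq {I : PolyOp n 0} {k ℓ : ℕ} {D : PolyOp n ℓ}
    (hD : IsAssociated I k D) (hnk : n ≠ 2 * k)
    (hcov : ∀ (M : SmoothManifold n) (g : Metric M) (Υ : Smooth M) (u : Fin ℓ → Smooth M) (x : M),
      Real.exp ((-(((n : ℝ) - 2 * k) / (ℓ + 1)) + n) * Υ x) * D M (conformal g Υ)
        (fun j => expSmooth (-(((n : ℝ) - 2 * k) / (ℓ + 1))) Υ * u j) x = D M g u x)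
    {j : ℕ} (hj : j ≤ ℓ) (M : SmoothManifold n) (g : Metric M) (v : Smooth M) (x : M) :
    iterLinearization I k (ℓ + 1) j M g v x
      = ((((n : ℝ) - 2 * k) / (ℓ + 1)) ^ (ℓ - j))⁻¹ * ℓ.descFactorial j * D M g (firstArgs ℓ j v) x := by
  have hnk' : (n : ℝ) - 2 * k ≠ 0 := by
    rw [sub_ne_zero]
    exact_mod_cast hnk
  have hl : (ℓ + 1 : ℝ) ≠ 0 := by positivity
  have hexp : ((((ℓ + 1 : ℕ) : ℝ) - 1) * n + 2 * k) / ((ℓ + 1 : ℕ) : ℝ)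
      = -(((n : ℝ) - 2 * k) / (ℓ + 1)) + n := by
    push_cast
    field_simp
    ring
  have hexp' : -((n : ℝ) - 2 * k) / ((ℓ + 1 : ℕ) : ℝ) = -(((n : ℝ) - 2 * k) / (ℓ + 1)) := by
    push_cast
    ring
  have happ := hD.apply_one
  set a := (((n : ℝ) - 2 * k) / (ℓ + 1)) with ha
  have ha0 : a ≠ 0 := div_ne_zero hnk' hl
  induction j generalizing g v with
  | zero =>
    have : firstArgs ℓ 0 v = fun _ => 1 := by
      funext i
      simp [firstArgs]
    rw [this, happ]
    change value I g x = _ * _ * (a ^ ℓ * value I g x)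
    have := pow_ne_zero ℓ ha0
    simp
    field_simp
  | succ j ih =>
    have hjl : j < ℓ := hj
    change deriv _ 0 = _
    -- By covariance the operator of `e^{2tv} g` becomes that of `g`. The arguments `e^{-atv} v`
    -- turn back into `v`, while an argument `1` becomes `e^{atv}`, so all dependence on `t` sits in
    -- the last `ℓ - j` arguments.
    have hfun : (fun t : ℝ => Real.exp (((((ℓ + 1 : ℕ) : ℝ) - 1) * n + 2 * k) / ((ℓ + 1 : ℕ) : ℝ)
        * (t * v x)) * iterLinearization I k (ℓ + 1) j M (conformal g (t • v))
          (expSmooth (-((n : ℝ) - 2 * k) / ((ℓ + 1 : ℕ) : ℝ)) (t • v) * v) x)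
        = fun t : ℝ => (a ^ (ℓ - j))⁻¹ * ℓ.descFactorial j * D M g (fun i =>
            expSmooth t (if (i : ℕ) < j then 0 else a • v) * firstArgs ℓ j v i) x := by
      funext t
      rw [ih hjl.le, hexp, hexp', ← hcov M g (t • v)]
      change Real.exp ((-a + n) * (t * v x)) * _ = _ * (Real.exp ((-a + n) * (t * v x)) * _)
      rw [mul_left_comm]
      refine congrArg (fun u => _ * (_ * D M (conformal g (t • v)) u x)) ?_
      funext i
      unfold firstArgs
      split_ifs with h
      · ext z
        change _ = _ * (Real.exp (t * 0) * v z)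
        rw [mul_zero, Real.exp_zero, one_mul]
        rfl
      · ext z
        change 1 = Real.exp (-a * (t * v z)) * (Real.exp (t * (a * v z)) * 1)
        rw [mul_one, ← Real.exp_add, eq_comm, Real.exp_eq_one_iff]
        ring
    rw [hfun, ((hD.natural.hasDerivAt_exp g _ _ x).const_mul _).deriv]
    have hterm : ∀ i : Fin ℓ, D M g (Function.update (firstArgs ℓ j v) i
        ((if (i : ℕ) < j then 0 else a • v) * firstArgs ℓ j v i)) x
        = if (i : ℕ) < j then 0 else a * D M g (firstArgs ℓ (j + 1) v) x := by
      intro i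
      split_ifs with h
      · rw [zero_mul, (D M g).map_update_zero]
        rfl
      · have h1 : firstArgs ℓ j v i = 1 := if_neg h
        rw [h1, mul_one, (D M g).map_update_smul, update_firstArgs hjl v (not_lt.1 h),
          hD.natural.perm_apply hD.selfAdjoint]
        rfl
    simp only [hterm]
    have hcard : (Finset.univ.filter fun i : Fin ℓ => ¬ (i : ℕ) < j).card = ℓ - j := by
      have h1 : (Finset.univ.filter fun i : Fin ℓ => (i : ℕ) < j).card = j := by
        rw [Fin.card_filter_val_lt]
        omega
      have h2 := Finset.card_filter_add_card_filter_not (s := (Finset.univ : Finset (Fin ℓ)))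
        (fun i : Fin ℓ => (i : ℕ) < j)
      rw [h1, Finset.card_univ, Fintype.card_fin] at h2
      omega
    have hsum : ∑ i : Fin ℓ, (if (i : ℕ) < j then 0 else a * D M g (firstArgs ℓ (j + 1) v) x)
        = (ℓ - j : ℕ) * (a * D M g (firstArgs ℓ (j + 1) v) x) := by
      rw [← hcard, ← nsmul_eq_mul, ← Finset.sum_const, Finset.sum_filter]
      exact Finset.sum_congr rfl fun i _ => by split_ifs <;> rfl
    rw [hsum, Nat.descFactorial_succ, show ℓ - j = ℓ - (j + 1) + 1 by omega, pow_succ]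
    have := pow_ne_zero (ℓ - (j + 1)) ha0
    push_cast
    field_simp

/-! ### Conclusion -/

/-- For `I = 0` no weight can be read off, and uniqueness could not be derived in higher rank by
that method; but `I` is then associated with itself in rank `1`, which is therefore the least rank.
-/
lemma isAssociated_of_value_eq_zero {I : PolyOp n 0} {k : ℕ} (hI : IsNatural I)
    (h0 : ∀ (M : SmoothManifold n) (g : Metric M) (x : M), value I g x = 0) : IsAssociated I k I := by
  have hz : ∀ (M : SmoothManifold n) (g : Metric M) (u : Fin 0 → Smooth M) (x : M), I M g u x = 0 := by
    intro M g u x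
    rw [← h0 M g x, Subsingleton.elim u]
    rfl
  refine ⟨hI, fun M g u _ σ => ?_, ⟨0, fun M g Υ u _ => ?_⟩, fun M g => ?_⟩
  · simp [dirichlet, hz]
  · simp [dirichlet, hz]
  · rw [pow_zero, one_smul, value, Subsingleton.elim (fun _ => 1)]

/-- Uniqueness and the linearization formula, for the least rank. -/
lemma IsAssociated.unique_and_linearization {I : PolyOp n 0} {k ℓ : ℕ} (hI : IsCVI I k)
    (hnk : n ≠ 2 * k) {D : PolyOp n ℓ} (hD : IsAssociated I k D)
    (hleast : ∀ m, ∀ D' : PolyOp n m, IsAssociated I k D' → ℓ ≤ m) :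
    (∀ D' : PolyOp n ℓ, IsAssociated I k D' → D' = D) ∧
      ∀ (M : SmoothManifold n) (g : Metric M) (v : Smooth M) (x : M),
        D M g (fun _ => v) x = 1 / (ℓ.factorial : ℝ) * iterLinearization I k (ℓ + 1) ℓ M g v x := by
  -- Minimality of the rank matters only when `I` vanishes identically; otherwise a point with `I ≠
  -- 0` fixes the weight in any rank.
  by_cases h0 : ∀ (M : SmoothManifold n) (g : Metric M) (x : M), value I g x = 0
  · obtain rfl : ℓ = 0 := Nat.le_zero.1 (hleast 0 I (isAssociated_of_value_eq_zero hI.1 h0))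
    have h1 : ∀ {D : PolyOp n 0}, IsAssociated I k D → D = I := by
      intro D hD
      funext M g
      ext u x
      have := hD.apply_one M g
      rw [pow_zero, one_smul, value, Subsingleton.elim (fun _ => 1) u,
        Subsingleton.elim (fun i : Fin 0 => _) u] at this
      rw [this]
    refine ⟨fun D' hD' => (h1 hD').trans (h1 hD).symm, fun M g v x => ?_⟩
    rw [h1 hD, Nat.factorial_zero, Nat.cast_one, div_one, one_mul, Subsingleton.elim (fun _ => v)]
    rfl
  · push Not at h0
    obtain ⟨M₀, g₀, x₀, hx₀⟩ := h0
    have hcov : ∀ {D : PolyOp n ℓ}, IsAssociated I k D →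
        ∀ (M : SmoothManifold n) (g : Metric M) (Υ : Smooth M) (u : Fin ℓ → Smooth M) (x : M),
        Real.exp ((-(((n : ℝ) - 2 * k) / (ℓ + 1)) + n) * Υ x) * D M (conformal g Υ)
          (fun j => expSmooth (-(((n : ℝ) - 2 * k) / (ℓ + 1))) Υ * u j) x = D M g u x := by
      intro D hD M g Υ u x
      obtain ⟨w, hw⟩ := hD.covariant
      rw [← hD.weight_eq hI.2.1 hnk hw g₀ hx₀]
      exact hD.natural.covariant_apply hw g Υ u x
    refine ⟨fun D' hD' => (hD.hasDiagonal hnk (hcov hD)).unique (hD'.hasDiagonal hnk (hcov hD'))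
      (hD.natural.perm_apply hD.selfAdjoint) (hD'.natural.perm_apply hD'.selfAdjoint),
      fun M g v x => ?_⟩
    have h1 : firstArgs ℓ ℓ v = fun _ => v := funext fun i => if_pos i.2
    rw [hD.iterLinearization_eq hnk (hcov hD) le_rfl, h1, Nat.sub_self, pow_zero,
      Nat.descFactorial_self]
    have : (ℓ.factorial : ℝ) ≠ 0 := by positivity
    field_simp

end CPD

end

theorem theorem1p1 (n k : ℕ) (hk : 1 ≤ k) (hnk : n ≠ 2 * k)
    (I : CPD.PolyOp n 0) (hI : CPD.IsCVI I k) :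
    ∃ ℓ : ℕ, ℓ + 1 ≤ 2 * k ∧
      IsLeast {m : ℕ | ∃ D : CPD.PolyOp n m, CPD.IsAssociated I k D} ℓ ∧
      ∃ D : CPD.PolyOp n ℓ, CPD.IsAssociated I k D ∧
        (∀ D' : CPD.PolyOp n ℓ, CPD.IsAssociated I k D' → D' = D) ∧
        ∀ (M : CPD.SmoothManifold n) (g : CPD.Metric M) (v : CPD.Smooth M) (x : M),
          D M g (fun _ => v) x =
            1 / (ℓ.factorial : ℝ) * CPD.iterLinearization I k (ℓ + 1) ℓ M g v x := by
  -- Operators are indexed by the number `ℓ` of arguments, one less than the rank: existence in rank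
  -- `2k` means `2k - 1 = m + 1` arguments.
  obtain ⟨m, hm⟩ : ∃ m, 2 * k = m + 2 := ⟨2 * k - 2, by omega⟩
  let S : Set ℕ := {m : ℕ | ∃ D : CPD.PolyOp n m, CPD.IsAssociated I k D}
  have hS : m + 1 ∈ S := hI.exists_isAssociated hm hnk
  obtain ⟨D, hD⟩ : sInf S ∈ S := Nat.sInf_mem ⟨_, hS⟩
  refine ⟨sInf S, ?_, ⟨⟨D, hD⟩, fun l hl => Nat.sInf_le hl⟩, D, hD,
    hD.unique_and_linearization hI hnk fun l D' hD' => Nat.sInf_le ⟨D', hD'⟩⟩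
  have := Nat.sInf_le hS
  omega
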